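/- Computation takes place on a word RAM with words of $O(\log n)$ bits (unit-cost arithmetic, comparison, bitwise and shift operations and indirect addressing; the input is given in memory). In the All-Pairs Shortest Paths problem (APSP) we are given an undirected graph on $n$ vertices with positive integer edge weights bounded by a polynomial in $n$, and must output, for every pair $u,v$ of vertices, a shortest path from $u$ to $v$ (represented by the distance and the second vertex of a shortest path). In the Viterbi Path problem we are given an $n\times n$ matrix $A$ and an $n\times\sigma$ matrix $B$ with non-negative entries and a sequence $s_1,\dots,s_T\in\{1,\dots,\sigma\}$ of observations, and must output a sequence of states $u_0=1,u_1,\dots,u_T\in\{1,\dots,n\}$ that minimizes $$\sum_{t=1}^{T}\bigl[A(u_{t-1},u_t)+B(u_t,s_t)\bigr].$$ A problem *requires $\Omega(f)^{1-o(1)}$ time* if for every $\varepsilon>0$ there is a $c$ such that no algorithm solves, in time $O(f^{1-\varepsilon})$, all instances (with $n\ge 1$) whose integer weights or matrix entries are at most $n^{c}$. The APSP Conjecture states that APSP requires $\Omega(n^3)^{1-o(1)}$ time. **Theorem 1.** Assume the APSP Conjecture. Then the Viterbi Path problem with $n$ states and $T=n^{\Theta(1)}$ observations requires $\Omega(Tn^2)^{1-o(1)}$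 time. More precisely, for every rational $\alpha>0$, the Viterbi Path problem restricted to $T=\lceil n^{\alpha}\rceil$ observations, to alphabets of size $\sigma\le T$ and to non-negative integer entries bounded by a polynomial in $n$ requires $\Omega(Tn^2)^{1-o(1)}$ time. -/

import Mathlib

/-!
# Fine-grained lower bounds on the word RAM: APSP and the Viterbi Path problem
-/

namespace WordRAM

/-- The binary word operations, each of unit cost. -/
inductive BinOp where
  | add | sub | mul | div | mod | land | lor | xor | shl | shr | lt | eq

/-- The value of a word operation (subtraction is truncated at `0`, division by `0` is `0`,
comparisons return `1` or `0`).  That the result fits into a word is checked in `Exec`. -/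
def BinOp.eval : BinOp → ℕ → ℕ → ℕ
  | .add, a, b => a + b
  | .sub, a, b => a - b
  | .mul, a, b => a * b
  | .div, a, b => a / b
  | .mod, a, b => a % b
  | .land, a, b => a &&& b
  | .lor, a, b => a ||| b
  | .xor, a, b => a ^^^ b
  | .shl, a, b => a <<< b
  | .shr, a, b => a >>> b
  | .lt, a, b => if a < b then 1 else 0
  | .eq, a, b => if a = b then 1 else 0

/-- Programs.  Registers and arrays are named by fixed numbers in the program text, so that a
program uses only finitely many registers and arrays; only the address inside an array is
computed at run time (indirect addressing). -/
inductive Prog where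
  /-- do nothing -/
  | skip
  /-- `const r k`: register `r` becomes the constant `k` -/
  | const (r k : ℕ)
  /-- `op o r a b`: register `r` becomes `o` applied to registers `a` and `b` -/
  | op (o : BinOp) (r a b : ℕ)
  /-- `load r i a`: register `r` becomes the cell of array `i` whose address is in register `a` -/
  | load (r i a : ℕ)
  /-- `store i a b`: the cell of array `i` whose address is in register `a` becomes the content
  of register `b` -/
  | store (i a b : ℕ)
  /-- sequential composition -/
  | seq (P Q : Prog)
  /-- `branch r P Q`: run `P` if register `r` is nonzero, and `Q` otherwise -/
  | branch (r : ℕ) (P Q : Prog)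
  /-- `loop r P`: run `P` as long as register `r` is nonzero -/
  | loop (r : ℕ) (P : Prog)

/-- A memory configuration: the registers, and the arrays (`mem i a` is cell `a` of array `i`). -/
structure State where
  reg : ℕ → ℕ
  mem : ℕ → ℕ → ℕ

/-- Write `x` into register `r`. -/
def State.setReg (s : State) (r x : ℕ) : State :=
  { s with reg := Function.update s.reg r x }

/-- Write `x` into cell `a` of array `i`. -/
def State.setMem (s : State) (i a x : ℕ) : State :=
  { s with mem := Function.update s.mem i (Function.update (s.mem i) a x) }

/-- `Exec M P s s' t`: on the word RAM whose words hold the integers `0, …, M - 1`, the program `P`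
started in `s` halts in `s'` after exactly `t` steps, and no word overflows on the way.  Every
elementary instruction and every test costs one step.  A run that overflows or that does not halt
has no derivation. -/
inductive Exec (M : ℕ) : Prog → State → State → ℕ → Prop where
  | skip (s : State) : Exec M .skip s s 1
  | const (s : State) (r k : ℕ) (h : k < M) : Exec M (.const r k) s (s.setReg r k) 1
  | op (s : State) (o : BinOp) (r a b : ℕ) (h : o.eval (s.reg a) (s.reg b) < M) :
      Exec M (.op o r a b) s (s.setReg r (o.eval (s.reg a) (s.reg b))) 1
  | load (s : State) (r i a : ℕ) (h : s.mem i (s.reg a) < M) :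
      Exec M (.load r i a) s (s.setReg r (s.mem i (s.reg a))) 1
  | store (s : State) (i a b : ℕ) (ha : s.reg a < M) (hb : s.reg b < M) :
      Exec M (.store i a b) s (s.setMem i (s.reg a) (s.reg b)) 1
  | seq {P Q : Prog} {s s' s'' : State} {t t' : ℕ} (hP : Exec M P s s' t)
      (hQ : Exec M Q s' s'' t') : Exec M (.seq P Q) s s'' (t + t')
  | branch_true {r : ℕ} {P Q : Prog} {s s' : State} {t : ℕ} (hr : s.reg r ≠ 0)
      (hP : Exec M P s s' t) : Exec M (.branch r P Q) s s' (t + 1)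
  | branch_false {r : ℕ} {P Q : Prog} {s s' : State} {t : ℕ} (hr : s.reg r = 0)
      (hQ : Exec M Q s s' t) : Exec M (.branch r P Q) s s' (t + 1)
  | loop_true {r : ℕ} {P : Prog} {s s' s'' : State} {t t' : ℕ} (hr : s.reg r ≠ 0)
      (hP : Exec M P s s' t) (hL : Exec M (.loop r P) s' s'' t') :
      Exec M (.loop r P) s s'' (t + t' + 1)
  | loop_false {r : ℕ} {P : Prog} {s : State} (hr : s.reg r = 0) : Exec M (.loop r P) s s 1

/-- A computational problem: instances of each size parameter `n`, the initial memory that presents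
an instance to the machine, and the final memories that hold a correct answer. -/
structure Problem where
  Inst : ℕ → Type
  init : ∀ {n : ℕ}, Inst n → State
  Correct : ∀ {n : ℕ}, Inst n → State → Prop

/-- `Q` is solvable in time `O(f(n))` on the word RAM with words of `O(log n)` bits: there are one
program and constants `k`, `K` such that on every instance of size `n ≥ 1` the program halts with a
correct answer after at most `K * f n` steps, all words staying below `(n + 2) ^ k`. -/
def SolvableInTime (Q : Problem) (f : ℕ → ℝ) : Prop :=
  ∃ (P : Prog) (k : ℕ) (K : ℝ), ∀ n : ℕ, 1 ≤ n → ∀ x : Q.Inst n, ∃ (s : State) (t : ℕ),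
    Exec ((n + 2) ^ k) P (Q.init x) s t ∧ (t : ℝ) ≤ K * f n ∧ Q.Correct x s

/-- "The problem with polynomially bounded input numbers requires time `Ω(f)^(1-o(1))`".  Here `Q c`
is the problem whose input numbers are at most `n ^ c`; no `ε > 0` admits `O(f ^ (1 - ε))`-time
algorithms for all polynomial bounds. -/
def RequiresTime (Q : ℕ → Problem) (f : ℕ → ℝ) : Prop :=
  ∀ ε : ℝ, 0 < ε → ∃ c : ℕ, ¬ SolvableInTime (Q c) (fun n => f n ^ (1 - ε))

end WordRAM

open WordRAM

/-! ### All-Pairs Shortest Paths -/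

/-- An undirected graph on `n` vertices with integer edge weights in `{1, …, W}`. -/
structure WeightedGraph (n W : ℕ) where
  graph : SimpleGraph (Fin n)
  weight : Sym2 (Fin n) → ℕ
  weight_mem : ∀ e ∈ graph.edgeSet, 1 ≤ weight e ∧ weight e ≤ W

namespace WeightedGraph

variable {n W : ℕ}

/-- The total weight of a walk. -/
def walkWeight (G : WeightedGraph n W) {u v : Fin n} (p : G.graph.Walk u v) : ℕ :=
  (p.edges.map G.weight).sum

/-- `p` has minimum weight among all walks with the same end points. -/
def IsShortest (G : WeightedGraph n W) {u v : Fin n} (p : G.graph.Walk u v) : Prop :=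
  ∀ q : G.graph.Walk u v, G.walkWeight p ≤ G.walkWeight q

open Classical in
/-- Entry of the weighted adjacency matrix; `0` stands for a missing edge. -/
noncomputable def entry (G : WeightedGraph n W) (u v : Fin n) : ℕ :=
  if G.graph.Adj u v then G.weight s(u, v) else 0

end WeightedGraph

/-- All-Pairs Shortest Paths with integer weights in `{1, …, n ^ c}`.
Input: register `0` holds `n`, and array `0` holds the weighted adjacency matrix, row by row.
Output: for all `u, v`, cell `u * n + v` of array `1` holds the distance from `u` to `v`, and the
same cell of array `2` holds the second vertex of a shortest path from `u` to `v` (which is `u` if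
`u = v`); distance `0` is written if there is no path from `u` to `v`. -/
noncomputable def apspProblem (c : ℕ) : Problem where
  Inst n := WeightedGraph n (n ^ c)
  init {n} G :=
    { reg := fun r => if r = 0 then n else 0
      mem := fun i a =>
        if h : i = 0 ∧ a < n * n then
          G.entry ⟨a / n, Nat.div_lt_of_lt_mul h.2⟩
            ⟨a % n, Nat.mod_lt a (Nat.pos_of_ne_zero fun h0 => by simp [h0] at h)⟩
        else 0 }
  Correct {n} G s := ∀ u v : Fin n,
    (G.graph.Reachable u v → ∃ p : G.graph.Walk u v, G.IsShortest p ∧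
      s.mem 1 (u * n + v) = G.walkWeight p ∧ s.mem 2 (u * n + v) = (p.snd : ℕ)) ∧
    (¬ G.graph.Reachable u v → s.mem 1 (u * n + v) = 0)

/-- The APSP Conjecture: APSP on undirected graphs with `n` vertices and polynomially bounded
positive integer weights requires time `Ω(n^3)^(1-o(1))`. -/
def APSPConjecture : Prop :=
  RequiresTime apspProblem (fun n => (n : ℝ) ^ 3)

/-! ### The Viterbi Path problem -/

/-- The cost of the state sequence `U = (u_0, …, u_T)` for the negative log-probabilities `A` (of
transitions) and `B` (of observations) and the observations `S = (s_1, …, s_T)`; the sequence `S` is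
indexed from `0`, so that `s_{t+1}` is `S t`. -/
def viterbiCost {R : Type*} [AddCommMonoid R] {n σ T : ℕ} (A : Matrix (Fin n) (Fin n) R)
    (B : Matrix (Fin n) (Fin σ) R) (S : Fin T → Fin σ) (U : Fin (T + 1) → Fin n) : R :=
  ∑ t : Fin T, (A (U t.castSucc) (U t.succ) + B (U t.succ) (S t))

/-- `U` is a solution of the Viterbi Path instance `(A, B, S)`: it starts in the first state (the
one with index `0`) and has minimum cost among all such sequences. -/
def IsViterbiPath {R : Type*} [AddCommMonoid R] [LE R] {n σ T : ℕ} (A : Matrix (Fin n) (Fin n) R)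
    (B : Matrix (Fin n) (Fin σ) R) (S : Fin T → Fin σ) (U : Fin (T + 1) → Fin n) : Prop :=
  (U 0 : ℕ) = 0 ∧ ∀ U' : Fin (T + 1) → Fin n, (U' 0 : ℕ) = 0 →
    viterbiCost A B S U ≤ viterbiCost A B S U'

/-- An instance of Viterbi Path with `n` states, `T` observations, an alphabet of size
`σ ≤ T`, and non-negative integer entries that are at most `W`. -/
structure ViterbiInstance (n T W : ℕ) where
  σ : ℕ
  σ_le : σ ≤ T
  A : Matrix (Fin n) (Fin n) ℕ
  B : Matrix (Fin n) (Fin σ) ℕ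
  S : Fin T → Fin σ
  A_le : ∀ u v, A u v ≤ W
  B_le : ∀ u s, B u s ≤ W

/-- The number of observations `T = ⌈n ^ α⌉`. -/
noncomputable def numObs (α : ℚ) (n : ℕ) : ℕ := ⌈(n : ℝ) ^ (α : ℝ)⌉₊

/-- Viterbi Path with `n` states, `T = ⌈n ^ α⌉` observations and entries in `{0, …, n ^ c}`.
Input: registers `0, 1, 2` hold `n, T, σ`, arrays `0, 1, 2` hold `A` and `B`, row by row, and `S`.
Output: array `3` holds an optimal state sequence `u_0, …, u_T`. -/
noncomputable def viterbiProblem (α : ℚ) (c : ℕ) : Problem where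
  Inst n := ViterbiInstance n (numObs α n) (n ^ c)
  init {n} x :=
    { reg := fun r =>
        if r = 0 then n else if r = 1 then numObs α n else if r = 2 then x.σ else 0
      mem := fun i a =>
        if h : i = 0 ∧ a < n * n then
          x.A ⟨a / n, Nat.div_lt_of_lt_mul h.2⟩
            ⟨a % n, Nat.mod_lt a (Nat.pos_of_ne_zero fun h0 => by simp [h0] at h)⟩
        else if h : i = 1 ∧ a < x.σ * n then
          x.B ⟨a / x.σ, Nat.div_lt_of_lt_mul h.2⟩
            ⟨a % x.σ, Nat.mod_lt a (Nat.pos_of_ne_zero fun h0 => by simp [h0] at h)⟩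
        else if h : i = 2 ∧ a < numObs α n then (x.S ⟨a, h.2⟩ : ℕ)
        else 0 }
  Correct {n} x s := ∃ U : Fin (numObs α n + 1) → Fin n, IsViterbiPath x.A x.B x.S U ∧
    ∀ t : Fin (numObs α n + 1), s.mem 3 t = (U t : ℕ)

/-! APSP is repeated min-plus squaring of the distance matrix `d`, and O(log n) squarings suffice.
All entries of one square are found by a simultaneous binary search with O(log n) rounds. A round
asks, for a matrix `q` of thresholds, which pairs `(i, j)` lie in a negative triangle, meaning `d i
k + d k j < q i j` for some `k`. It remains to answer such a round with a Viterbi algorithm.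

For a set of rows, a set of columns and a set of middle vertices, one Viterbi instance finds a
negative triangle if there is one. Each middle vertex `k` gets two consecutive observations. Staying
idle through both costs a fixed `V`. Visiting row `i` and then column `j` costs `d i k + (V - q i j)
+ d k j`, and every other behaviour costs at least `V`. So the optimum falls below `V` times the
number of middle vertices exactly when a negative triangle exists, and then an optimal sequence
passes through one (`exists_negative_of_isViterbiPath`).

Let `α = p / q` and `e = p + 2 * q`. The vertex set is padded to `N = a ^ e`, rows and columns are
cut into blocks of `a ^ q`, and middle vertices into blocks of `a ^ p`. This gives exactly `N ^ 2`
block triples. The instances have `(3 * a) ^ q` states and hence exactly `(3 * a) ^ p` observations,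
so one call has nominal cost `T * m ^ 2 = (3 * a) ^ e`, which is linear in `n`. A call either finds
a triangle, which settles its pair for this round, or certifies that its block triple contains none.
Hence `2 * N ^ 2` calls finish a round (`Sweeping.step`, `Sweeping.swept`). A Viterbi time of `(T *
m ^ 2) ^ (1 - δ)` thus yields APSP in time about `n ^ 2 * n ^ (1 - δ) * log ^ 2 n`, which is `O((n ^
3) ^ (1 - δ / 6))`; see `solvable_apsp`.

All of this is carried out on the word RAM. A small structured language is compiled to machine code
with explicit time and word bounds (`Runs`). The Viterbi program expects fresh memory at every call,
and clearing all the addresses it may have used could cost more than the call itself. Its cells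
therefore carry a time stamp, and cells with an outdated stamp are read as zero (`exec_simulate`).
-/

namespace WordRAM

/-! ### A structured language on top of the word RAM -/

/-- The scalar variables of the APSP algorithm. -/
inductive Var where
  | n | base | dim | rowBlock | midBlock | rowBlocks | midBlocks | states | obs | cap
  | ctr | phase | step | iter | idx | rowStart | colStart | midStart | hit | epoch
  deriving DecidableEq

/-- The arrays of the APSP algorithm; `value i` and `stamp i` hold array `i` of a simulated
program. -/
inductive Arr where
  | input | distOut | nextOut | dist | low | lowNew | thr | wit | next | nextNew
  | value (i : ℕ) | stamp (i : ℕ)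
  deriving DecidableEq

theorem Var.ctorIdx_injective : Function.Injective Var.ctorIdx :=
  Function.LeftInverse.injective Var.ofNat_ctorIdx

/-- Registers from `tmp` on are free for intermediate results. -/
def tmp : ℕ := 32

theorem Var.ctorIdx_lt (v : Var) : v.ctorIdx < tmp := by
  cases v <;> decide

/-- The number of the machine array that holds an array of the algorithm. -/
def Arr.num : Arr → ℕ
  | .input => 0
  | .distOut => 1
  | .nextOut => 2
  | .dist => 3
  | .low => 4
  | .lowNew => 5
  | .thr => 6
  | .wit => 7
  | .next => 8
  | .nextNew => 9
  | .value i => 10 + 2 * i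
  | .stamp i => 11 + 2 * i

theorem Arr.num_injective : Function.Injective Arr.num := by
  intro x y h
  cases x <;> cases y <;> simp [Arr.num] at h ⊢ <;> omega

/-- The contents of the variables and the arrays. -/
@[ext] structure Store where
  reg : Var → ℕ
  arr : Arr → ℕ → ℕ

namespace Store

/-- Write `k` into the variable `x`. -/
def setReg (σ : Store) (x : Var) (k : ℕ) : Store :=
  { σ with reg := Function.update σ.reg x k }

/-- Replace the array `x`. -/
def setArr (σ : Store) (x : Arr) (f : ℕ → ℕ) : Store :=
  { σ with arr := Function.update σ.arr x f }

@[simp] theorem reg_setReg (σ : Store) (x : Var) (k : ℕ) (y : Var) :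
    (σ.setReg x k).reg y = if y = x then k else σ.reg y := by
  simp [setReg, Function.update_apply]

@[simp] theorem arr_setReg (σ : Store) (x : Var) (k : ℕ) : (σ.setReg x k).arr = σ.arr := rfl

@[simp] theorem reg_setArr (σ : Store) (x : Arr) (f : ℕ → ℕ) : (σ.setArr x f).reg = σ.reg := rfl

@[simp] theorem arr_setArr (σ : Store) (x : Arr) (f : ℕ → ℕ) (y : Arr) :
    (σ.setArr x f).arr y = if y = x then f else σ.arr y := by
  simp [setArr, Function.update_apply]

/-- All numbers in the store are at most `X`. -/
structure Bounded (X : ℕ) (σ : Store) : Prop where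
  reg : ∀ x, σ.reg x ≤ X
  arr : ∀ x a, σ.arr x a ≤ X

theorem Bounded.setReg {X : ℕ} {σ : Store} (hσ : σ.Bounded X) (x : Var) {k : ℕ} (hk : k ≤ X) :
    (σ.setReg x k).Bounded X where
  reg y := by
    have := hσ.reg y
    simp only [reg_setReg]
    split <;> assumption
  arr := hσ.arr

theorem Bounded.setArr {X : ℕ} {σ : Store} (hσ : σ.Bounded X) (x : Arr) {f : ℕ → ℕ}
    (hf : ∀ a, f a ≤ X) : (σ.setArr x f).Bounded X where
  reg := hσ.reg
  arr y a := by
    have := hσ.arr y a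
    simp only [arr_setArr]
    split
    · exact hf a
    · assumption

end Store

/-- The machine state `s` holds the store `σ`. -/
structure Holds (s : State) (σ : Store) : Prop where
  reg : ∀ x : Var, s.reg x.ctorIdx = σ.reg x
  arr : ∀ (x : Arr) (a : ℕ), s.mem x.num a = σ.arr x a

@[simp] theorem State.reg_setReg (s : State) (r k r' : ℕ) :
    (s.setReg r k).reg r' = if r' = r then k else s.reg r' := by
  simp [State.setReg, Function.update_apply]

@[simp] theorem State.mem_setReg (s : State) (r k : ℕ) : (s.setReg r k).mem = s.mem := rfl

@[simp] theorem State.reg_setMem (s : State) (i a k : ℕ) : (s.setMem i a k).reg = s.reg := rfl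

theorem State.mem_setMem (s : State) (i a k j b : ℕ) :
    (s.setMem i a k).mem j b = if j = i ∧ b = a then k else s.mem j b := by
  by_cases h : j = i
  · subst h
    simp [State.setMem, Function.update_apply]
  · simp [State.setMem, h]

theorem Holds.of_eq {s s' : State} {σ : Store} (h : Holds s σ)
    (hreg : ∀ r < tmp, s'.reg r = s.reg r) (hmem : s'.mem = s.mem) : Holds s' σ where
  reg x := by rw [hreg _ x.ctorIdx_lt, h.reg]
  arr x a := by rw [hmem, h.arr]

theorem Holds.setReg {s : State} {σ : Store} (h : Holds s σ) (x : Var) (k : ℕ) :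
    Holds (s.setReg x.ctorIdx k) (σ.setReg x k) where
  reg y := by simp [h.reg, Var.ctorIdx_injective.eq_iff]
  arr y a := by simp [h.arr]

theorem Holds.setMem {s : State} {σ : Store} (h : Holds s σ) (x : Arr) (a k : ℕ) :
    Holds (s.setMem x.num a k) (σ.setArr x (Function.update (σ.arr x) a k)) where
  reg y := by simp [h.reg]
  arr y b := by
    simp only [State.mem_setMem, h.arr, Arr.num_injective.eq_iff]
    by_cases hy : y = x
    · subst hy
      simp [Function.update_apply]
    · simp [hy]

/-- The operations in expressions. -/
inductive Arith where
  | add | sub | mul | div | mod | lt | eq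

/-- The corresponding machine operation. -/
def Arith.toBinOp : Arith → BinOp
  | .add => .add
  | .sub => .sub
  | .mul => .mul
  | .div => .div
  | .mod => .mod
  | .lt => .lt
  | .eq => .eq

/-- Expressions over the variables and the arrays. -/
inductive Expr where
  | lit (k : ℕ)
  | var (x : Var)
  | op (o : Arith) (e f : Expr)
  | read (x : Arr) (e : Expr)
  | ite (c e f : Expr)

namespace Expr

instance (k : ℕ) : OfNat Expr k := ⟨lit k⟩
instance : Add Expr := ⟨op .add⟩
instance : Sub Expr := ⟨op .sub⟩
instance : Mul Expr := ⟨op .mul⟩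
instance : Div Expr := ⟨op .div⟩
instance : Mod Expr := ⟨op .mod⟩

/-- The value of an expression. -/
def eval (σ : Store) : Expr → ℕ
  | lit k => k
  | var x => σ.reg x
  | op o e f => o.toBinOp.eval (e.eval σ) (f.eval σ)
  | read x e => σ.arr x (e.eval σ)
  | ite c e f => if c.eval σ = 0 then f.eval σ else e.eval σ

/-- The size of an expression, which bounds its evaluation time and the numbers that occur. -/
def size : Expr → ℕ
  | lit k => k + 1
  | var _ => 1
  | op _ e f => e.size + f.size + 1
  | read _ e => e.size + 1
  | ite c e f => c.size + e.size + f.size + 1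

/-- Powers of an expression. -/
def pow (e : Expr) : ℕ → Expr
  | 0 => lit 1
  | k + 1 => op .mul (e.pow k) e

/-! ### Evaluation and size of expressions. -/

section Eval

variable (σ : Store) (e f c : Expr)

@[simp] theorem eval_var (x : Var) : (var x).eval σ = σ.reg x := rfl
@[simp] theorem eval_lit (k : ℕ) : (lit k).eval σ = k := rfl
@[simp] theorem eval_zero : (0 : Expr).eval σ = 0 := rfl
@[simp] theorem eval_one : (1 : Expr).eval σ = 1 := rfl
@[simp] theorem eval_two : (2 : Expr).eval σ = 2 := rfl
@[simp] theorem eval_three : (3 : Expr).eval σ = 3 := rfl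
@[simp] theorem eval_read (x : Arr) : (read x e).eval σ = σ.arr x (e.eval σ) := rfl
@[simp] theorem eval_add : (e + f).eval σ = e.eval σ + f.eval σ := rfl
@[simp] theorem eval_sub : (e - f).eval σ = e.eval σ - f.eval σ := rfl
@[simp] theorem eval_mul : (e * f).eval σ = e.eval σ * f.eval σ := rfl
@[simp] theorem eval_div : (e / f).eval σ = e.eval σ / f.eval σ := rfl
@[simp] theorem eval_mod : (e % f).eval σ = e.eval σ % f.eval σ := rfl
@[simp] theorem eval_lt : (op .lt e f).eval σ = if e.eval σ < f.eval σ then 1 else 0 := rfl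
@[simp] theorem eval_eq : (op .eq e f).eval σ = if e.eval σ = f.eval σ then 1 else 0 := rfl
theorem eval_ite : (ite c e f).eval σ = if c.eval σ = 0 then f.eval σ else e.eval σ := rfl

@[simp] theorem eval_ite_lt (a b : Expr) : (ite (op .lt a b) e f).eval σ =
    if a.eval σ < b.eval σ then e.eval σ else f.eval σ := by
  rw [eval_ite, eval_lt]
  by_cases h : a.eval σ < b.eval σ <;> simp [h]

@[simp] theorem eval_ite_eq (a b : Expr) : (ite (op .eq a b) e f).eval σ =
    if a.eval σ = b.eval σ then e.eval σ else f.eval σ := by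
  rw [eval_ite, eval_eq]
  by_cases h : a.eval σ = b.eval σ <;> simp [h]

@[simp] theorem eval_pow (k : ℕ) : (e.pow k).eval σ = e.eval σ ^ k := by
  induction k with
  | zero => rfl
  | succ k ih => rw [pow_succ, ← ih]; rfl

@[simp] theorem size_var (x : Var) : (var x).size = 1 := rfl
@[simp] theorem size_lit (k : ℕ) : (lit k).size = k + 1 := rfl
@[simp] theorem size_zero : (0 : Expr).size = 1 := rfl
@[simp] theorem size_one : (1 : Expr).size = 2 := rfl
@[simp] theorem size_two : (2 : Expr).size = 3 := rfl
@[simp] theorem size_three : (3 : Expr).size = 4 := rfl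
@[simp] theorem size_read (x : Arr) : (read x e).size = e.size + 1 := rfl
@[simp] theorem size_op (o : Arith) : (op o e f).size = e.size + f.size + 1 := rfl
@[simp] theorem size_add : (e + f).size = e.size + f.size + 1 := rfl
@[simp] theorem size_sub : (e - f).size = e.size + f.size + 1 := rfl
@[simp] theorem size_mul : (e * f).size = e.size + f.size + 1 := rfl
@[simp] theorem size_div : (e / f).size = e.size + f.size + 1 := rfl
@[simp] theorem size_mod : (e % f).size = e.size + f.size + 1 := rfl
@[simp] theorem size_ite : (ite c e f).size = c.size + e.size + f.size + 1 := rfl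

@[simp] theorem size_pow (k : ℕ) : (e.pow k).size = k * (e.size + 1) + 2 := by
  induction k with
  | zero => simp [pow]
  | succ k ih => simp only [pow, size_op, ih]; ring

end Eval

/-- Multiplication is the worst case: it adds exponents. A fixed expression over polynomially
bounded data therefore never leaves words of O(log n) bits. -/
theorem eval_lt_pow {X : ℕ} {σ : Store} (hσ : σ.Bounded X) (e : Expr) :
    e.eval σ < (X + 2) ^ e.size := by
  induction e with
  | lit k =>
    calc k < 2 ^ k := Nat.lt_two_pow_self
      _ ≤ (X + 2) ^ k := Nat.pow_le_pow_left (by omega) _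
      _ ≤ _ := Nat.pow_le_pow_right (by omega) (by simp)
  | var x =>
    have := hσ.reg x
    simp; omega
  | read x e ih =>
    calc σ.arr x (e.eval σ) < (X + 2) ^ 1 := by
          have := hσ.arr x (e.eval σ)
          rw [pow_one]
          omega
      _ ≤ _ := Nat.pow_le_pow_right (by omega) (by simp)
  | ite c e f _ ihe ihf =>
    simp only [eval]
    split
    · exact ihf.trans_le (Nat.pow_le_pow_right (by omega) (by simp; omega))
    · exact ihe.trans_le (Nat.pow_le_pow_right (by omega) (by simp; omega))
  | op o e f ihe ihf =>
    have he : 1 ≤ (X + 2) ^ e.size := Nat.one_le_pow _ _ (by omega)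
    have hf : 1 ≤ (X + 2) ^ f.size := Nat.one_le_pow _ _ (by omega)
    have hpow : (X + 2) ^ (op o e f).size = (X + 2) ^ e.size * (X + 2) ^ f.size * (X + 2) := by
      simp only [size]; ring
    simp only [eval]
    rw [hpow]
    set u := (X + 2) ^ e.size
    set v := (X + 2) ^ f.size
    have hu : u ≤ u * v := Nat.le_mul_of_pos_right _ hf
    have hv : v ≤ u * v := Nat.le_mul_of_pos_left _ he
    have h2 : u * v * 2 ≤ u * v * (X + 2) := Nat.mul_le_mul_left _ (by omega)
    have huv : 1 ≤ u * v := he.trans hu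
    cases o <;> simp only [Arith.toBinOp, BinOp.eval]
    · omega
    · omega
    · have := Nat.mul_lt_mul'' ihe ihf
      omega
    · have := Nat.div_le_self (e.eval σ) (f.eval σ)
      omega
    · have := Nat.mod_le (e.eval σ) (f.eval σ)
      omega
    · split <;> omega
    · split <;> omega

/-- Code that computes the value of an expression into register `tmp + d`. -/
def code : Expr → ℕ → Prog
  | lit k, d => .const (tmp + d) k
  -- The machine has no move instruction; the bitwise or of a register with itself copies it.
  | var x, d => .op .lor (tmp + d) x.ctorIdx x.ctorIdx
  | op o e f, d =>
    .seq (.seq (e.code d) (f.code (d + 1))) (.op o.toBinOp (tmp + d) (tmp + d) (tmp + d + 1))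
  | read x e, d => .seq (e.code d) (.load (tmp + d) x.num (tmp + d))
  | ite c e f, d => .seq (c.code d) (.branch (tmp + d) (e.code d) (f.code d))

/-- The registers from `tmp` on form an evaluation stack. Code at depth `d` leaves everything below
`tmp + d` untouched, so the first operand survives the evaluation of the second. -/
theorem exec_code {X M : ℕ} {σ : Store} (hσ : σ.Bounded X) (e : Expr)
    (hM : (X + 2) ^ e.size ≤ M) (d : ℕ) (s : State) (hs : Holds s σ) :
    ∃ s' t, Exec M (e.code d) s s' t ∧ t ≤ e.size ∧ (∀ r < tmp + d, s'.reg r = s.reg r) ∧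
      s'.mem = s.mem ∧ s'.reg (tmp + d) = e.eval σ := by
  have hX : 0 < X + 2 := by omega
  induction e generalizing d s with
  | lit k =>
    refine ⟨_, 1, .const _ _ _ ((eval_lt_pow hσ (lit k)).trans_le hM), by simp, ?_, rfl, by simp⟩
    intro r hr
    simp [hr.ne]
  | var x =>
    refine ⟨_, 1, .op _ _ _ _ _ ?_, by simp, ?_, rfl, by simp [BinOp.eval, hs.reg]⟩
    · simpa [BinOp.eval, hs.reg] using (eval_lt_pow hσ (var x)).trans_le hM
    · intro r hr
      simp [hr.ne]
  | read x e ih =>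
    obtain ⟨s₁, t₁, hex, ht, hr₁, hm₁, hv₁⟩ :=
      ih (le_trans (Nat.pow_le_pow_right hX (by simp)) hM) d s hs
    have hval : s₁.mem x.num (s₁.reg (tmp + d)) = (read x e).eval σ := by
      rw [hm₁, hv₁, hs.arr]; rfl
    refine ⟨_, _, .seq hex (.load _ _ _ _ ?_), by simpa using ht, ?_, hm₁, by simp [hval]⟩
    · rw [hval]
      exact (eval_lt_pow hσ _).trans_le hM
    · intro r hr
      simp [hr.ne, hr₁ r hr]
  | ite c e f ihc ihe ihf =>
    obtain ⟨s₁, t₁, hex, ht, hr₁, hm₁, hv₁⟩ :=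
      ihc (le_trans (Nat.pow_le_pow_right hX (by simp; omega)) hM) d s hs
    have hs₁ : Holds s₁ σ := hs.of_eq (fun r hr => hr₁ r (by omega)) hm₁
    by_cases hc : c.eval σ = 0
    · obtain ⟨s₂, t₂, hex₂, ht₂, hr₂, hm₂, hv₂⟩ :=
        ihf (le_trans (Nat.pow_le_pow_right hX (by simp; omega)) hM) d s₁ hs₁
      refine ⟨s₂, _, .seq hex (.branch_false (by rw [hv₁, hc]) hex₂), by simp; omega, ?_,
        hm₂.trans hm₁, by simp [hv₂, hc, eval_ite]⟩
      intro r hr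
      rw [hr₂ r hr, hr₁ r hr]
    · obtain ⟨s₂, t₂, hex₂, ht₂, hr₂, hm₂, hv₂⟩ :=
        ihe (le_trans (Nat.pow_le_pow_right hX (by simp; omega)) hM) d s₁ hs₁
      refine ⟨s₂, _, .seq hex (.branch_true (by rwa [hv₁]) hex₂), by simp; omega, ?_,
        hm₂.trans hm₁, by simp [hv₂, hc, eval_ite]⟩
      intro r hr
      rw [hr₂ r hr, hr₁ r hr]
  | op o e f ihe ihf =>
    obtain ⟨s₁, t₁, hex, ht, hr₁, hm₁, hv₁⟩ :=
      ihe (le_trans (Nat.pow_le_pow_right hX (by simp; omega)) hM) d s hs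
    have hs₁ : Holds s₁ σ := hs.of_eq (fun r hr => hr₁ r (by omega)) hm₁
    obtain ⟨s₂, t₂, hex₂, ht₂, hr₂, hm₂, hv₂⟩ :=
      ihf (le_trans (Nat.pow_le_pow_right hX (by simp; omega)) hM) (d + 1) s₁ hs₁
    have hval : o.toBinOp.eval (s₂.reg (tmp + d)) (s₂.reg (tmp + d + 1)) = (op o e f).eval σ := by
      rw [hr₂ _ (by omega), hv₁, add_assoc, hv₂]; rfl
    refine ⟨_, _, .seq (.seq hex hex₂) (.op _ _ _ _ _ ?_), by simp; omega, ?_,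
      hm₂.trans hm₁, by simp [hval]⟩
    · rw [hval]
      exact (eval_lt_pow hσ _).trans_le hM
    · intro r hr
      simp [hr.ne, hr₂ r (by omega), hr₁ r hr]

end Expr

/-- Started in a machine state that holds `σ`, the program `P` halts after at most `B` steps in a
state that holds some store with numbers at most `X` and with the property `Q`. -/
def Runs (M X : ℕ) (P : Prog) (σ : Store) (B : ℕ) (Q : Store → Prop) : Prop :=
  ∀ s, Holds s σ → ∃ s' t σ', Exec M P s s' t ∧ t ≤ B ∧ Holds s' σ' ∧ σ'.Bounded X ∧ Q σ'

namespace Runs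

variable {M X D : ℕ} {P P' : Prog} {σ : Store} {B B' : ℕ} {Q Q' : Store → Prop}

theorem mono (h : Runs M X P σ B Q) (hB : B ≤ B') (hQ : ∀ σ', σ'.Bounded X → Q σ' → Q' σ') :
    Runs M X P σ B' Q' := by
  intro s hs
  obtain ⟨s', t, σ', hex, ht, hs', hσ', hq⟩ := h s hs
  exact ⟨s', t, σ', hex, ht.trans hB, hs', hσ', hQ _ hσ' hq⟩

theorem seq (h : Runs M X P σ B Q) (h' : ∀ σ', σ'.Bounded X → Q σ' → Runs M X P' σ' B' Q') :
    Runs M X (.seq P P') σ (B + B') Q' := by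
  intro s hs
  obtain ⟨s', t, σ', hex, ht, hs', hσ', hq⟩ := h s hs
  obtain ⟨s'', t', σ'', hex', ht', hs'', hσ'', hq'⟩ := h' _ hσ' hq s' hs'
  exact ⟨s'', _, σ'', .seq hex hex', by omega, hs'', hσ'', hq'⟩

theorem loop_zero {x : Var} (hσ : σ.Bounded X) (hx : σ.reg x = 0) :
    Runs M X (.loop x.ctorIdx P) σ 1 (· = σ) := fun s hs =>
  ⟨s, 1, σ, .loop_false (by rw [hs.reg, hx]), le_rfl, hs, hσ, rfl⟩

/-- The index of the invariant is the number of iterations still to come, so termination and running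
time are read off from it. -/
theorem loop (x : Var) (I : ℕ → Store → Prop) (hzero : ∀ σ, I 0 σ → σ.reg x = 0)
    (hsucc : ∀ k σ, σ.Bounded X → I (k + 1) σ → σ.reg x ≠ 0 ∧ Runs M X P σ B (I k)) (k : ℕ)
    (hσ : σ.Bounded X) (hI : I k σ) :
    Runs M X (.loop x.ctorIdx P) σ (k * (B + 1) + 1) (I 0) := by
  induction k generalizing σ with
  | zero =>
    exact (loop_zero hσ (hzero σ hI)).mono (by simp) (fun _ _ h => h ▸ hI)
  | succ k ih =>
    intro s hs
    obtain ⟨hx, hrun⟩ := hsucc k σ hσ hI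
    obtain ⟨s', t, σ', hex, ht, hs', hσ', hq⟩ := hrun s hs
    obtain ⟨s'', t', σ'', hex', ht', hs'', hσ'', hq'⟩ := ih hσ' hq s' hs'
    refine ⟨s'', _, σ'', .loop_true (by rwa [hs.reg]) hex hex', ?_, hs'', hσ'', hq'⟩
    linarith

end Runs

namespace Prog

/-- Assign the value of an expression to a variable. -/
def assign (x : Var) (e : Expr) : Prog :=
  .seq (e.code 0) (.op .lor x.ctorIdx tmp tmp)

/-- Write the value of `f` into the cell of `x` whose address is the value of `e`. -/
def write (x : Arr) (e f : Expr) : Prog :=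
  .seq (.seq (e.code 0) (f.code 1)) (.store x.num tmp (tmp + 1))

/-- A conditional. -/
def cond (e : Expr) (P P' : Prog) : Prog :=
  .seq (e.code 0) (.branch tmp P P')

/-- Assign `e` to the variable `x` for all values of the counter below `m`, in decreasing order. -/
def fold (m : Expr) (x : Var) (e : Expr) : Prog :=
  .seq (assign .ctr m) (.loop Var.ctr.ctorIdx (.seq (assign .ctr (.var .ctr - 1)) (assign x e)))

/-- Write the value of `e` into the cells of `x` below `m`; the counter holds the address. -/
def fill (m : Expr) (x : Arr) (e : Expr) : Prog :=
  .seq (assign .ctr m)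
    (.loop Var.ctr.ctorIdx (.seq (assign .ctr (.var .ctr - 1)) (write x (.var .ctr) e)))

end Prog

/-! ### Correctness and cost of assignments, conditionals and counted loops. -/

namespace Runs

variable {M X D : ℕ} {P P' : Prog} {σ : Store} {B B' : ℕ} {Q Q' : Store → Prop}

theorem assign (hM : (X + 2) ^ D ≤ M) (hσ : σ.Bounded X) {e : Expr} (he : e.size ≤ D)
    (hX : e.eval σ ≤ X) (x : Var) :
    Runs M X (.assign x e) σ (D + 1) (· = σ.setReg x (e.eval σ)) := by
  intro s hs
  obtain ⟨s', t, hex, ht, hr, hm, hv⟩ := e.exec_code hσ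
    (le_trans (Nat.pow_le_pow_right (by omega) he) hM) 0 s hs
  have hs' : Holds s' σ := hs.of_eq hr hm
  have hlor : BinOp.eval .lor (s'.reg tmp) (s'.reg tmp) = e.eval σ := by
    rw [add_zero] at hv
    simp [BinOp.eval, hv]
  refine ⟨_, _, _, .seq hex (.op _ _ _ _ _ ?_), by omega, ?_, hσ.setReg x hX, rfl⟩
  · rw [hlor]
    exact (e.eval_lt_pow hσ).trans_le (le_trans (Nat.pow_le_pow_right (by omega) he) hM)
  · rw [hlor]
    exact hs'.setReg _ _

theorem write (hM : (X + 2) ^ D ≤ M) (hσ : σ.Bounded X) {e f : Expr} (he : e.size ≤ D)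
    (hf : f.size ≤ D) (hX : f.eval σ ≤ X) (x : Arr) :
    Runs M X (.write x e f) σ (2 * D + 1)
      (· = σ.setArr x (Function.update (σ.arr x) (e.eval σ) (f.eval σ))) := by
  intro s hs
  have hpow : ∀ {e : Expr}, e.size ≤ D → (X + 2) ^ e.size ≤ M := fun he =>
    le_trans (Nat.pow_le_pow_right (by omega) he) hM
  obtain ⟨s₁, t₁, hex, ht, hr, hm, hv⟩ := e.exec_code hσ (hpow he) 0 s hs
  have hs₁ : Holds s₁ σ := hs.of_eq hr hm
  obtain ⟨s₂, t₂, hex₂, ht₂, hr₂, hm₂, hv₂⟩ := f.exec_code hσ (hpow hf) 1 s₁ hs₁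
  have hs₂ : Holds s₂ σ := hs₁.of_eq (fun r h => hr₂ r (by omega)) hm₂
  have haddr : s₂.reg tmp = e.eval σ := by rw [hr₂ _ (by omega), ← hv, add_zero]
  refine ⟨_, _, _, .seq (.seq hex hex₂) (.store _ _ _ _ ?_ ?_), by omega, ?_, ?_, rfl⟩
  · rw [haddr]
    exact (e.eval_lt_pow hσ).trans_le (hpow he)
  · rw [hv₂]
    exact (f.eval_lt_pow hσ).trans_le (hpow hf)
  · rw [haddr, hv₂]
    exact hs₂.setMem _ _ _
  · refine hσ.setArr x fun a => ?_
    rw [Function.update_apply]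
    split
    · exact hX
    · exact hσ.arr _ _

theorem cond (hM : (X + 2) ^ D ≤ M) (hσ : σ.Bounded X) {e : Expr} (he : e.size ≤ D)
    (h : e.eval σ ≠ 0 → Runs M X P σ B Q) (h' : e.eval σ = 0 → Runs M X P' σ B Q) :
    Runs M X (.cond e P P') σ (D + 1 + B) Q := by
  intro s hs
  obtain ⟨s₁, t₁, hex, ht, hr, hm, hv⟩ := e.exec_code hσ
    (le_trans (Nat.pow_le_pow_right (by omega) he) hM) 0 s hs
  have hs₁ : Holds s₁ σ := hs.of_eq hr hm
  rw [add_zero] at hv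
  by_cases hc : e.eval σ = 0
  · obtain ⟨s', t, σ', hex', ht', hs', hσ', hq⟩ := h' hc s₁ hs₁
    exact ⟨s', _, σ', .seq hex (.branch_false (by rw [hv, hc]) hex'), by omega, hs', hσ', hq⟩
  · obtain ⟨s', t, σ', hex', ht', hs', hσ', hq⟩ := h hc s₁ hs₁
    exact ⟨s', _, σ', .seq hex (.branch_true (by rwa [hv]) hex'), by omega, hs', hσ', hq⟩

/-- The rule for `fold`; the invariant is indexed by the counter. -/
theorem fold (hM : (X + 2) ^ D ≤ M) (hD : 4 ≤ D) (hσ : σ.Bounded X) {m e : Expr}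
    (hm : m.size ≤ D) (hmX : m.eval σ ≤ X) (he : e.size ≤ D) {x : Var} (hx : x ≠ .ctr)
    (I : ℕ → ℕ → Prop) (hI : I (m.eval σ) (σ.reg x))
    (hstep : ∀ k v, k < m.eval σ → I (k + 1) v →
      e.eval ((σ.setReg .ctr k).setReg x v) ≤ X ∧
        I k (e.eval ((σ.setReg .ctr k).setReg x v))) :
    Runs M X (.fold m x e) σ ((m.eval σ + 1) * (3 * D + 3))
      (fun σ' => ∃ v, σ' = (σ.setReg .ctr 0).setReg x v ∧ I 0 v) := by
  have h1 : 0 < m.eval σ + 1 := by omega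
  refine ((assign hM hσ hm hmX .ctr).seq (B' := m.eval σ * ((D + 1) + (D + 1) + 1) + 1)
    (Q' := fun σ' => ∃ v, σ' = (σ.setReg .ctr 0).setReg x v ∧ I 0 v) ?_).mono ?_ ?_
  · rintro _ hσ' rfl
    refine (Runs.loop .ctr (fun k σ' => k ≤ m.eval σ ∧
      ∃ v, σ' = (σ.setReg .ctr k).setReg x v ∧ I k v) ?_ ?_ (m.eval σ) hσ' ?_).mono le_rfl ?_
    · rintro _ ⟨-, v, rfl, -⟩
      simp [hx.symm]
    · rintro k _ hσ₁ ⟨hk, v, rfl, hv⟩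
      refine ⟨by simp [hx.symm], ?_⟩
      refine (assign hM hσ₁ (e := .var .ctr - 1) (by simp; omega) ?_ .ctr).seq ?_
      · simp [hx.symm]; omega
      · rintro _ hσ₂ rfl
        have heq : ((σ.setReg .ctr (k + 1)).setReg x v).setReg .ctr
            ((Expr.var .ctr - 1).eval ((σ.setReg .ctr (k + 1)).setReg x v)) =
            (σ.setReg .ctr k).setReg x v := by
          ext y
          · simp [hx.symm]
            split_ifs <;> simp_all
          · simp
        rw [heq] at hσ₂ ⊢
        obtain ⟨h1, h2⟩ := hstep k v hk hv
        refine (assign hM hσ₂ he h1 x).mono le_rfl ?_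
        rintro _ - rfl
        refine ⟨by omega, _, ?_, h2⟩
        ext y <;> simp
        split_ifs <;> rfl
    · refine ⟨le_rfl, σ.reg x, ?_, hI⟩
      ext y <;> simp
      intro h
      subst h
      simp [hx]
    · rintro _ - ⟨-, h⟩
      exact h
  · nlinarith
  · exact fun _ _ h => h

/-- `hindep` forbids that the expression reads the array being filled; otherwise cells written
earlier would influence later ones. Matrix updates that need their own old entries go through a
second array for this reason. -/
theorem fill (hM : (X + 2) ^ D ≤ M) (hD : 4 ≤ D) (hσ : σ.Bounded X) {m e : Expr}
    (hm : m.size ≤ D) (hmX : m.eval σ ≤ X) (he : e.size ≤ D) {x : Arr}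
    (hX : ∀ k < m.eval σ, e.eval (σ.setReg .ctr k) ≤ X)
    (hindep : ∀ k f, e.eval ((σ.setReg .ctr k).setArr x f) = e.eval (σ.setReg .ctr k)) :
    Runs M X (.fill m x e) σ ((m.eval σ + 1) * (4 * D + 4))
      (· = (σ.setReg .ctr 0).setArr x
        (fun k => if k < m.eval σ then e.eval (σ.setReg .ctr k) else σ.arr x k)) := by
  -- The array when the counter stands at `j`: the cells from `j` on are already written.
  let F (j k : ℕ) : ℕ := if j ≤ k ∧ k < m.eval σ then e.eval (σ.setReg .ctr k) else σ.arr x k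
  refine ((assign hM hσ hm hmX .ctr).seq (B' := m.eval σ * ((D + 1) + (2 * D + 1) + 1) + 1)
    (Q' := (· = (σ.setReg .ctr 0).setArr x
        (fun k => if k < m.eval σ then e.eval (σ.setReg .ctr k) else σ.arr x k))) ?_).mono ?_ ?_
  · rintro _ hσ' rfl
    refine (Runs.loop .ctr (fun k σ' => k ≤ m.eval σ ∧
      σ' = (σ.setReg .ctr k).setArr x (F k)) ?_ ?_ (m.eval σ) hσ' ?_).mono le_rfl ?_
    · rintro _ ⟨-, rfl⟩
      simp
    · rintro k _ hσ₁ ⟨hk, rfl⟩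
      refine ⟨by simp, ?_⟩
      refine (assign hM hσ₁ (e := .var .ctr - 1) (by simp; omega) ?_ .ctr).seq ?_
      · simp; omega
      · rintro _ hσ₂ rfl
        have heq : ((σ.setReg .ctr (k + 1)).setArr x (F (k + 1))).setReg .ctr
            ((Expr.var .ctr - 1).eval ((σ.setReg .ctr (k + 1)).setArr x (F (k + 1)))) =
            (σ.setReg .ctr k).setArr x (F (k + 1)) := by
          ext y
          · simp
            split_ifs <;> simp_all
          · simp
        rw [heq] at hσ₂ ⊢
        refine (write hM hσ₂ (by simp; omega) he ?_ x).mono le_rfl ?_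
        · rw [hindep]
          exact hX k hk
        rintro _ - rfl
        refine ⟨by omega, ?_⟩
        rw [hindep]
        ext y j
        · simp
        · simp only [Expr.eval_var, Store.reg_setArr, Store.reg_setReg, if_true, Store.arr_setArr,
            Store.arr_setReg]
          split
          · simp only [Function.update_apply, F]
            by_cases hjk : j = k
            · subst hjk
              simp [Nat.lt_of_succ_le hk]
            · rw [if_neg hjk]
              congr 1
              simp only [eq_iff_iff]
              omega
          · rfl
    · refine ⟨le_rfl, ?_⟩
      ext y j
      · simp
      · simp only [Store.arr_setArr, Store.arr_setReg]
        split
        · rename_i h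
          subst h
          simp only [F]
          rw [if_neg (by omega)]
        · rfl
    · rintro _ - ⟨-, rfl⟩
      simp [F]
  · nlinarith
  · exact fun _ _ h => h

end Runs

end WordRAM

namespace WordRAM

/-! ### Subroutine calls without clearing memory -/

/-- The arrays that do not belong to the simulated program. -/
def Arr.IsOwn : Arr → Prop
  | .value _ => False
  | .stamp _ => False
  | _ => True

/-- The content of cell `a` of array `i` of the simulated program: cells with an old stamp count as
empty. -/
def Store.live (σ : Store) (i a : ℕ) : ℕ :=
  if σ.arr (.stamp i) a = σ.reg .epoch then σ.arr (.value i) a else 0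

/-- No cell has a stamp from the future. -/
def Store.Stamped (σ : Store) : Prop :=
  ∀ i a, σ.arr (.stamp i) a ≤ σ.reg .epoch

namespace Prog

/-- All registers of the program are below this number. -/
def regBound : Prog → ℕ
  | .skip => 0
  | .const r _ => r + 1
  | .op _ r a b => max (r + 1) (max (a + 1) (b + 1))
  | .load r _ a => max (r + 1) (a + 1)
  | .store _ a b => max (a + 1) (b + 1)
  | .seq P P' => max P.regBound P'.regBound
  | .branch r P P' => max (r + 1) (max P.regBound P'.regBound)
  | .loop r P => max (r + 1) P.regBound

/-- The register of the machine that simulates register `r`. -/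
def simReg (r : ℕ) : ℕ := tmp + 2 + r

/-- Simulation of a program in which cells without the current stamp are read as `0`. -/
def simulate : Prog → Prog
  | .skip => .skip
  | .const r k => .const (simReg r) k
  | .op o r a b => .op o (simReg r) (simReg a) (simReg b)
  | .load r i a =>
    -- The comparison of the stamp with the epoch gives 0 or 1, and multiplying by it masks outdated
    -- values without a branch.
    .seq (.seq (.seq (.load tmp (Arr.value i).num (simReg a))
      (.load (tmp + 1) (Arr.stamp i).num (simReg a)))
      (.op .eq (tmp + 1) (tmp + 1) Var.epoch.ctorIdx))
      (.op .mul (simReg r) tmp (tmp + 1))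
  | .store i a b =>
    .seq (.store (Arr.value i).num (simReg a) (simReg b))
      (.store (Arr.stamp i).num (simReg a) Var.epoch.ctorIdx)
  | .seq P P' => .seq P.simulate P'.simulate
  | .branch r P P' => .branch (simReg r) P.simulate P'.simulate
  | .loop r P => .loop (simReg r) P.simulate

/-- Clear the simulated registers below `R`. -/
def clearRegs : ℕ → Prog
  | 0 => .skip
  | R + 1 => .seq (clearRegs R) (.const (simReg R) 0)

/-- Run `P` with the numbers of states, observations and symbols in its first registers. -/
def call (P : Prog) : Prog :=
  -- The summand 3 covers the input registers 0, 1, 2 even if `P` mentions none of them. Register 2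
  -- receives the number of observations because the alphabet has size `T`.
  .seq (.seq (.seq (.seq (clearRegs (P.regBound + 3))
    (.op .lor (simReg 0) Var.states.ctorIdx Var.states.ctorIdx))
    (.op .lor (simReg 1) Var.obs.ctorIdx Var.obs.ctorIdx))
    (.op .lor (simReg 2) Var.obs.ctorIdx Var.obs.ctorIdx)) P.simulate

end Prog

open Prog

/-- The machine state `s` simulates the state `p` of a program with registers below `R`; apart from
that, it holds the store `σ`. -/
def Simulates (X R : ℕ) (σ : Store) (s p : State) : Prop :=
  (∀ r < R, s.reg (simReg r) = p.reg r) ∧ ∃ σ', Holds s σ' ∧ σ'.Bounded X ∧ σ'.reg = σ.reg ∧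
    (∀ x : Arr, x.IsOwn → σ'.arr x = σ.arr x) ∧ (∀ i a, σ'.live i a = p.mem i a) ∧ σ'.Stamped

theorem Simulates.setReg {X R : ℕ} {σ : Store} {s p : State} (h : Simulates X R σ s p)
    (r k : ℕ) : Simulates X R σ (s.setReg (simReg r) k) (p.setReg r k) := by
  obtain ⟨hreg, σ', hs, h'⟩ := h
  refine ⟨?_, σ', hs.of_eq ?_ rfl, h'⟩
  · intro r' hr'
    simp [simReg] at hreg ⊢
    rw [hreg r' hr']
  · intro r' hr'
    have : r' ≠ simReg r := by unfold simReg; omega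
    simp [this]

theorem Simulates.of_eq {X R : ℕ} {σ : Store} {s s' p : State} (h : Simulates X R σ s p)
    (hreg : ∀ r, r ≠ tmp → r ≠ tmp + 1 → s'.reg r = s.reg r) (hmem : s'.mem = s.mem) :
    Simulates X R σ s' p := by
  obtain ⟨hreg', σ', hs, h'⟩ := h
  refine ⟨?_, σ', hs.of_eq (fun r hr => hreg r (by omega) (by omega)) hmem, h'⟩
  intro r hr
  rw [hreg _ (by unfold simReg; omega) (by unfold simReg; omega), hreg' r hr]

/-- Writing the current epoch next to the value makes the cell live; no other cell changes its
status. -/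
theorem Simulates.setMem {X R : ℕ} {σ : Store} {s p : State} (h : Simulates X R σ s p)
    (i a k : ℕ) (hk : k ≤ X) :
    Simulates X R σ ((s.setMem (Arr.value i).num a k).setMem (Arr.stamp i).num a
      (σ.reg .epoch)) (p.setMem i a k) := by
  obtain ⟨hreg, σ', hs, hb, hr, ho, hl, hst⟩ := h
  refine ⟨hreg, _, (hs.setMem (.value i) a k).setMem (.stamp i) a (σ.reg .epoch), ?_, hr, ?_, ?_,
    ?_⟩
  · refine (hb.setArr _ fun b => ?_).setArr _ fun b => ?_
    · rw [Function.update_apply]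
      split
      · exact hk
      · exact hb.arr _ _
    · rw [Function.update_apply]
      split
      · rw [← hr]
        exact hb.reg _
      · simpa using hb.arr _ _
  · intro x hx
    rw [← ho x hx]
    cases x <;> simp_all [Arr.IsOwn]
  · intro j b
    rw [State.mem_setMem, ← hl]
    by_cases hj : j = i
    · subst hj
      by_cases hb' : b = a
      · subst hb'
        simp [Store.live, hr]
      · simp [Store.live, hb']
    · simp [Store.live, hj]
  · intro j b
    have := hst j b
    rw [hr] at this
    by_cases hj : j = i
    · subst hj
      by_cases hb' : b = a
      · subst hb'
        simp [hr]
      · simpa [hb', hr] using this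
    · simpa [hj, hr] using this

/-- Induction on the run. A load is the most expensive instruction to simulate, with four steps,
whence the factor 4. Overflow is excluded since the words of the simulated run stay below `N`, and
the values, stamps and epoch are at most `X < M`. -/
theorem exec_simulate {M X R N : ℕ} (hN : N ≤ X) (hX : X < M) {σ : Store} {P : Prog}
    {p p' : State} {t : ℕ} (h : Exec N P p p' t) (hR : P.regBound ≤ R) (s : State)
    (hs : Simulates X R σ s p) :
    ∃ s' t', Exec M P.simulate s s' t' ∧ t' ≤ 4 * t ∧ Simulates X R σ s' p' := by
  have hM : 1 < M ∨ M = 1 := by omega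
  induction h generalizing s with
  | skip p => exact ⟨s, 1, .skip s, by omega, hs⟩
  | const p r k h => exact ⟨_, 1, .const _ _ _ (by omega), by omega, hs.setReg _ _⟩
  | op p o r a b h =>
    simp only [regBound, max_le_iff] at hR
    have ha : s.reg (simReg a) = p.reg a := hs.1 a (by omega)
    have hb : s.reg (simReg b) = p.reg b := hs.1 b (by omega)
    refine ⟨_, 1, .op _ _ _ _ _ ?_, by omega, ?_⟩
    · rw [ha, hb]; omega
    · rw [ha, hb]; exact hs.setReg _ _
  | load p r i a h =>
    simp only [regBound, max_le_iff] at hR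
    have ha : s.reg (simReg a) = p.reg a := hs.1 a (by omega)
    obtain ⟨hreg, σ', hσ, hb, hr, ho, hl, hst⟩ := id hs
    set s₁ := s.setReg tmp (σ'.arr (.value i) (p.reg a)) with hs₁
    set s₂ := s₁.setReg (tmp + 1) (σ'.arr (.stamp i) (p.reg a)) with hs₂
    set s₃ := s₂.setReg (tmp + 1)
      (if σ'.arr (.stamp i) (p.reg a) = σ'.reg .epoch then 1 else 0) with hs₃
    have e₁ : Exec M (.load tmp (Arr.value i).num (simReg a)) s s₁ 1 := by
      have := Exec.load (M := M) s tmp (Arr.value i).num (simReg a)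
      rw [ha, hσ.arr] at this
      exact this ((hb.arr _ _).trans_lt hX)
    have e₂ : Exec M (.load (tmp + 1) (Arr.stamp i).num (simReg a)) s₁ s₂ 1 := by
      have := Exec.load (M := M) s₁ (tmp + 1) (Arr.stamp i).num (simReg a)
      have h1 : s₁.reg (simReg a) = p.reg a := by
        rw [← ha, hs₁]
        have : simReg a ≠ tmp := by unfold simReg; omega
        simp [this]
      rw [h1, hs₁, State.mem_setReg, hσ.arr] at this
      exact this ((hb.arr _ _).trans_lt hX)
    have e₃ : Exec M (.op .eq (tmp + 1) (tmp + 1) Var.epoch.ctorIdx) s₂ s₃ 1 := by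
      have := Exec.op (M := M) s₂ .eq (tmp + 1) (tmp + 1) Var.epoch.ctorIdx
      have hne : Var.epoch.ctorIdx ≠ tmp + 1 := by decide
      have hne' : Var.epoch.ctorIdx ≠ tmp := by decide
      have h2 : s₂.reg Var.epoch.ctorIdx = σ'.reg .epoch := by
        rw [← hσ.reg, hs₂, hs₁]
        simp [hne, hne']
      have h1 : s₂.reg (tmp + 1) = σ'.arr (.stamp i) (p.reg a) := by simp [hs₂]
      rw [h1, h2] at this
      refine this ?_
      have := hb.reg .epoch
      have := hb.arr (.stamp i) (p.reg a)
      simp only [BinOp.eval]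
      split_ifs
      · omega
      · omega
    have hval : BinOp.eval .mul (s₃.reg tmp) (s₃.reg (tmp + 1)) = p.mem i (p.reg a) := by
      rw [← hl]
      simp [hs₃, hs₂, hs₁, BinOp.eval, Store.live]
    have e₄ : Exec M (.op .mul (simReg r) tmp (tmp + 1)) s₃
        (s₃.setReg (simReg r) (p.mem i (p.reg a))) 1 := by
      have := Exec.op (M := M) s₃ .mul (simReg r) tmp (tmp + 1)
      rw [hval] at this
      exact this (by omega)
    refine ⟨_, _, .seq (.seq (.seq e₁ e₂) e₃) e₄, by omega, Simulates.setReg ?_ _ _⟩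
    refine hs.of_eq ?_ rfl
    intro r h h'
    simp [hs₃, hs₂, hs₁, h, h']
  | store p i a b hpa hpb =>
    simp only [regBound, max_le_iff] at hR
    have ha : s.reg (simReg a) = p.reg a := hs.1 a (by omega)
    have hb : s.reg (simReg b) = p.reg b := hs.1 b (by omega)
    obtain ⟨hreg, σ', hσ, hbd, hr, -⟩ := id hs
    have hep : s.reg Var.epoch.ctorIdx = σ.reg .epoch := by rw [hσ.reg, hr]
    refine ⟨_, _, .seq (.store _ _ _ _ ?_ ?_) (.store _ _ _ _ ?_ ?_), by omega, ?_⟩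
    · omega
    · omega
    · simp only [State.reg_setMem]; omega
    · simp only [State.reg_setMem]
      rw [hσ.reg]
      exact (hbd.reg _).trans_lt hX
    · simp only [State.reg_setMem, hep, ha, hb]
      exact hs.setMem _ _ _ (by omega)
  | seq _ _ ih ih' =>
    simp only [regBound, max_le_iff] at hR
    obtain ⟨s₁, t₁, h₁, ht₁, hs₁⟩ := ih hR.1 s hs
    obtain ⟨s₂, t₂, h₂, ht₂, hs₂⟩ := ih' hR.2 s₁ hs₁
    exact ⟨s₂, _, .seq h₁ h₂, by omega, hs₂⟩
  | branch_true hr _ ih =>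
    simp only [regBound, max_le_iff] at hR
    obtain ⟨s₁, t₁, h₁, ht₁, hs₁⟩ := ih hR.2.1 s hs
    exact ⟨s₁, _, .branch_true (by rwa [hs.1 _ (by omega)]) h₁, by omega, hs₁⟩
  | branch_false hr _ ih =>
    simp only [regBound, max_le_iff] at hR
    obtain ⟨s₁, t₁, h₁, ht₁, hs₁⟩ := ih hR.2.2 s hs
    exact ⟨s₁, _, .branch_false (by rwa [hs.1 _ (by omega)]) h₁, by omega, hs₁⟩
  | loop_true hr _ _ ih ih' =>
    have hR' := hR
    simp only [regBound, max_le_iff] at hR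
    obtain ⟨s₁, t₁, h₁, ht₁, hs₁⟩ := ih hR.2 s hs
    obtain ⟨s₂, t₂, h₂, ht₂, hs₂⟩ := ih' hR' s₁ hs₁
    exact ⟨s₂, _, .loop_true (by rwa [hs.1 _ (by omega)]) h₁ h₂, by omega, hs₂⟩
  | loop_false hr =>
    simp only [regBound, max_le_iff] at hR
    exact ⟨s, 1, .loop_false (by rwa [hs.1 _ (by omega)]), by omega, hs⟩

/-- The simulated registers overlap with the evaluation stack of expressions and keep leftovers of
earlier calls. There is a constant number of them, so unlike the arrays they can simply be zeroed.
-/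
theorem exec_clearRegs {M : ℕ} (hM : 0 < M) (R : ℕ) (s : State) :
    ∃ s', Exec M (clearRegs R) s s' (R + 1) ∧ (∀ r < tmp, s'.reg r = s.reg r) ∧
      s'.mem = s.mem ∧ ∀ r < R, s'.reg (simReg r) = 0 := by
  induction R with
  | zero => exact ⟨s, .skip s, fun _ _ => rfl, rfl, by simp⟩
  | succ R ih =>
    obtain ⟨s', h, hr, hm, hz⟩ := ih
    refine ⟨_, .seq h (.const _ _ _ hM), ?_, hm, ?_⟩
    · intro r hlt
      have : r ≠ simReg R := by unfold simReg; omega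
      simp [this, hr r hlt]
    · intro r hlt
      by_cases hrR : r = R
      · simp [hrR]
      · have : simReg r ≠ simReg R := by unfold simReg; omega
        simp [this, hz r (by omega)]

/-- The rule for a call of `P`. -/
theorem Runs.call {M X N : ℕ} (hN : N ≤ X) (hX : X < M) {σ : Store} (hσ : σ.Bounded X)
    (hst : σ.Stamped) {P : Prog} {p p' : State} {t : ℕ} (h : Exec N P p p' t)
    (hreg : ∀ r, p.reg r =
      if r = 0 then σ.reg .states else if r = 1 then σ.reg .obs else if r = 2 then σ.reg .obs else 0)
    (hmem : ∀ i a, σ.live i a = p.mem i a) :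
    Runs M X (call P) σ (P.regBound + 7 + 4 * t) fun σ' =>
      σ'.reg = σ.reg ∧ (∀ x : Arr, x.IsOwn → σ'.arr x = σ.arr x) ∧
        (∀ i a, σ'.live i a = p'.mem i a) ∧ σ'.Stamped := by
  intro s hs
  obtain ⟨s₁, e₁, hr₁, hm₁, hz₁⟩ := exec_clearRegs (M := M) (by omega) (P.regBound + 3) s
  have hs₁ : Holds s₁ σ := hs.of_eq hr₁ hm₁
  have key : ∀ (s : State) (r : ℕ) (x : Var), Holds s σ →
      Exec M (.op .lor (simReg r) x.ctorIdx x.ctorIdx) s (s.setReg (simReg r) (σ.reg x)) 1 ∧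
      Holds (s.setReg (simReg r) (σ.reg x)) σ := by
    intro s r x hs
    constructor
    · have := Exec.op (M := M) s .lor (simReg r) x.ctorIdx x.ctorIdx
      simp only [BinOp.eval, Nat.or_self, hs.reg] at this
      exact this ((hσ.reg _).trans_lt hX)
    · refine hs.of_eq (fun r' hr' => ?_) rfl
      have : r' ≠ simReg r := by unfold simReg; omega
      simp [this]
  obtain ⟨e₂, hs₂⟩ := key s₁ 0 .states hs₁
  obtain ⟨e₃, hs₃⟩ := key _ 1 .obs hs₂
  obtain ⟨e₄, hs₄⟩ := key _ 2 .obs hs₃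
  obtain ⟨s', t', e₅, ht', -, σ', hs', hb', hr', ho', hl', hst'⟩ :=
    exec_simulate (R := P.regBound + 3) (σ := σ) hN hX h (by omega) _
      ⟨by
        intro r hr
        have h1 : ∀ r r', simReg r = simReg r' ↔ r = r' := by unfold simReg; omega
        rw [hreg]
        simp only [State.reg_setReg, h1, hz₁ r hr]
        split_ifs <;> first | rfl | omega, σ, hs₄, hσ, rfl, fun _ _ => rfl, hmem, hst⟩
  exact ⟨s', _, σ', .seq (.seq (.seq (.seq e₁ e₂) e₃) e₄) e₅, by omega, hs', hb', hr', ho', hl',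
    hst'⟩

end WordRAM

/-! ### Negative triangles as Viterbi paths -/

/-- Transition costs: states `x` with `x / g = 1` stand for rows, states `x` with `x / g = 2` for
columns, and all others are idle. -/
def gadgetA (V g : ℕ) (Q : ℕ → ℕ → ℕ) (x y : ℕ) : ℕ :=
  if x / g = 1 then (if y / g = 2 then V - Q (x % g) (y % g) else V) else 0

/-- Observation costs: the observations `2 * k` and `2 * k + 1` stand for the middle vertex `k`. -/
def gadgetB (V g h : ℕ) (E F : ℕ → ℕ → ℕ) (x t : ℕ) : ℕ :=
  if t < 2 * h then
    if t % 2 = 0 then (if x / g = 1 then E (x % g) (t / 2) else V)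
    else (if x / g = 2 then F (t / 2) (x % g) else 0)
  else 0

theorem sum_range_two_mul (c : ℕ → ℕ) (h : ℕ) :
    ∑ t ∈ Finset.range (2 * h), c t = ∑ k ∈ Finset.range h, (c (2 * k) + c (2 * k + 1)) := by
  induction h with
  | zero => simp
  | succ h ih => rw [mul_add, mul_one, Finset.sum_range_succ, Finset.sum_range_succ, ih,
      Finset.sum_range_succ, add_assoc]

section Gadget

variable {V g h : ℕ} {Q E F : ℕ → ℕ → ℕ}

/-- If `y` is no row, its even observation costs `V`. If `y` is a row and `z` no column, the
transition out of `y` costs `V`. In the remaining case the costs contain `E + (V - Q) + F`, and the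
subtraction is not truncated because `Q ≤ V`. -/
theorem le_gadget_block (hQ : ∀ i < g, ∀ j < g, Q i j ≤ V) (hg : 0 < g) {k x y z : ℕ} (hk : k < h)
    (hno : Q (y % g) (z % g) ≤ E (y % g) k + F k (z % g)) :
    V ≤ gadgetA V g Q x y + gadgetB V g h E F y (2 * k) +
      (gadgetA V g Q y z + gadgetB V g h E F z (2 * k + 1)) := by
  have h1 : 2 * k < 2 * h := by omega
  have h2 : 2 * k + 1 < 2 * h := by omega
  have h3 : (2 * k + 1) / 2 = k := by omega
  have h4 : (2 * k + 1) % 2 ≠ 0 := by omega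
  have := hQ _ (Nat.mod_lt y hg) _ (Nat.mod_lt z hg)
  by_cases hy : y / g = 1 <;> by_cases hz : z / g = 2 <;>
    simp [gadgetA, gadgetB, h1, h2, h3, hy, hz] <;> omega

/-- The cost of step `t` of the state sequence `u`. -/
def gadgetStep (V g h : ℕ) (Q E F : ℕ → ℕ → ℕ) (u : ℕ → ℕ) (t : ℕ) : ℕ :=
  gadgetA V g Q (u t) (u (t + 1)) + gadgetB V g h E F (u (t + 1)) t

/-- Idle in state 0 all the time, except for the detour through row `i` and column `j` during the
two observations of `k`. That block costs less than `V`, and each other block costs `V`. -/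
theorem exists_cheap_sequence (hQ : ∀ i < g, ∀ j < g, Q i j ≤ V) {i j k T : ℕ} (hi : i < g)
    (hj : j < g) (hk : k < h) (hT : 2 * h ≤ T) (hneg : E i k + F k j < Q i j) :
    ∃ u : ℕ → ℕ, u 0 = 0 ∧ (∀ t, u t < 3 * g) ∧
      ∑ t ∈ Finset.range T, gadgetStep V g h Q E F u t < h * V := by
  have hg : 0 < g := by omega
  refine ⟨fun t => if t = 2 * k + 1 then g + i else if t = 2 * k + 2 then 2 * g + j else 0,
    by simp, fun t => by simp only; split_ifs <;> omega, ?_⟩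
  set u : ℕ → ℕ := fun t => if t = 2 * k + 1 then g + i else if t = 2 * k + 2 then 2 * g + j else 0
  have d1 : (g + i) / g = 1 := by rw [Nat.add_div_left _ hg, Nat.div_eq_of_lt hi]
  have d2 : (2 * g + j) / g = 2 := by
    rw [mul_comm, Nat.mul_add_div hg, Nat.div_eq_of_lt hj]
  have m1 : (g + i) % g = i := by rw [Nat.add_mod_left, Nat.mod_eq_of_lt hi]
  have m2 : (2 * g + j) % g = j := by rw [Nat.mul_add_mod_self_right, Nat.mod_eq_of_lt hj]
  have hA : ∀ t, t ≠ 2 * k + 1 → gadgetA V g Q (u t) (u (t + 1)) = 0 := by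
    intro t ht
    have : u t / g ≠ 1 := by
      simp only [u, if_neg ht]
      split_ifs
      · omega
      · simp
    simp [gadgetA, this]
  -- The observations beyond `2 * h` only pad the sequence to length `T`. They are free, and so are
  -- transitions that do not start in a row.
  have htail : ∀ t ∈ Finset.range T, t ∉ Finset.range (2 * h) → gadgetStep V g h Q E F u t = 0 := by
    intro t _ ht
    rw [Finset.mem_range] at ht
    rw [gadgetStep, hA t (by omega), gadgetB, if_neg ht]
  rw [← Finset.sum_subset (Finset.range_subset_range.2 hT) htail, sum_range_two_mul,
    ← Finset.card_range h, ← smul_eq_mul, ← Finset.sum_const, Finset.card_range]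
  -- Both sides are now sums over the middle vertices, the right one with constant term `V`; block
  -- `k` gives the strict inequality.
  refine Finset.sum_lt_sum ?_ ⟨k, Finset.mem_range.2 hk, ?_⟩
  · intro l hl
    rw [Finset.mem_range] at hl
    by_cases hlk : l = k
    · subst hlk
      have := hQ i hi j hj
      have h4 : (2 * l + 1) / 2 = l := by omega
      simp [gadgetStep, gadgetB, gadgetA, u, d1, d2, m1, m2, h4]
      split_ifs <;> omega
    · have e1 : u (2 * l + 1) = 0 := by
        simp only [u]
        rw [if_neg (by omega), if_neg (by omega)]
      have e2 : u (2 * l + 2) = 0 := by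
        simp only [u]
        rw [if_neg (by omega), if_neg (by omega)]
      rw [gadgetStep, gadgetStep, hA _ (by omega), hA _ (by omega), e1, add_assoc, e2]
      simp [gadgetB]
      split_ifs <;> omega
  · have := hQ i hi j hj
    have h4 : (2 * k + 1) / 2 = k := by omega
    simp [gadgetStep, gadgetB, gadgetA, u, d1, d2, m1, m2, h4]
    split_ifs <;> omega

/-- If there is a negative triangle, then an optimal state sequence passes through one. -/
theorem exists_negative_of_isViterbiPath {m T : ℕ} (hQ : ∀ i < g, ∀ j < g, Q i j ≤ V) (hg : 0 < g)
    (hm : 3 * g ≤ m) (hT : 2 * h ≤ T) {U : Fin (T + 1) → Fin m}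
    (hU : IsViterbiPath (fun x y : Fin m => gadgetA V g Q x y)
      (fun (x : Fin m) (t : Fin T) => gadgetB V g h E F x t) id U)
    (hex : ∃ i < g, ∃ j < g, ∃ k < h, E i k + F k j < Q i j) :
    ∃ k, ∃ hk : k < h, E (U ⟨2 * k + 1, by omega⟩ % g) k + F k (U ⟨2 * k + 2, by omega⟩ % g) <
      Q (U ⟨2 * k + 1, by omega⟩ % g) (U ⟨2 * k + 2, by omega⟩ % g) := by
  -- If no block of `U` exhibits a negative triangle, each block costs at least `V`, so `U` costs at
  -- least `h * V` and is beaten by the cheap sequence.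
  by_contra! hno
  obtain ⟨i, hi, j, hj, k, hk, hneg⟩ := hex
  obtain ⟨u, hu0, hu, hcheap⟩ := exists_cheap_sequence (T := T) hQ hi hj hk hT hneg
  have hcost : ∀ (u : ℕ → ℕ) (U' : Fin (T + 1) → Fin m), (∀ t, (U' t : ℕ) = u t) →
      viterbiCost (fun x y : Fin m => gadgetA V g Q x y)
        (fun (x : Fin m) (t : Fin T) => gadgetB V g h E F x t) id U' =
      ∑ t ∈ Finset.range T, gadgetStep V g h Q E F u t := by
    intro u U' hu
    unfold viterbiCost
    rw [← Fin.sum_univ_eq_sum_range]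
    refine Finset.sum_congr rfl fun t _ => ?_
    simp [gadgetStep, hu]
  have hopt := hU.2 (fun t => ⟨u t, (hu t).trans_le hm⟩) hu0
  -- `U` extended by zero, so that its cost becomes a sum over a range of natural numbers.
  let w : ℕ → ℕ := fun t => if ht : t < T + 1 then U ⟨t, ht⟩ else 0
  have hw : ∀ t (ht : t < T + 1), w t = U ⟨t, ht⟩ := fun t ht => dif_pos ht
  rw [hcost w U fun t => (hw t t.2).symm, hcost u _ fun _ => rfl] at hopt
  have hlow : h * V ≤ ∑ t ∈ Finset.range (2 * h), gadgetStep V g h Q E F w t := by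
    rw [sum_range_two_mul]
    nth_rewrite 1 [← Finset.card_range h]
    rw [← smul_eq_mul, ← Finset.sum_const]
    refine Finset.sum_le_sum fun l hl => ?_
    rw [Finset.mem_range] at hl
    have := hno l hl
    rw [← hw, ← hw] at this
    exact le_gadget_block hQ hg hl this
  have := Finset.sum_le_sum_of_subset (f := gadgetStep V g h Q E F w)
    (Finset.range_subset_range.2 hT)
  omega

end Gadget

/-! ### Shortest paths by repeated squaring -/

namespace WeightedGraph

variable {n W : ℕ} (G : WeightedGraph n W)

open SimpleGraph

@[simp] theorem walkWeight_nil (u : Fin n) : G.walkWeight (.nil : G.graph.Walk u u) = 0 := rfl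

@[simp] theorem walkWeight_cons {u v w : Fin n} (h : G.graph.Adj u v) (p : G.graph.Walk v w) :
    G.walkWeight (.cons h p) = G.weight s(u, v) + G.walkWeight p := by
  simp [walkWeight]

theorem walkWeight_append {u v w : Fin n} (p : G.graph.Walk u v) (q : G.graph.Walk v w) :
    G.walkWeight (p.append q) = G.walkWeight p + G.walkWeight q := by
  simp [walkWeight, Walk.edges_append]

theorem walkWeight_bypass_le {u v : Fin n} (p : G.graph.Walk u v) :
    G.walkWeight p.bypass ≤ G.walkWeight p :=
  List.Sublist.sum_le_sum (p.edges_bypass_sublist_edges.map _) fun _ _ => Nat.zero_le _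

theorem walkWeight_le {u v : Fin n} (p : G.graph.Walk u v) :
    G.walkWeight p ≤ p.length * W := by
  induction p with
  | nil => simp
  | cons h p ih =>
    have := (G.weight_mem _ ((mem_edgeSet _).2 h)).2
    rw [walkWeight_cons, Walk.length_cons, add_mul]
    omega

/-- Cut the walk after its first `a` edges, or at its end if it is shorter. -/
theorem exists_split {u v : Fin n} (p : G.graph.Walk u v) (a b : ℕ) (hp : p.length ≤ a + b) :
    ∃ (w : Fin n) (q : G.graph.Walk u w) (r : G.graph.Walk w v), q.length ≤ a ∧ r.length ≤ b ∧
      G.walkWeight p = G.walkWeight q + G.walkWeight r := by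
  induction p generalizing a with
  | nil => exact ⟨_, .nil, .nil, by simp, by simp, by simp⟩
  | @cons u v w h p ih =>
    cases a with
    | zero => exact ⟨u, .nil, .cons h p, by simp, by simpa using hp, by simp⟩
    | succ a =>
      obtain ⟨x, q, r, hq, hr, hw⟩ := ih a (by rw [Walk.length_cons] at hp; omega)
      exact ⟨x, .cons h q, r, by simpa using hq, hr, by simp [hw]; ring⟩

/-- The matrices `D` and `X` of distances and second vertices, extended to `N` vertices, are correct
for shortest walks with at most `l` edges; entries `I` of `D` stand for infinity. -/
structure Approximates (N I l : ℕ) (D X : ℕ → ℕ → ℕ) : Prop where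
  diag : ∀ i < N, D i i = 0
  le : ∀ i < N, ∀ j < N, D i j ≤ I
  sound : ∀ i < N, ∀ j < N, D i j < I → (i = j ∧ X i j = i) ∨
    ∃ (u v : Fin n) (p : G.graph.Walk u v), u ≠ v ∧ i = u ∧ j = v ∧ G.walkWeight p = D i j ∧
      (p.snd : ℕ) = X i j
  complete : ∀ (u v : Fin n) (p : G.graph.Walk u v), p.length ≤ l → D u v ≤ G.walkWeight p

open Classical in
/-- The matrix of edge weights, extended to isolated vertices. -/
noncomputable def edgeMatrix (I i j : ℕ) : ℕ :=
  if i = j then 0 else if h : i < n ∧ j < n then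
    (if G.entry ⟨i, h.1⟩ ⟨j, h.2⟩ = 0 then I else G.entry ⟨i, h.1⟩ ⟨j, h.2⟩) else I

theorem entry_of_adj {u v : Fin n} (h : G.graph.Adj u v) : G.entry u v = G.weight s(u, v) :=
  if_pos h

theorem entry_of_not_adj {u v : Fin n} (h : ¬ G.graph.Adj u v) : G.entry u v = 0 :=
  if_neg h

theorem entry_le (u v : Fin n) : G.entry u v ≤ W := by
  by_cases h : G.graph.Adj u v
  · rw [G.entry_of_adj h]
    exact (G.weight_mem _ ((mem_edgeSet _).2 h)).2
  · rw [G.entry_of_not_adj h]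
    omega

variable {G}

theorem edgeMatrix_of_adj {u v : Fin n} (I : ℕ) (h : G.graph.Adj u v) :
    G.edgeMatrix I u v = G.weight s(u, v) := by
  have h1 := (G.weight_mem _ ((mem_edgeSet _).2 h)).1
  rw [edgeMatrix, if_neg (by rw [← Fin.ext_iff]; exact h.ne), dif_pos ⟨u.2, v.2⟩,
    G.entry_of_adj h, if_neg (by omega)]

/-- A finite off-diagonal entry comes from the one-edge walk, whose second vertex is its end; hence
the second-vertex matrix is just `j`. -/
theorem approximates_edgeMatrix {N I : ℕ} (hI : W ≤ I) :
    G.Approximates N I 1 (G.edgeMatrix I) (fun _ j => j) where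
  diag i _ := by simp [edgeMatrix]
  le i _ j _ := by
    unfold edgeMatrix
    split_ifs
    · omega
    · omega
    · exact (G.entry_le _ _).trans hI
    · omega
  sound i _ j _ h := by
    by_cases hij : i = j
    · exact .inl ⟨hij, hij.symm⟩
    by_cases hn : i < n ∧ j < n
    · by_cases hadj : G.graph.Adj ⟨i, hn.1⟩ ⟨j, hn.2⟩
      · exact .inr ⟨⟨i, hn.1⟩, ⟨j, hn.2⟩, hadj.toWalk, hadj.ne, rfl, rfl,
          by simpa [walkWeight] using (edgeMatrix_of_adj I hadj).symm, rfl⟩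
      · simp [edgeMatrix, hij, hn, G.entry_of_not_adj hadj] at h
    · simp [edgeMatrix, hij, hn] at h
  complete u v p hp := by
    cases p with
    | nil => simp [edgeMatrix]
    | cons h p =>
      cases p with
      | nil => simp [edgeMatrix_of_adj I h]
      | cons h p => simp at hp

theorem snd_append_of_ne {u v w : Fin n} (p : G.graph.Walk u v) (q : G.graph.Walk v w)
    (h : u ≠ v) : (p.append q).snd = p.snd := by
  cases p with
  | nil => exact absurd rfl h
  | cons h p => simp

/-- A walk with at most `2 * l` edges splits into two with at most `l`, which gives completeness.
For soundness, the second vertex is changed only at a strict improvement. Then both summands are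
finite and both pieces are nontrivial, so the concatenation starts with the same edge as its first
piece. -/
theorem Approximates.square {N I l : ℕ} (hn : n ≤ N) {D X D' X' P : ℕ → ℕ → ℕ}
    (h : G.Approximates N I l D X)
    (hP : ∀ i < N, ∀ j < N, P i j < N ∧ D' i j = D i (P i j) + D (P i j) j)
    (hle : ∀ i < N, ∀ j < N, ∀ k < N, D' i j ≤ D i k + D k j)
    (hX : ∀ i < N, ∀ j < N, X' i j = if D' i j < D i j then X i (P i j) else X i j) :
    G.Approximates N I (2 * l) D' X' where
  diag i hi := by
    have := hle i hi i hi i hi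
    rw [h.diag i hi] at this
    omega
  le i hi j hj := by
    have := hle i hi j hj i hi
    rw [h.diag i hi] at this
    have := h.le i hi j hj
    omega
  sound i hi j hj hlt := by
    obtain ⟨hPN, hD'⟩ := hP i hi j hj
    have hdi := h.diag i hi
    have hdj := h.diag j hj
    rw [hX i hi j hj]
    have hij := hle i hi j hj j hj
    split_ifs with hd
    · have h1 := h.sound i hi _ hPN (by omega)
      have h2 := h.sound _ hPN j hj (by omega)
      -- A middle vertex equal to an end point gives back the old entry, contradicting the strict
      -- improvement.
      rcases h1 with ⟨h1, -⟩ | ⟨u, v, p, huv, hu, hv, hp, hs⟩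
      · rw [← h1, hdi] at hD'
        omega
      rcases h2 with ⟨h2, -⟩ | ⟨u', v', p', huv', hu', hv', hp', hs'⟩
      · rw [h2, hdj] at hD'
        omega
      obtain rfl : v = u' := Fin.ext (hv.symm.trans hu')
      -- A closed walk cannot improve on the diagonal entry 0.
      by_cases hne : u = v'
      · rw [hu, hv', hne, ← hv', hdj] at hd
        omega
      · exact .inr ⟨u, v', p.append p', hne, hu, hv', by rw [walkWeight_append]; omega,
          by rw [snd_append_of_ne _ _ huv, hs]⟩
    · rcases h.sound i hi j hj (by omega) with h1 | ⟨u, v, p, huv, hu, hv, hp, hs⟩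
      · exact .inl h1
      · exact .inr ⟨u, v, p, huv, hu, hv, by omega, hs⟩
  complete u v p hp := by
    obtain ⟨w, q, r, hq, hr, hw⟩ := G.exists_split p l l (by omega)
    have := hle u (by omega) v (by omega) w (by omega)
    have := h.complete _ _ q hq
    have := h.complete _ _ r hr
    omega

/-- Removing cycles does not increase the weight and leaves fewer than `n` edges, so completeness
for `l ≥ n` bounds every walk. Such a path weighs less than `n * W ≤ I`, hence no true distance is
mistaken for infinity. -/
theorem Approximates.correct {N I l : ℕ} (hn : n ≤ N) (hW : 1 ≤ W) (hI : n * W ≤ I) (hl : n ≤ l)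
    {D X : ℕ → ℕ → ℕ} (h : G.Approximates N I l D X) (u v : Fin n) :
    (G.graph.Reachable u v → ∃ p : G.graph.Walk u v, G.IsShortest p ∧
      (if D u v < I then D u v else 0) = G.walkWeight p ∧ X u v = (p.snd : ℕ)) ∧
    (¬ G.graph.Reachable u v → (if D u v < I then D u v else 0) = 0) := by
  have hu : (u : ℕ) < N := by omega
  have hv : (v : ℕ) < N := by omega
  have hpath : ∀ q : G.graph.Walk u v, q.bypass.length < n := fun q => by
    simpa using q.bypass_isPath.length_lt
  have hlower : ∀ q : G.graph.Walk u v, D u v ≤ G.walkWeight q := fun q =>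
    (h.complete u v q.bypass ((hpath q).le.trans hl)).trans (G.walkWeight_bypass_le q)
  constructor
  · rintro ⟨q⟩
    have hlt : D u v < I := by
      have h1 := h.complete u v q.bypass ((hpath q).le.trans hl)
      have h2 := G.walkWeight_le q.bypass
      have h3 := Nat.mul_lt_mul_of_pos_right (hpath q) (show 0 < W by omega)
      omega
    rw [if_pos hlt]
    rcases h.sound u hu v hv hlt with ⟨huv, hX⟩ | ⟨u', v', p, -, hu', hv', hp, hs⟩
    · obtain rfl : u = v := Fin.ext huv
      refine ⟨.nil, fun q => by simp, ?_, by simpa using hX⟩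
      simpa using h.diag u hu
    · obtain rfl : u = u' := Fin.ext hu'
      obtain rfl : v = v' := Fin.ext hv'
      exact ⟨p, fun q => hp.trans_le (hlower q), hp.symm, hs.symm⟩
  · intro hr
    split_ifs with hlt
    · rcases h.sound u hu v hv hlt with ⟨huv, -⟩ | ⟨u', v', p, -, hu', hv', -⟩
      · rw [Fin.ext huv]
        exact h.diag v hv
      · obtain rfl : u = u' := Fin.ext hu'
        obtain rfl : v = v' := Fin.ext hv'
        exact absurd ⟨p⟩ hr
    · rfl

end WeightedGraph

namespace WordRAM

/-! ### Searching for a negative triangle with a Viterbi algorithm -/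

/-- The variables that a search for a triangle may change. -/
def Var.IsScratch : Var → Prop
  | .ctr | .idx | .rowStart | .colStart | .midStart | .hit | .epoch => True
  | _ => False

theorem Var.ne_of_isScratch {x y : Var} (hx : ¬ x.IsScratch) (hy : y.IsScratch) : x ≠ y :=
  fun h => hx (h ▸ hy)

/-- Expressions that do not depend on the memory of the simulated program. -/
def Expr.IsOwn (e : Expr) : Prop :=
  ∀ σ σ' : Store, σ.reg = σ'.reg → (∀ x : Arr, x.IsOwn → σ.arr x = σ'.arr x) → e.eval σ = e.eval σ'

/-- Write the values of `e` into the cells below `m` of array `i` of the simulated program. -/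
def Prog.put (i : ℕ) (m e : Expr) : Prog :=
  .seq (.fill m (.value i) e) (.fill m (.stamp i) (.var .epoch))

/-- No cell of array `i` is live beforehand, so stamping exactly the cells below `m` makes the array
zero beyond `m` without touching those cells. `hmind` is needed because the length is evaluated a
second time, after the values have been written. -/
theorem Runs.put {M X D : ℕ} (hM : (X + 2) ^ D ≤ M) (hD : 4 ≤ D) {σ : Store} (hσ : σ.Bounded X)
    (hst : σ.Stamped) {m e : Expr} (hm : m.size ≤ D) (he : e.size ≤ D) (hmX : m.eval σ ≤ X)
    (hX : ∀ k < m.eval σ, e.eval (σ.setReg .ctr k) ≤ X) (hown : e.IsOwn)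
    (hmind : ∀ f, m.eval ((σ.setReg .ctr 0).setArr (.value i) f) = m.eval σ)
    (hlive : ∀ a, σ.live i a = 0) :
    Runs M X (.put i m e) σ (2 * ((m.eval σ + 1) * (4 * D + 4))) fun σ' =>
      σ'.reg = (σ.setReg .ctr 0).reg ∧ (∀ x : Arr, x.IsOwn → σ'.arr x = σ.arr x) ∧ σ'.Stamped ∧
      (∀ a, σ'.live i a = if a < m.eval σ then e.eval (σ.setReg .ctr a) else 0) ∧
      ∀ j ≠ i, σ'.live j = σ.live j := by
  rw [two_mul]
  refine (fill hM hD hσ hm hmX he hX ?_).seq ?_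
  · refine fun k f => hown _ _ rfl fun x hx => ?_
    cases x <;> simp_all [Arr.IsOwn]
  · rintro σ₁ hσ₁ rfl
    set f := fun k => if k < m.eval σ then e.eval (σ.setReg .ctr k) else σ.arr (.value i) k with hf
    have h := fill (x := .stamp i) (e := .var .epoch) hM hD hσ₁ hm (by rwa [hmind])
      (by simp; omega) (fun k _ => by simpa using hσ.reg _) (by simp)
    rw [hmind] at h
    refine h.mono le_rfl ?_
    rintro _ - rfl
    refine ⟨?_, ?_, ?_, ?_, ?_⟩
    · ext x
      by_cases hx : x = .ctr <;> simp [hx]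
    · intro x hx
      cases x <;> simp_all [Arr.IsOwn]
    · intro j a
      have := hst j a
      by_cases hj : j = i
      · subst hj
        simp
        split_ifs
        · rfl
        · exact this
      · simpa [hj] using this
    · intro a
      have := hlive a
      simp only [Store.live] at this ⊢
      by_cases ha : a < m.eval σ
      · simp [ha, hf]
      · simpa [ha, hf] using this
    · intro j hj
      funext a
      simp [Store.live, hj]

/-- The fixed numbers of a run: `n` vertices, extended to `N`, in `ni` blocks of size `g` and also
in `nk` blocks of size `h`; `m` states, `T` observations, and the bound `V` of the entries. -/
structure Sizes where
  (n N g h ni nk m T V : ℕ)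

/-- The relations between the sizes. -/
structure Sizes.Valid (z : Sizes) : Prop where
  N_eq_row : z.N = z.ni * z.g
  N_eq_mid : z.N = z.nk * z.h
  g_pos : 0 < z.g
  h_pos : 0 < z.h
  ni_pos : 0 < z.ni
  nk_pos : 0 < z.nk
  g_le : 3 * z.g ≤ z.m
  h_le : 2 * z.h ≤ z.T
  blocks : z.ni * (z.ni * z.nk) = z.N * z.N

/-- The bounds that rule out an overflow. -/
structure Sizes.Small (z : Sizes) (X : ℕ) : Prop where
  two : 2 ≤ X
  N : 2 * (z.N * z.N) ≤ X
  m : z.m * z.m ≤ X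
  Tm : z.T * z.m ≤ X
  T : z.T ≤ X
  V : z.V ≤ X

/-- The variables hold the fixed numbers. -/
structure Store.HasSizes (σ : Store) (z : Sizes) : Prop where
  n : σ.reg .n = z.n
  dim : σ.reg .dim = z.N
  rowBlock : σ.reg .rowBlock = z.g
  midBlock : σ.reg .midBlock = z.h
  rowBlocks : σ.reg .rowBlocks = z.ni
  midBlocks : σ.reg .midBlocks = z.nk
  states : σ.reg .states = z.m
  obs : σ.reg .obs = z.T
  cap : σ.reg .cap = z.V

/-- The variables that hold the fixed numbers. -/
def Var.IsSize : Var → Prop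
  | .n | .dim | .rowBlock | .midBlock | .rowBlocks | .midBlocks | .states | .obs | .cap => True
  | _ => False

theorem Store.HasSizes.of_eq {σ σ' : Store} {z : Sizes} (h : σ.HasSizes z)
    (heq : ∀ x : Var, x.IsSize → σ'.reg x = σ.reg x) : σ'.HasSizes z where
  n := by rw [heq .n trivial, h.n]
  dim := by rw [heq .dim trivial, h.dim]
  rowBlock := by rw [heq .rowBlock trivial, h.rowBlock]
  midBlock := by rw [heq .midBlock trivial, h.midBlock]
  rowBlocks := by rw [heq .rowBlocks trivial, h.rowBlocks]
  midBlocks := by rw [heq .midBlocks trivial, h.midBlocks]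
  states := by rw [heq .states trivial, h.states]
  obs := by rw [heq .obs trivial, h.obs]
  cap := by rw [heq .cap trivial, h.cap]

theorem Store.HasSizes.setReg {σ : Store} {z : Sizes} (h : σ.HasSizes z) {x : Var} (k : ℕ)
    (hx : ¬ x.IsSize) : (σ.setReg x k).HasSizes z := by
  refine h.of_eq fun y hy => ?_
  have : y ≠ x := fun h => hx (h ▸ hy)
  simp [this]

theorem Store.HasSizes.setArr {σ : Store} {z : Sizes} (h : σ.HasSizes z) (x : Arr) (f : ℕ → ℕ) :
    (σ.setArr x f).HasSizes z :=
  h.of_eq fun _ _ => rfl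

/-! ### Code for the search of one block. -/

namespace Expr

/-- An entry of a square matrix. -/
def entry (x : Arr) (i j : Expr) : Expr := .read x (i * .var .dim + j)

/-- The entries of the transition matrix. -/
def trans : Expr :=
  .ite (.op .eq (.var .ctr / .var .states / .var .rowBlock) 1)
    (.ite (.op .eq (.var .ctr % .var .states / .var .rowBlock) 2)
      (.var .cap - entry .thr (.var .rowStart + .var .ctr / .var .states % .var .rowBlock)
        (.var .colStart + .var .ctr % .var .states % .var .rowBlock))
      (.var .cap))
    0

/-- The entries of the observation matrix. -/
def emit : Expr :=
  .ite (.op .lt (.var .ctr % .var .obs) (2 * .var .midBlock))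
    (.ite (.op .eq (.var .ctr % .var .obs % 2) 0)
      (.ite (.op .eq (.var .ctr / .var .obs / .var .rowBlock) 1)
        (entry .dist (.var .rowStart + .var .ctr / .var .obs % .var .rowBlock)
          (.var .midStart + .var .ctr % .var .obs / 2))
        (.var .cap))
      (.ite (.op .eq (.var .ctr / .var .obs / .var .rowBlock) 2)
        (entry .dist (.var .midStart + .var .ctr % .var .obs / 2)
          (.var .colStart + .var .ctr / .var .obs % .var .rowBlock))
        0))
    0

/-- A cell of the output array of the simulated program. -/
def output (e : Expr) : Expr :=
  .ite (.op .eq (.read (.stamp 3) e) (.var .epoch)) (.read (.value 3) e) 0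

/-- The row of the candidate in block `e` of the output. -/
def candRow (e : Expr) : Expr := .var .rowStart + output (2 * e + 1) % .var .rowBlock
/-- The column of the candidate in block `e` of the output. -/
def candCol (e : Expr) : Expr := .var .colStart + output (2 * e + 2) % .var .rowBlock
/-- The middle vertex of the candidate in block `e` of the output. -/
def candMid (e : Expr) : Expr := .var .midStart + e

/-- The test whether the candidate is a negative triangle. -/
def candTest (e : Expr) : Expr :=
  .op .lt (entry .dist (candRow e) (candMid e) + entry .dist (candMid e) (candCol e))
    (entry .thr (candRow e) (candCol e))

end Expr

namespace Prog

open WordRAM.Expr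

/-- Write the Viterbi instance for the current block. -/
def build : Prog :=
  .seq (.seq (.put 0 (.var .states * .var .states) trans) (.put 1 (.var .obs * .var .states) emit))
    (.put 2 (.var .obs) (.var .ctr))

/-- Compute the current block. -/
def locate : Prog :=
  .seq (.assign .epoch (.var .epoch + 1))
    (.seq (.assign .rowStart (.var .idx % .var .rowBlocks * .var .rowBlock))
      (.seq (.assign .colStart (.var .idx / .var .rowBlocks % .var .rowBlocks * .var .rowBlock))
        (.assign .midStart (.var .idx / .var .rowBlocks / .var .rowBlocks % .var .midBlocks *
          .var .midBlock))))

/-- Look for a negative triangle in the output. -/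
def extract : Prog :=
  .seq (.assign .hit 0)
    (.fold (.var .midBlock) .hit (.ite (candTest (.var .ctr)) (.var .ctr + 1) (.var .hit)))

/-- Record the triangle that was found, or move on to the next block. -/
def record : Prog :=
  .cond (.var .hit)
    (.seq (.write .wit (candRow (.var .hit - 1) * .var .dim + candCol (.var .hit - 1))
        (candMid (.var .hit - 1)))
      (.write .thr (candRow (.var .hit - 1) * .var .dim + candCol (.var .hit - 1)) 0))
    (.assign .idx (.var .idx + 1))

/-- Search the current block for a negative triangle. -/
def query (P : Prog) : Prog :=
  .seq (.seq (.seq (.seq locate build) (.call P)) extract) record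

end Prog

open WordRAM.Expr

/-! ### Correctness and cost of the search of one block. -/

variable {M X D : ℕ}

theorem Runs.assign_seq (hM : (X + 2) ^ D ≤ M) {σ : Store} (hσ : σ.Bounded X) {e : Expr}
    (he : e.size ≤ D) (hX : e.eval σ ≤ X) {x : Var} {P : Prog} {B : ℕ} {Q : Store → Prop}
    (h : (σ.setReg x (e.eval σ)).Bounded X → Runs M X P (σ.setReg x (e.eval σ)) B Q) :
    Runs M X (.seq (.assign x e) P) σ (D + 1 + B) Q := by
  refine (assign hM hσ he hX x).seq ?_
  rintro _ hσ' rfl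
  exact h hσ'

/-- The block index is read in mixed radix. The last digit is reduced as well, because a sweep may
push the index beyond the number of blocks; the search then harmlessly revisits a block. -/
theorem Runs.locate (hM : (X + 2) ^ D ≤ M) (hD : 20 ≤ D) {z : Sizes} (hz : z.Valid)
    (hX : z.Small X) {σ : Store} (hσ : σ.Bounded X) (hs : σ.HasSizes z)
    (hep : σ.reg .epoch + 1 ≤ X) :
    Runs M X .locate σ (4 * (D + 1)) fun σ' =>
      σ' = (((σ.setReg .epoch (σ.reg .epoch + 1)).setReg .rowStart
        (σ.reg .idx % z.ni * z.g)).setReg .colStart (σ.reg .idx / z.ni % z.ni * z.g)).setReg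
          .midStart (σ.reg .idx / z.ni / z.ni % z.nk * z.h) := by
  have hrow : ∀ k, k % z.ni * z.g ≤ X := fun k => by
    have h1 := Nat.mul_le_mul_right z.g (Nat.mod_lt k hz.ni_pos).le
    have h2 := hX.N
    have h3 := Nat.le_mul_self z.N
    rw [← hz.N_eq_row] at h1
    omega
  have hmid : ∀ k, k % z.nk * z.h ≤ X := fun k => by
    have h1 := Nat.mul_le_mul_right z.h (Nat.mod_lt k hz.nk_pos).le
    have h2 := hX.N
    have h3 := Nat.le_mul_self z.N
    rw [← hz.N_eq_mid] at h1
    omega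
  refine (assign_seq hM hσ (by simp; omega) (by simpa using hep) fun h₁ =>
    assign_seq hM h₁ (by simp; omega) (by simp [hs.rowBlocks, hs.rowBlock, hrow]) fun h₂ =>
    assign_seq hM h₂ (by simp; omega) (by simp [hs.rowBlocks, hs.rowBlock, hrow]) fun h₃ =>
    assign hM h₃ (by simp; omega)
      (by simp [hs.rowBlocks, hs.midBlocks, hs.midBlock, hmid]) _).mono (by omega) ?_
  rintro _ - rfl
  simp [hs.rowBlocks, hs.rowBlock, hs.midBlocks, hs.midBlock]

/-- The matrix stored in an array. -/
def Sizes.mat (z : Sizes) (f : ℕ → ℕ) (i j : ℕ) : ℕ := f (i * z.N + j)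

/-- The transition matrix for the block that starts at row `r` and column `c`. -/
def Sizes.transAt (z : Sizes) (q : ℕ → ℕ) (r c : ℕ) : ℕ → ℕ → ℕ :=
  gadgetA z.V z.g (fun i j => z.mat q (r + i) (c + j))

/-- The observation matrix for the block that starts at row `r`, column `c` and middle vertex `k`. -/
def Sizes.emitAt (z : Sizes) (d : ℕ → ℕ) (r c k : ℕ) : ℕ → ℕ → ℕ :=
  gadgetB z.V z.g z.h (fun i l => z.mat d (r + i) (k + l)) (fun l j => z.mat d (k + l) (c + j))

theorem Sizes.transAt_le (z : Sizes) (q : ℕ → ℕ) (r c x y : ℕ) : z.transAt q r c x y ≤ z.V := by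
  unfold transAt gadgetA
  split_ifs <;> omega

theorem Sizes.emitAt_le (z : Sizes) (hg : 0 < z.g) {d : ℕ → ℕ} {r c k : ℕ}
    (h1 : ∀ i < z.g, ∀ l < z.h, z.mat d (r + i) (k + l) ≤ z.V)
    (h2 : ∀ l < z.h, ∀ j < z.g, z.mat d (k + l) (c + j) ≤ z.V) (x t : ℕ) :
    z.emitAt d r c k x t ≤ z.V := by
  unfold emitAt gadgetB
  split_ifs with h
  · exact h1 _ (Nat.mod_lt _ hg) _ (by omega)
  · exact le_rfl
  · exact h2 _ (by omega) _ (Nat.mod_lt _ hg)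
  · omega
  · omega

theorem Expr.isOwn_trans : Expr.trans.IsOwn := by
  rintro ⟨r, a⟩ ⟨r', a'⟩ h h'
  obtain rfl : r = r' := h
  have : a .thr = a' .thr := h' .thr trivial
  simp [Expr.trans, entry, this]
  rfl

theorem Expr.isOwn_emit : emit.IsOwn := by
  rintro ⟨r, a⟩ ⟨r', a'⟩ h h'
  obtain rfl : r = r' := h
  have : a .dist = a' .dist := h' .dist trivial
  simp [emit, entry, this]
  rfl

theorem Expr.eval_trans {z : Sizes} {σ : Store} (hs : σ.HasSizes z) :
    Expr.trans.eval σ = z.transAt (σ.arr .thr) (σ.reg .rowStart) (σ.reg .colStart)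
      (σ.reg .ctr / z.m) (σ.reg .ctr % z.m) := by
  simp [trans, entry, hs.states, hs.rowBlock, hs.cap, hs.dim, Sizes.transAt, gadgetA, Sizes.mat]

theorem Expr.eval_emit {z : Sizes} {σ : Store} (hs : σ.HasSizes z) :
    emit.eval σ = z.emitAt (σ.arr .dist) (σ.reg .rowStart) (σ.reg .colStart) (σ.reg .midStart)
      (σ.reg .ctr / z.T) (σ.reg .ctr % z.T) := by
  simp [emit, entry, hs.obs, hs.midBlock, hs.rowBlock, hs.cap, hs.dim, Sizes.emitAt, gadgetB,
    Sizes.mat]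

/-- The memory that presents the Viterbi instance of a block. -/
def Sizes.instMem (z : Sizes) (d q : ℕ → ℕ) (r c k i a : ℕ) : ℕ :=
  if i = 0 ∧ a < z.m * z.m then z.transAt q r c (a / z.m) (a % z.m)
  else if i = 1 ∧ a < z.T * z.m then z.emitAt d r c k (a / z.T) (a % z.T)
  else if i = 2 ∧ a < z.T then a
  else 0

/-- The cost is proportional to the size of the instance, `m ^ 2 + T * m + T`, which has to stay
below the sublinear time of the Viterbi call. The observations are all distinct, so that every time
step has a column of its own in the observation matrix. -/
theorem Runs.build (hM : (X + 2) ^ D ≤ M) (hD : 100 ≤ D) {z : Sizes} (hz : z.Valid)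
    (hX : z.Small X) {σ : Store} (hσ : σ.Bounded X) (hs : σ.HasSizes z) (hst : σ.Stamped)
    (hlive : ∀ i a, σ.live i a = 0)
    (h1 : ∀ i < z.g, ∀ l < z.h,
      z.mat (σ.arr .dist) (σ.reg .rowStart + i) (σ.reg .midStart + l) ≤ z.V)
    (h2 : ∀ l < z.h, ∀ j < z.g,
      z.mat (σ.arr .dist) (σ.reg .midStart + l) (σ.reg .colStart + j) ≤ z.V) :
    Runs M X .build σ ((D + 1) * (8 * (z.m * z.m + z.T * z.m + z.T) + 24)) fun σ' =>
      σ'.reg = (σ.setReg .ctr 0).reg ∧ (∀ x : Arr, x.IsOwn → σ'.arr x = σ.arr x) ∧ σ'.Stamped ∧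
      ∀ i a, σ'.live i a = z.instMem (σ.arr .dist) (σ.arr .thr) (σ.reg .rowStart)
        (σ.reg .colStart) (σ.reg .midStart) i a := by
  -- Writing the simulated arrays does not disturb the source matrices, so later entries may be
  -- evaluated in the original store.
  have key : ∀ σ' : Store, σ'.reg = (σ.setReg .ctr 0).reg →
      (∀ x : Arr, x.IsOwn → σ'.arr x = σ.arr x) → ∀ e : Expr, e.IsOwn → ∀ k,
      e.eval (σ'.setReg .ctr k) = e.eval (σ.setReg .ctr k) := by
    intro σ' hr ha e he k
    refine he _ _ ?_ ha
    ext x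
    by_cases hx : x = .ctr <;> simp [hr, hx]
  have hown : (Expr.var .ctr).IsOwn := fun σ σ' h _ => by simp [h]
  have htrans : ∀ k, Expr.trans.eval (σ.setReg .ctr k) = z.transAt (σ.arr .thr) (σ.reg .rowStart)
      (σ.reg .colStart) (k / z.m) (k % z.m) := fun k => by
    rw [Expr.eval_trans (hs.setReg k id)]
    simp
  have hemit : ∀ k, emit.eval (σ.setReg .ctr k) = z.emitAt (σ.arr .dist) (σ.reg .rowStart)
      (σ.reg .colStart) (σ.reg .midStart) (k / z.T) (k % z.T) := fun k => by
    rw [Expr.eval_emit (hs.setReg k id)]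
    simp
  have hsizes : ∀ σ' : Store, σ'.reg = (σ.setReg .ctr 0).reg → σ'.HasSizes z := fun σ' h =>
    (hs.setReg (x := .ctr) 0 id).of_eq fun x _ => by rw [h]
  have hstates : (Expr.var .states * .var .states).eval σ = z.m * z.m := by simp [hs.states]
  refine (((put hM (by omega) hσ hst (by simp; omega) (by simp [Expr.trans, entry]; omega)
    (by simpa [hs.states] using hX.m) ?_ isOwn_trans (by simp) (hlive 0)).seq
    (B' := 2 * ((z.T * z.m + 1) * (4 * D + 4))) (Q' := fun σ' =>
      σ'.reg = (σ.setReg .ctr 0).reg ∧ (∀ x : Arr, x.IsOwn → σ'.arr x = σ.arr x) ∧ σ'.Stamped ∧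
      ∀ i a, σ'.live i a = if i = 2 then 0 else z.instMem (σ.arr .dist) (σ.arr .thr)
        (σ.reg .rowStart) (σ.reg .colStart) (σ.reg .midStart) i a) ?_).seq
    (B' := 2 * ((z.T + 1) * (4 * D + 4))) (Q' := fun σ' =>
      σ'.reg = (σ.setReg .ctr 0).reg ∧ (∀ x : Arr, x.IsOwn → σ'.arr x = σ.arr x) ∧ σ'.Stamped ∧
      ∀ i a, σ'.live i a = z.instMem (σ.arr .dist) (σ.arr .thr) (σ.reg .rowStart)
        (σ.reg .colStart) (σ.reg .midStart) i a) ?_).mono ?_ fun _ _ h => h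
  · intro k _
    rw [htrans]
    exact (z.transAt_le _ _ _ _ _).trans hX.V
  · rintro σ₁ hσ₁ ⟨hr, ha, hst₁, hl, hl'⟩
    have hs₁ := hsizes σ₁ hr
    have hm : (Expr.var .obs * .var .states).eval σ₁ = z.T * z.m := by simp [hs₁.states, hs₁.obs]
    have h := put (i := 1) (m := .var .obs * .var .states) (e := emit) hM (by omega) hσ₁ hst₁
      (by simp; omega) (by simp [emit, entry]; omega) (by rw [hm]; exact hX.Tm) ?_ isOwn_emit
      (by simp) (fun a => by rw [hl' 1 (by omega)]; exact hlive 1 a)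
    · rw [hm] at h
      refine h.mono le_rfl ?_
      rintro σ₂ - ⟨hr₂, ha₂, hst₂, hl₂, hl₂'⟩
      refine ⟨?_, fun x hx => by rw [ha₂ x hx, ha x hx], hst₂, ?_⟩
      · rw [hr₂]
        ext x
        by_cases hx : x = .ctr <;> simp [hr, hx]
      · intro i a
        by_cases hi : i = 1
        · subst hi
          rw [hl₂, key σ₁ hr ha _ isOwn_emit, hemit]
          simp [Sizes.instMem]
        · rw [hl₂' i hi]
          by_cases hi0 : i = 0
          · subst hi0
            rw [hl, hstates, htrans]
            simp [Sizes.instMem]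
          · rw [hl' i hi0, hlive]
            simp [Sizes.instMem, hi, hi0]
            omega
    · intro k _
      rw [key σ₁ hr ha _ isOwn_emit, hemit]
      exact (z.emitAt_le hz.g_pos h1 h2 _ _).trans hX.V
  · rintro σ₁ hσ₁ ⟨hr, ha, hst₁, hl⟩
    have hs₁ := hsizes σ₁ hr
    have hm : (Expr.var .obs).eval σ₁ = z.T := by simp [hs₁.obs]
    have h := put (i := 2) (m := .var .obs) (e := .var .ctr) hM (by omega) hσ₁ hst₁
      (by simp; omega) (by simp; omega) (by rw [hm]; exact hX.T) ?_ hown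
      (by simp) (fun a => by simp [hl])
    · rw [hm] at h
      refine h.mono le_rfl ?_
      rintro σ₂ - ⟨hr₂, ha₂, hst₂, hl₂, hl₂'⟩
      refine ⟨?_, fun x hx => by rw [ha₂ x hx, ha x hx], hst₂, ?_⟩
      · rw [hr₂]
        ext x
        by_cases hx : x = .ctr <;> simp [hr, hx]
      · intro i a
        by_cases hi : i = 2
        · subst hi
          rw [hl₂]
          simp [Sizes.instMem]
        · rw [hl₂' i hi, hl, if_neg hi]
    · intro k hk
      have := hX.T
      rw [hm] at hk
      simp
      omega
  · rw [hstates]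
    ring_nf
    omega

/-- The triangle with the given row, column and middle vertex is negative. -/
def Sizes.Neg (z : Sizes) (d q : ℕ → ℕ) (i j k : ℕ) : Prop :=
  z.mat d i k + z.mat d k j < z.mat q i j

instance (z : Sizes) (d q : ℕ → ℕ) (i j k : ℕ) : Decidable (z.Neg d q i j k) :=
  inferInstanceAs (Decidable (_ < _))

/-- The row of the candidate in block `k` of the output. -/
def Store.row (σ : Store) (z : Sizes) (k : ℕ) : ℕ :=
  σ.reg .rowStart + σ.live 3 (2 * k + 1) % z.g

/-- The column of the candidate in block `k` of the output. -/
def Store.col (σ : Store) (z : Sizes) (k : ℕ) : ℕ :=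
  σ.reg .colStart + σ.live 3 (2 * k + 2) % z.g

/-- The middle vertex of the candidate in block `k` of the output. -/
def Store.mid (σ : Store) (k : ℕ) : ℕ := σ.reg .midStart + k

theorem Expr.eval_output (σ : Store) (e : Expr) : (output e).eval σ = σ.live 3 (e.eval σ) := by
  simp [output, Store.live]
  rfl

section Cand

variable {z : Sizes} {σ : Store} (hs : σ.HasSizes z) (e : Expr)
include hs

theorem Expr.eval_candRow : (candRow e).eval σ = σ.row z (e.eval σ) := by
  simp [candRow, Store.row, eval_output, hs.rowBlock]

theorem Expr.eval_candCol : (candCol e).eval σ = σ.col z (e.eval σ) := by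
  simp [candCol, Store.col, eval_output, hs.rowBlock]

omit hs in
theorem Expr.eval_candMid : (candMid e).eval σ = σ.mid (e.eval σ) := by
  simp [candMid, Store.mid]

theorem Expr.eval_entry (x : Arr) (f : Expr) :
    (entry x e f).eval σ = z.mat (σ.arr x) (e.eval σ) (f.eval σ) := by
  simp [entry, Sizes.mat, hs.dim]

theorem Expr.eval_candTest : (candTest e).eval σ =
    if z.Neg (σ.arr .dist) (σ.arr .thr) (σ.row z (e.eval σ)) (σ.col z (e.eval σ))
      (σ.mid (e.eval σ)) then 1 else 0 := by
  simp [candTest, eval_entry hs, eval_candRow hs, eval_candCol hs, eval_candMid, Sizes.Neg]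
  rfl

end Cand

theorem Store.live_setReg (σ : Store) {x : Var} (hx : x ≠ .epoch) (k : ℕ) :
    (σ.setReg x k).live = σ.live := by
  funext i a
  simp [live, hx.symm]

/-- Each candidate read from the output is tested directly against the matrices, so a reported
triangle is always genuine. The variable `hit` holds the middle vertex shifted by one, which leaves
0 for failure. -/
theorem Runs.extract (hM : (X + 2) ^ D ≤ M) (hD : 200 ≤ D) {z : Sizes} {σ : Store}
    (hσ : σ.Bounded X) (hs : σ.HasSizes z) (hh : z.h + 1 ≤ X) :
    Runs M X .extract σ ((D + 1) * (3 * z.h + 4)) fun σ' =>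
      ∃ v, σ' = (σ.setReg .ctr 0).setReg .hit v ∧
        ((v = 0 ∧ ∀ k < z.h, ¬ z.Neg (σ.arr .dist) (σ.arr .thr) (σ.row z k) (σ.col z k) (σ.mid k)) ∨
        ∃ k < z.h, v = k + 1 ∧
          z.Neg (σ.arr .dist) (σ.arr .thr) (σ.row z k) (σ.col z k) (σ.mid k)) := by
  have hs₁ : (σ.setReg .hit 0).HasSizes z := hs.setReg _ id
  refine (assign_seq hM hσ (e := 0) (by simp; omega) (by simp) fun h₁ =>
    fold hM (by omega) h₁ (m := .var .midBlock) (by simp; omega) ?_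
    (by simp [candTest, entry, candRow, candCol, candMid, output]; omega) (by simp)
    -- The counter runs downwards: at value `j` the candidates from `j` on have been tested.
    (fun j v => (v = 0 ∧ ∀ k, j ≤ k → k < z.h →
      ¬ z.Neg (σ.arr .dist) (σ.arr .thr) (σ.row z k) (σ.col z k) (σ.mid k)) ∨
        ∃ k < z.h, v = k + 1 ∧
          z.Neg (σ.arr .dist) (σ.arr .thr) (σ.row z k) (σ.col z k) (σ.mid k)) ?_ ?_).mono ?_ ?_
  · simp [hs.midBlock]
    omega
  · refine .inl ⟨by simp, fun k h h' => ?_⟩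
    simp [hs.midBlock] at h
    omega
  · intro k v hk hI
    have hk' : k < z.h := by simpa [hs.midBlock] using hk
    have hs₂ : (((σ.setReg .hit (eval σ 0)).setReg .ctr k).setReg .hit v).HasSizes z :=
      ((hs.setReg (x := .hit) _ id).setReg (x := .ctr) _ id).setReg _ id
    have hev : (Expr.ite (candTest (.var .ctr)) (.var .ctr + 1) (.var .hit)).eval
        (((σ.setReg .hit (eval σ 0)).setReg .ctr k).setReg .hit v) =
        if z.Neg (σ.arr .dist) (σ.arr .thr) (σ.row z k) (σ.col z k) (σ.mid k) then k + 1 else v := by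
      rw [eval_ite, eval_candTest hs₂]
      simp only [Store.row, Store.col, Store.mid,
        Store.live_setReg _ (show Var.hit ≠ .epoch by simp),
        Store.live_setReg _ (show Var.ctr ≠ .epoch by simp)]
      by_cases h : z.Neg (σ.arr .dist) (σ.arr .thr) (σ.reg .rowStart + σ.live 3 (2 * k + 1) % z.g)
        (σ.reg .colStart + σ.live 3 (2 * k + 2) % z.g) (σ.reg .midStart + k) <;> simp [h]
    rw [hev]
    split_ifs with htest
    · exact ⟨by omega, .inr ⟨k, hk', rfl, htest⟩⟩
    · refine ⟨?_, ?_⟩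
      · rcases hI with ⟨rfl, -⟩ | ⟨k', hk', rfl, -⟩ <;> omega
      · refine hI.imp_left fun ⟨h0, h⟩ => ⟨h0, fun k' hle hlt => ?_⟩
        rcases hle.eq_or_lt with rfl | hlt'
        · exact htest
        · exact h k' hlt' hlt
  · simp [hs.midBlock]
    nlinarith
  · rintro _ - ⟨v, rfl, hv⟩
    refine ⟨v, ?_, by simpa using hv⟩
    ext x <;> simp
    split_ifs <;> rfl

/-- Setting the threshold to 0 marks the pair as settled, since no sum of natural numbers is below
0. The block index stays in this case, as the block may contain further negative triangles. -/
theorem Runs.record (hM : (X + 2) ^ D ≤ M) (hD : 200 ≤ D) {z : Sizes} {σ : Store}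
    (hσ : σ.Bounded X) (hs : σ.HasSizes z) (hidx : σ.reg .idx + 1 ≤ X)
    (hmid : ∀ k, σ.reg .hit = k + 1 → σ.mid k ≤ X) :
    Runs M X .record σ ((D + 1) * 5) fun σ' =>
      (σ.reg .hit = 0 ∧ σ' = σ.setReg .idx (σ.reg .idx + 1)) ∨ ∃ k, σ.reg .hit = k + 1 ∧
        σ' = (σ.setArr .wit (Function.update (σ.arr .wit) (σ.row z k * z.N + σ.col z k)
          (σ.mid k))).setArr .thr (Function.update (σ.arr .thr) (σ.row z k * z.N + σ.col z k) 0) := by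
  refine (cond hM hσ (by simp; omega) (B := 4 * D + 2) (fun hne => ?_) (fun h0 => ?_)).mono
    (by omega) fun _ _ h => h
  · obtain ⟨k, hk⟩ := Nat.exists_eq_succ_of_ne_zero hne
    rw [eval_var] at hk
    have hev : (Expr.var .hit - 1).eval σ = k := by simp [hk]
    refine ((write hM hσ (by simp [candRow, candCol, output]; omega)
      (by simp [candMid]; omega) ?_ .wit).seq (B' := 2 * D + 1) fun σ₁ hσ₁ h₁ => ?_).mono
        (by omega) fun _ _ h => h
    · rw [eval_candMid, hev]
      exact hmid k hk
    · rw [eval_candMid, eval_add, eval_mul, eval_var, eval_candRow hs, eval_candCol hs, hev,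
        hs.dim] at h₁
      subst h₁
      have hs₁ := hs.setArr .wit (Function.update (σ.arr .wit) (σ.row z k * z.N + σ.col z k)
        (σ.mid k))
      refine (write hM hσ₁ (by simp [candRow, candCol, output]; omega) (f := 0)
        (by simp; omega) (by simp) .thr).mono le_rfl ?_
      rintro _ - rfl
      refine .inr ⟨k, hk, ?_⟩
      rw [eval_add, eval_mul, eval_var, eval_candRow hs₁, eval_candCol hs₁]
      simp [Store.row, Store.col, Store.live, hk, hs.dim]
  · refine (assign hM hσ (by simp; omega) (by simpa using hidx) _).mono (by omega) ?_
    rintro _ - rfl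
    exact .inl ⟨h0, by simp⟩

/-- The effect of a search. -/
structure Searched (z : Sizes) (σ σ' : Store) : Prop where
  reg : ∀ x : Var, ¬ x.IsScratch → σ'.reg x = σ.reg x
  epoch : σ'.reg .epoch = σ.reg .epoch + 1
  arr : ∀ x : Arr, x.IsOwn → x ≠ .wit → x ≠ .thr → σ'.arr x = σ.arr x
  stamped : σ'.Stamped
  result : (∃ i < z.N, ∃ j < z.N, ∃ k < z.N, z.Neg (σ.arr .dist) (σ.arr .thr) i j k ∧
      σ'.reg .idx = σ.reg .idx ∧
      σ'.arr .wit = Function.update (σ.arr .wit) (i * z.N + j) k ∧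
      σ'.arr .thr = Function.update (σ.arr .thr) (i * z.N + j) 0) ∨
    (σ'.reg .idx = σ.reg .idx + 1 ∧ σ'.arr .wit = σ.arr .wit ∧ σ'.arr .thr = σ.arr .thr ∧
      ∀ i < z.g, ∀ j < z.g, ∀ k < z.h, ¬ z.Neg (σ.arr .dist) (σ.arr .thr)
        (σ.reg .idx % z.ni * z.g + i) (σ.reg .idx / z.ni % z.ni * z.g + j)
        (σ.reg .idx / z.ni / z.ni % z.nk * z.h + k))

/-- `P` solves all Viterbi instances with `m` states and entries at most `m ^ c` in time `τ` with
words below `L`. -/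
def SolvesViterbi (α : ℚ) (c m L : ℕ) (P : Prog) (τ : ℕ) : Prop :=
  ∀ x : (viterbiProblem α c).Inst m, ∃ s t, Exec L P ((viterbiProblem α c).init x) s t ∧ t ≤ τ ∧
    (viterbiProblem α c).Correct x s

/-- The Viterbi instance for a block. -/
noncomputable def Sizes.inst (z : Sizes) {α : ℚ} {c : ℕ} (hV : z.V ≤ z.m ^ c) (hg : 0 < z.g) {d : ℕ → ℕ}
    (q : ℕ → ℕ) {r s k : ℕ} (h1 : ∀ i < z.g, ∀ l < z.h, z.mat d (r + i) (k + l) ≤ z.V)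
    (h2 : ∀ l < z.h, ∀ j < z.g, z.mat d (k + l) (s + j) ≤ z.V) :
    ViterbiInstance z.m (numObs α z.m) (z.m ^ c) where
  σ := numObs α z.m
  σ_le := le_rfl
  A x y := z.transAt q r s x y
  B x t := z.emitAt d r s k x t
  S := id
  A_le _ _ := (z.transAt_le _ _ _ _ _).trans hV
  B_le _ _ := (z.emitAt_le hg h1 h2 _ _).trans hV

/-- Here `hv` is all that is needed from the Viterbi call: either the whole block is free of
negative triangles, or a tested candidate is one. -/
theorem Runs.record_searched (hM : (X + 2) ^ D ≤ M) (hD : 200 ≤ D) {z : Sizes} (hz : z.Valid)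
    (hN : z.N ≤ X) {σ σ₂ : Store} {r s w v : ℕ} (hσ₂ : ((σ₂.setReg .ctr 0).setReg .hit v).Bounded X)
    (hs : σ.HasSizes z) (hidx : σ.reg .idx + 1 ≤ X) (hr : r = σ.reg .idx % z.ni * z.g)
    (hs' : s = σ.reg .idx / z.ni % z.ni * z.g) (hw : w = σ.reg .idx / z.ni / z.ni % z.nk * z.h)
    (hrN : ∀ i < z.g, r + i < z.N) (hsN : ∀ i < z.g, s + i < z.N) (hwN : ∀ i < z.h, w + i < z.N)
    (hreg : ∀ x : Var, ¬ x.IsScratch → σ₂.reg x = σ.reg x)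
    (harr : ∀ x : Arr, x.IsOwn → σ₂.arr x = σ.arr x) (hst : σ₂.Stamped)
    (hepoch : σ₂.reg .epoch = σ.reg .epoch + 1) (hi : σ₂.reg .idx = σ.reg .idx)
    (hrow : σ₂.reg .rowStart = r) (hcol : σ₂.reg .colStart = s) (hmid : σ₂.reg .midStart = w)
    (hv : (v = 0 ∧ ∀ i < z.g, ∀ j < z.g, ∀ k < z.h,
        ¬ z.Neg (σ.arr .dist) (σ.arr .thr) (r + i) (s + j) (w + k)) ∨
      ∃ k < z.h, v = k + 1 ∧
        z.Neg (σ₂.arr .dist) (σ₂.arr .thr) (σ₂.row z k) (σ₂.col z k) (σ₂.mid k)) :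
    Runs M X .record ((σ₂.setReg .ctr 0).setReg .hit v) ((D + 1) * 5) (Searched z σ) := by
  have hs₂ : ((σ₂.setReg .ctr 0).setReg .hit v).HasSizes z :=
    ((hs.of_eq (σ' := σ₂) fun x hx => hreg x (by cases x <;> simp_all [Var.IsSize, Var.IsScratch])).setReg
      (x := .ctr) 0 id).setReg _ id
  have hrow' : ∀ k, σ₂.row z k < z.N := fun k => by
    rw [Store.row, hrow]
    exact hrN _ (Nat.mod_lt _ hz.g_pos)
  have hcol' : ∀ k, σ₂.col z k < z.N := fun k => by
    rw [Store.col, hcol]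
    exact hsN _ (Nat.mod_lt _ hz.g_pos)
  have hmid' : ∀ k < z.h, σ₂.mid k < z.N := fun k hk => by
    rw [Store.mid, hmid]
    exact hwN k hk
  refine (record hM hD hσ₂ hs₂ (by simpa [hi] using hidx) ?_).mono le_rfl ?_
  · intro k hk
    simp at hk
    rcases hv with ⟨rfl, -⟩ | ⟨k', hk', rfl, -⟩
    · omega
    · obtain rfl : k' = k := by omega
      exact (hmid' k' hk').le.trans hN
  · rintro σ₃ - hres
    rcases hres with ⟨h0, rfl⟩ | ⟨k, hk, rfl⟩
    · simp at h0
      refine ⟨fun x hx => ?_, by simpa using hepoch, fun x hx _ _ => harr x hx, hst,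
        .inr ⟨by simp [hi], harr .wit trivial, harr .thr trivial, ?_⟩⟩
      · simp [Var.ne_of_isScratch hx (y := .idx) trivial, Var.ne_of_isScratch hx (y := .hit) trivial,
          Var.ne_of_isScratch hx (y := .ctr) trivial, hreg x hx]
      · rcases hv with ⟨-, hv⟩ | ⟨k', hk', rfl, -⟩
        · rwa [hr, hs', hw] at hv
        · omega
    · simp at hk
      rcases hv with ⟨rfl, -⟩ | ⟨k', hk', rfl, hneg⟩
      · omega
      obtain rfl : k' = k := by omega
      refine ⟨fun x hx => ?_, by simpa using hepoch, fun x hx hw ht => ?_, fun i a => ?_,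
        .inl ⟨_, hrow' k', _, hcol' k', _, hmid' k' hk', ?_⟩⟩
      · simp [Var.ne_of_isScratch hx (y := .hit) trivial,
          Var.ne_of_isScratch hx (y := .ctr) trivial, hreg x hx]
      · simp [hw, ht, harr x hx]
      · simpa using hst i a
      · rw [harr .dist trivial, harr .thr trivial] at hneg
        refine ⟨hneg, by simpa using hi, ?_, ?_⟩
        · simp [Store.row, Store.col, Store.mid, Store.live, harr .wit trivial]
        · simp [Store.row, Store.col, Store.live, harr .thr trivial]

/-- Only the claim that a block contains no negative triangle relies on the optimality of the
computed sequence; a triangle that is found has been tested. -/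
theorem Runs.query (hM : (X + 2) ^ D ≤ M) (hD : 200 ≤ D) {z : Sizes} (hz : z.Valid)
    (hX : z.Small X) {α : ℚ} {c L τ : ℕ} {P : Prog} (hT : z.T = numObs α z.m)
    (hV : z.V ≤ z.m ^ c) (hP : SolvesViterbi α c z.m L P τ) (hL : L ≤ X) {σ : Store}
    (hσ : σ.Bounded X) (hs : σ.HasSizes z) (hst : σ.Stamped) (hep : σ.reg .epoch + 1 ≤ X)
    (hidx : σ.reg .idx + 1 ≤ X) (hd : ∀ i < z.N, ∀ j < z.N, z.mat (σ.arr .dist) i j ≤ z.V)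
    (hq : ∀ i < z.N, ∀ j < z.N, z.mat (σ.arr .thr) i j ≤ z.V) :
    Runs M X (.query P) σ
      ((D + 1) * (8 * (z.m * z.m + z.T * z.m + z.T) + 3 * z.h + 37) + P.regBound + 7 + 4 * τ)
      (Searched z σ) := by
  set r := σ.reg .idx % z.ni * z.g with hr
  set s := σ.reg .idx / z.ni % z.ni * z.g with hs'
  set w := σ.reg .idx / z.ni / z.ni % z.nk * z.h with hw
  have hrN : ∀ i < z.g, r + i < z.N := fun i hi => by
    have h1 := Nat.mod_lt (σ.reg .idx) hz.ni_pos
    rw [hz.N_eq_row]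
    calc r + i < (σ.reg .idx % z.ni + 1) * z.g := by rw [add_mul, one_mul]; omega
      _ ≤ _ := Nat.mul_le_mul_right _ h1
  have hsN : ∀ i < z.g, s + i < z.N := fun i hi => by
    have h1 := Nat.mod_lt (σ.reg .idx / z.ni) hz.ni_pos
    rw [hz.N_eq_row]
    calc s + i < (σ.reg .idx / z.ni % z.ni + 1) * z.g := by rw [add_mul, one_mul]; omega
      _ ≤ _ := Nat.mul_le_mul_right _ h1
  have hwN : ∀ i < z.h, w + i < z.N := fun i hi => by
    have h1 := Nat.mod_lt (σ.reg .idx / z.ni / z.ni) hz.nk_pos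
    rw [hz.N_eq_mid]
    calc w + i < (σ.reg .idx / z.ni / z.ni % z.nk + 1) * z.h := by rw [add_mul, one_mul]; omega
      _ ≤ _ := Nat.mul_le_mul_right _ h1
  have hNX : z.N ≤ X := by
    have h2 := hX.N
    have h3 := Nat.le_mul_self z.N
    omega
  have h1 : ∀ i < z.g, ∀ l < z.h, z.mat (σ.arr .dist) (r + i) (w + l) ≤ z.V :=
    fun i hi l hl => hd _ (hrN i hi) _ (hwN l hl)
  have h2 : ∀ l < z.h, ∀ j < z.g, z.mat (σ.arr .dist) (w + l) (s + j) ≤ z.V :=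
    fun l hl j hj => hd _ (hwN l hl) _ (hsN j hj)
  have hX0 : X < M := by
    calc X < X + 2 := by omega
      _ = (X + 2) ^ 1 := (pow_one _).symm
      _ ≤ (X + 2) ^ D := Nat.pow_le_pow_right (by omega) (by omega)
      _ ≤ M := hM
  obtain ⟨p', t, hex, ht, hcorr⟩ := hP (z.inst hV hz.g_pos (σ.arr .thr) h1 h2)
  obtain ⟨U, hU, hout⟩ := hcorr
  set σ₁ : Store := (((σ.setReg .epoch (σ.reg .epoch + 1)).setReg .rowStart r).setReg
    .colStart s).setReg .midStart w with hσ₁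
  have hs₁ : σ₁.HasSizes z :=
    (((hs.setReg (x := .epoch) _ id).setReg (x := .rowStart) _ id).setReg (x := .colStart)
      _ id).setReg _ id
  refine (((((locate hM (by omega) hz hX hσ hs hep).seq
    (B' := (D + 1) * (8 * (z.m * z.m + z.T * z.m + z.T) + 24)) (Q' := fun σ' =>
      σ'.reg = (σ₁.setReg .ctr 0).reg ∧ (∀ x : Arr, x.IsOwn → σ'.arr x = σ.arr x) ∧ σ'.Stamped ∧
      ∀ i a, σ'.live i a = z.instMem (σ.arr .dist) (σ.arr .thr) r s w i a) ?_).seq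
    (B' := P.regBound + 7 + 4 * t) (Q' := fun σ' =>
      σ'.reg = (σ₁.setReg .ctr 0).reg ∧ (∀ x : Arr, x.IsOwn → σ'.arr x = σ.arr x) ∧ σ'.Stamped ∧
      ∀ i a, σ'.live i a = p'.mem i a) ?_).seq (B' := (D + 1) * (3 * z.h + 4))
    (Q' := fun σ' => ∃ (σ₂ : Store) (v : ℕ), (σ₂.reg = (σ₁.setReg .ctr 0).reg ∧
      (∀ x : Arr, x.IsOwn → σ₂.arr x = σ.arr x) ∧ σ₂.Stamped ∧ ∀ i a, σ₂.live i a = p'.mem i a) ∧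
      σ' = (σ₂.setReg .ctr 0).setReg .hit v ∧
        ((v = 0 ∧ ∀ k < z.h,
          ¬ z.Neg (σ₂.arr .dist) (σ₂.arr .thr) (σ₂.row z k) (σ₂.col z k) (σ₂.mid k)) ∨
        ∃ k < z.h, v = k + 1 ∧
          z.Neg (σ₂.arr .dist) (σ₂.arr .thr) (σ₂.row z k) (σ₂.col z k) (σ₂.mid k))) ?_).seq
    (B' := (D + 1) * 5) (Q' := Searched z σ) ?_).mono ?_ fun _ _ h => h
  · rintro _ hσ' rfl
    refine (build hM (by omega) hz hX hσ' hs₁ ?_ ?_ ?_ ?_).mono le_rfl ?_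
    · intro i a
      have := hst i a
      simp
      omega
    -- Old stamps are at most the old epoch, hence below the new one: the simulated memory is empty.
    · intro i a
      have := hst i a
      simp [Store.live]
      omega
    · simpa using h1
    · simpa using h2
    · rintro σ' - ⟨h, h', h'', h'''⟩
      refine ⟨h, h', h'', ?_⟩
      simpa using h'''
  · rintro σ' hσ' ⟨hreg, harr, hst', hlive⟩
    have hs₂ : σ'.HasSizes z := (hs₁.setReg (x := .ctr) 0 id).of_eq fun x _ => by rw [hreg]
    refine (call hL hX0 hσ' hst' hex ?_ ?_).mono le_rfl ?_
    · intro i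
      rw [hs₂.states, hs₂.obs, hT]
      rfl
    · intro i a
      rw [hlive]
      simp only [Sizes.instMem, viterbiProblem, Sizes.inst, hT]
      split_ifs <;> rfl
    · rintro σ'' - ⟨h, h', h'', h'''⟩
      exact ⟨h.trans hreg, fun x hx => by rw [h' x hx, harr x hx], h''', h''⟩
  · rintro σ' hσ' ⟨hreg, harr, hst', hlive⟩
    have hs₂ : σ'.HasSizes z := (hs₁.setReg (x := .ctr) 0 id).of_eq fun x _ => by rw [hreg]
    refine (extract hM hD hσ' hs₂ ?_).mono le_rfl ?_
    · have := hX.T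
      have := hz.h_le
      have := hz.h_pos
      omega
    · rintro σ'' - ⟨v, h, h'⟩
      exact ⟨σ', v, ⟨hreg, harr, hst', hlive⟩, h, h'⟩
  · rintro _ hσ' ⟨σ₂, v, ⟨hreg, harr, hst', hlive⟩, rfl, hv⟩
    have hs₂ : ((σ₂.setReg .ctr 0).setReg .hit v).HasSizes z :=
      (((hs₁.setReg (x := .ctr) 0 id).of_eq (σ' := σ₂) fun x _ => by rw [hreg]).setReg
        (x := .ctr) 0 id).setReg _ id
    refine record_searched hM hD hz hNX hσ' hs hidx hr hs' hw hrN hsN hwN ?_ harr hst' ?_ ?_ ?_ ?_ ?_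
      (hv.imp_left fun ⟨h0, hv⟩ => ⟨h0, ?_⟩)
    · intro x hx
      simp [hreg, hσ₁, Var.ne_of_isScratch hx (y := .epoch) trivial,
        Var.ne_of_isScratch hx (y := .ctr) trivial, Var.ne_of_isScratch hx (y := .rowStart) trivial,
        Var.ne_of_isScratch hx (y := .colStart) trivial,
        Var.ne_of_isScratch hx (y := .midStart) trivial]
    · simp [hreg, hσ₁]
    · simp [hreg, hσ₁]
    · simp [hreg, hσ₁]
    · simp [hreg, hσ₁]
    · simp [hreg, hσ₁]
    -- All candidates of the output failed the test. A negative triangle in the block would force an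
    -- optimal sequence to show one among precisely these candidates.
    · by_contra! hcon
      obtain ⟨i, hi, j, hj, k, hk, hneg⟩ := hcon
      have hUB : IsViterbiPath
          (fun x y : Fin z.m => gadgetA z.V z.g
            (fun i j => z.mat (σ.arr .thr) (r + i) (s + j)) x y)
          (fun (x : Fin z.m) (t : Fin (numObs α z.m)) => gadgetB z.V z.g z.h
            (fun i l => z.mat (σ.arr .dist) (r + i) (w + l))
            (fun l j => z.mat (σ.arr .dist) (w + l) (s + j)) x t) id U := hU
      obtain ⟨k', hk', hneg'⟩ := exists_negative_of_isViterbiPath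
        (fun i hi j hj => hq _ (hrN i hi) _ (hsN j hj)) hz.g_pos hz.g_le
        (hT ▸ hz.h_le) hUB ⟨i, hi, j, hj, k, hk, hneg⟩
      have h2h := hT ▸ hz.h_le
      have hU1 := hout ⟨2 * k' + 1, by omega⟩
      have hU2 := hout ⟨2 * k' + 2, by omega⟩
      simp only at hU1 hU2
      rw [← hlive] at hU1 hU2
      rw [← hU1, ← hU2] at hneg'
      refine hv k' hk' ?_
      rw [harr .dist trivial, harr .thr trivial, Store.row, Store.col, Store.mid, hreg]
      simpa [Sizes.Neg, hσ₁] using hneg'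
  · ring_nf
    omega

/-! ### The min-plus product -/

theorem Sizes.mat_update (z : Sizes) (f : ℕ → ℕ) {i j i' j' : ℕ} (hj : j < z.N) (hj' : j' < z.N)
    (v : ℕ) : z.mat (Function.update f (i * z.N + j) v) i' j' =
      if i' = i ∧ j' = j then v else z.mat f i' j' := by
  have hiff : i' * z.N + j' = i * z.N + j ↔ i' = i ∧ j' = j := by
    refine ⟨fun h => ?_, fun ⟨h, h'⟩ => by rw [h, h']⟩
    have h1 : (i' * z.N + j') / z.N = (i * z.N + j) / z.N := by rw [h]
    have h2 : (i' * z.N + j') % z.N = (i * z.N + j) % z.N := by rw [h]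
    have hN : 0 < z.N := by omega
    rw [mul_comm i', mul_comm i, Nat.mul_add_div hN, Nat.mul_add_div hN, Nat.div_eq_of_lt hj,
      Nat.div_eq_of_lt hj'] at h1
    rw [mul_comm i', mul_comm i, Nat.mul_add_mod, Nat.mul_add_mod, Nat.mod_eq_of_lt hj,
      Nat.mod_eq_of_lt hj'] at h2
    exact ⟨h1, h2⟩
  simp only [mat, Function.update_apply, hiff]

/-- The number of zero thresholds is the part of the potential that counts settled pairs. -/
theorem card_filter_update_zero {f : ℕ → ℕ} {c n : ℕ} (hc : c < n) (hf : f c ≠ 0) :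
    ((Finset.range n).filter fun a => Function.update f c 0 a = 0).card =
      ((Finset.range n).filter fun a => f a = 0).card + 1 := by
  rw [← Finset.card_insert_of_notMem (a := c) (by simp [hf])]
  congr 1
  ext a
  by_cases ha : a = c
  · simp [ha, hc]
  · simp [ha]

theorem Sizes.index_lt (z : Sizes) {i j : ℕ} (hi : i < z.N) (hj : j < z.N) :
    i * z.N + j < z.N * z.N := by
  calc i * z.N + j < (i + 1) * z.N := by rw [add_mul, one_mul]; omega
    _ ≤ _ := Nat.mul_le_mul_right _ hi

/-- Every triple of vertices lies in one of the blocks. -/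
theorem Sizes.Valid.exists_block {z : Sizes} (hz : z.Valid) {i j k : ℕ} (hi : i < z.N)
    (hj : j < z.N) (hk : k < z.N) : ∃ b < z.N * z.N, b % z.ni * z.g + i % z.g = i ∧
      b / z.ni % z.ni * z.g + j % z.g = j ∧ b / z.ni / z.ni % z.nk * z.h + k % z.h = k := by
  have hi' : i / z.g < z.ni := by
    rw [Nat.div_lt_iff_lt_mul hz.g_pos, ← hz.N_eq_row]; exact hi
  have hj' : j / z.g < z.ni := by
    rw [Nat.div_lt_iff_lt_mul hz.g_pos, ← hz.N_eq_row]; exact hj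
  have hk' : k / z.h < z.nk := by
    rw [Nat.div_lt_iff_lt_mul hz.h_pos, ← hz.N_eq_mid]; exact hk
  have h1 : (z.ni * (z.ni * (k / z.h) + j / z.g) + i / z.g) / z.ni = z.ni * (k / z.h) + j / z.g := by
    rw [Nat.mul_add_div hz.ni_pos, Nat.div_eq_of_lt hi', add_zero]
  have h2 : (z.ni * (k / z.h) + j / z.g) / z.ni = k / z.h := by
    rw [Nat.mul_add_div hz.ni_pos, Nat.div_eq_of_lt hj', add_zero]
  -- The mixed-radix index whose digits, from the lowest, are the row block, the column block and
  -- the middle block.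
  refine ⟨z.ni * (z.ni * (k / z.h) + j / z.g) + i / z.g, ?_, ?_, ?_, ?_⟩
  · rw [← hz.blocks]
    calc z.ni * (z.ni * (k / z.h) + j / z.g) + i / z.g
        < z.ni * (z.ni * (k / z.h) + j / z.g + 1) := by rw [mul_add _ _ 1]; omega
      _ ≤ z.ni * (z.ni * (k / z.h + 1)) := Nat.mul_le_mul_left _ (by rw [mul_add]; omega)
      _ ≤ _ := Nat.mul_le_mul_left _ (Nat.mul_le_mul_left _ hk')
  · rw [Nat.mul_add_mod, Nat.mod_eq_of_lt hi', mul_comm]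
    exact Nat.div_add_mod i z.g
  · rw [h1, Nat.mul_add_mod, Nat.mod_eq_of_lt hj', mul_comm]
    exact Nat.div_add_mod j z.g
  · rw [h1, h2, Nat.mod_eq_of_lt hk', mul_comm]
    exact Nat.div_add_mod k z.h

/-! ### All pairs in negative triangles, by a potential argument. -/

namespace Prog

/-- Find all pairs of vertices that are in a negative triangle. -/
def sweep (P : Prog) : Prog :=
  .seq (.assign .idx 0) (.seq (.assign .iter (2 * (.var .dim * .var .dim)))
    (.loop Var.iter.ctorIdx (.seq (.assign .iter (.var .iter - 1)) (.query P))))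

end Prog

/-- The effect of `sweep`. -/
structure Swept (z : Sizes) (σ σ' : Store) : Prop where
  reg : ∀ x : Var, ¬ x.IsScratch → x ≠ .iter → σ'.reg x = σ.reg x
  epoch : σ'.reg .epoch = σ.reg .epoch + 2 * (z.N * z.N)
  arr : ∀ x : Arr, x.IsOwn → x ≠ .wit → x ≠ .thr → σ'.arr x = σ.arr x
  stamped : σ'.Stamped
  result : ∀ i < z.N, ∀ j < z.N,
    (z.mat (σ'.arr .thr) i j = z.mat (σ.arr .thr) i j ∧
      z.mat (σ'.arr .wit) i j = z.mat (σ.arr .wit) i j ∧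
      ∀ k < z.N, ¬ z.Neg (σ.arr .dist) (σ.arr .thr) i j k) ∨
    (z.mat (σ'.arr .thr) i j = 0 ∧ z.mat (σ'.arr .wit) i j < z.N ∧
      z.Neg (σ.arr .dist) (σ.arr .thr) i j (z.mat (σ'.arr .wit) i j))

/-- The state of `sweep` before the last `k` searches. -/
structure Sweeping (z : Sizes) (σ : Store) (k : ℕ) (σ' : Store) : Prop where
  reg : ∀ x : Var, ¬ x.IsScratch → x ≠ .iter → σ'.reg x = σ.reg x
  iter : σ'.reg .iter = k
  epoch : σ'.reg .epoch + k = σ.reg .epoch + 2 * (z.N * z.N)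
  arr : ∀ x : Arr, x.IsOwn → x ≠ .wit → x ≠ .thr → σ'.arr x = σ.arr x
  stamped : σ'.Stamped
  pairs : ∀ i < z.N, ∀ j < z.N,
    (z.mat (σ'.arr .thr) i j = z.mat (σ.arr .thr) i j ∧
      z.mat (σ'.arr .wit) i j = z.mat (σ.arr .wit) i j) ∨
    (z.mat (σ'.arr .thr) i j = 0 ∧ z.mat (σ'.arr .wit) i j < z.N ∧
      z.Neg (σ.arr .dist) (σ.arr .thr) i j (z.mat (σ'.arr .wit) i j))
  blocks : ∀ b < σ'.reg .idx, ∀ i < z.g, ∀ j < z.g, ∀ k < z.h,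
    ¬ z.Neg (σ.arr .dist) (σ'.arr .thr) (b % z.ni * z.g + i) (b / z.ni % z.ni * z.g + j)
        (b / z.ni / z.ni % z.nk * z.h + k)
  count : σ'.reg .idx + ((Finset.range (z.N * z.N)).filter fun a => σ'.arr .thr a = 0).card + k =
    2 * (z.N * z.N)

theorem Sweeping.thr_le {z : Sizes} {σ σ' : Store} {k : ℕ} (h : Sweeping z σ k σ') {i j : ℕ}
    (hi : i < z.N) (hj : j < z.N) : z.mat (σ'.arr .thr) i j ≤ z.mat (σ.arr .thr) i j := by
  rcases h.pairs i hi j hj with ⟨h, -⟩ | ⟨h, -⟩ <;> omega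

/-- Each search raises the block index plus the number of zero thresholds by exactly one. A block
once found free of negative triangles stays so, because thresholds only decrease. -/
theorem Sweeping.step {z : Sizes} (hz : z.Valid) {σ σ₁ σ₂ : Store} {k : ℕ}
    (h : Sweeping z σ (k + 1) σ₁) (h' : Searched z (σ₁.setReg .iter k) σ₂) :
    Sweeping z σ k σ₂ where
  reg x hx hi := by rw [h'.reg x hx, ← h.reg x hx hi]; simp [hi]
  iter := by rw [h'.reg .iter id]; simp
  epoch := by
    have h1 := h'.epoch
    have h2 := h.epoch
    simp at h1
    omega
  arr x hx hw ht := by rw [h'.arr x hx hw ht]; exact h.arr x hx hw ht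
  stamped := h'.stamped
  pairs i hi j hj := by
    rcases h'.result with ⟨i', hi', j', hj', k', hk', hneg, -, hwit, hthr⟩ | ⟨-, hwit, hthr, -⟩
    · simp only [Store.arr_setReg] at hneg hwit hthr
      rw [hwit, hthr, z.mat_update _ hj' hj, z.mat_update _ hj' hj]
      split_ifs with heq
      · obtain ⟨rfl, rfl⟩ := heq
        refine .inr ⟨rfl, hk', ?_⟩
        rw [h.arr .dist trivial (by simp) (by simp)] at hneg
        -- The triangle was negative for the current threshold, which is at most the original one.
        exact lt_of_lt_of_le hneg (h.thr_le hi' hj')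
      · exact h.pairs i hi j hj
    · rw [hwit, hthr]
      exact h.pairs i hi j hj
  blocks b hb i hi j hj l hl := by
    have hN : b / z.ni % z.ni * z.g + j < z.N := by
      rw [hz.N_eq_row]
      calc b / z.ni % z.ni * z.g + j < (b / z.ni % z.ni + 1) * z.g := by
            rw [add_mul, one_mul]; omega
        _ ≤ _ := Nat.mul_le_mul_right _ (Nat.mod_lt _ hz.ni_pos)
    rcases h'.result with ⟨i', hi', j', hj', k', hk', -, hidx, -, hthr⟩ | ⟨hidx, -, hthr, hno⟩
    · simp only [Store.arr_setReg, Store.reg_setReg] at hthr hidx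
      have := h.blocks b (by simpa [hidx] using hb) i hi j hj l hl
      rw [Sizes.Neg, hthr, z.mat_update _ hj' hN]
      rw [Sizes.Neg] at this
      split_ifs <;> omega
    · simp only [Store.arr_setReg, Store.reg_setReg] at hthr hidx hno
      rw [if_neg (by simp)] at hidx
      rw [hthr]
      rcases Nat.lt_succ_iff_lt_or_eq.1 (hidx ▸ hb) with hlt | rfl
      · exact h.blocks b hlt i hi j hj l hl
      · have := hno i hi j hj l hl
        rw [h.arr .dist trivial (by simp) (by simp)] at this
        simpa using this
  count := by
    have hcount := h.count
    rcases h'.result with ⟨i', hi', j', hj', k', hk', hneg, hidx, -, hthr⟩ | ⟨hidx, -, hthr, -⟩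
    · simp only [Store.arr_setReg, Store.reg_setReg] at hthr hidx hneg
      rw [if_neg (by simp)] at hidx
      rw [hthr, card_filter_update_zero (z.index_lt hi' hj'), hidx]
      · omega
      -- A threshold above a sum of natural numbers is positive, so a settled pair is never counted
      -- twice.
      · have : z.mat (σ₁.arr .thr) i' j' ≠ 0 := by
          have := hneg
          rw [Sizes.Neg] at this
          omega
        exact this
    · simp only [Store.arr_setReg, Store.reg_setReg] at hthr hidx
      rw [if_neg (by simp)] at hidx
      rw [hthr, hidx]
      omega

/-- There are at most `N * N` zero thresholds, so after `2 * (N * N)` searches the block index is at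
least `N * N` and every block has been certified. An untouched pair with a negative triangle would
contradict the certificate of its block. -/
theorem Sweeping.swept {z : Sizes} (hz : z.Valid) {σ σ' : Store}
    (h : Sweeping z σ 0 σ') : Swept z σ σ' where
  reg := h.reg
  epoch := h.epoch
  arr := h.arr
  stamped := h.stamped
  result i hi j hj := by
    refine (h.pairs i hi j hj).imp_left fun ⟨hthr, hwit⟩ => ⟨hthr, hwit, fun k hk hneg => ?_⟩
    obtain ⟨b, hb, e1, e2, e3⟩ := hz.exists_block hi hj hk
    have hcard := Finset.card_filter_le (Finset.range (z.N * z.N)) fun a => σ'.arr .thr a = 0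
    rw [Finset.card_range] at hcard
    have hcount := h.count
    have := h.blocks b (by omega) _ (Nat.mod_lt i hz.g_pos) _ (Nat.mod_lt j hz.g_pos) _
      (Nat.mod_lt k hz.h_pos)
    rw [e1, e2, e3, Sizes.Neg, hthr] at this
    exact this hneg

/-- The time bound of a search. -/
def queryTime (D : ℕ) (z : Sizes) (P : Prog) (τ : ℕ) : ℕ :=
  (D + 1) * (8 * (z.m * z.m + z.T * z.m + z.T) + 3 * z.h + 37) + P.regBound + 7 + 4 * τ

/-- What is known about the simulated program. -/
structure Oracle (α : ℚ) (c : ℕ) (z : Sizes) (X : ℕ) (P : Prog) (τ : ℕ) : Prop where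
  obs : z.T = numObs α z.m
  cap : z.V ≤ z.m ^ c
  solves : ∃ L ≤ X, SolvesViterbi α c z.m L P τ

/-- The number of searches is fixed in advance instead of stopping early, which makes time and epoch
consumption independent of the data. `hpos` makes the count of zero thresholds start at 0. -/
theorem Runs.sweep (hM : (X + 2) ^ D ≤ M) (hD : 200 ≤ D) {z : Sizes} (hz : z.Valid)
    (hX : z.Small X) {α : ℚ} {c τ : ℕ} {P : Prog} (hP : Oracle α c z X P τ) {σ : Store}
    (hσ : σ.Bounded X) (hs : σ.HasSizes z) (hst : σ.Stamped)
    (hep : σ.reg .epoch + 2 * (z.N * z.N) ≤ X)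
    (hd : ∀ i < z.N, ∀ j < z.N, z.mat (σ.arr .dist) i j ≤ z.V)
    (hq : ∀ i < z.N, ∀ j < z.N, z.mat (σ.arr .thr) i j ≤ z.V)
    (hpos : ∀ i < z.N, ∀ j < z.N, z.mat (σ.arr .thr) i j ≠ 0) :
    Runs M X (.sweep P) σ ((z.N * z.N + 1) * (2 * queryTime D z P τ + 2 * D + 8)) (Swept z σ) := by
  obtain ⟨hT, hV, L, hL, hsol⟩ := hP
  have hzero : ((Finset.range (z.N * z.N)).filter fun a => σ.arr .thr a = 0).card = 0 := by
    rw [Finset.card_eq_zero, Finset.filter_eq_empty_iff]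
    intro a ha h0
    rw [Finset.mem_range] at ha
    have hN : 0 < z.N := Nat.pos_of_ne_zero fun h => by simp [h] at ha
    refine hpos (a / z.N) (Nat.div_lt_of_lt_mul ha) (a % z.N) (Nat.mod_lt _ hN) ?_
    rw [Sizes.mat, mul_comm, Nat.div_add_mod, h0]
  have h2N := hX.N
  refine (assign_seq hM hσ (e := 0) (by simp; omega) (by simp) fun h₁ =>
    assign_seq hM h₁ (by simp; omega) (by simpa [hs.dim] using hX.N) fun h₂ =>
    (loop (B := D + 1 + queryTime D z P τ) .iter (fun k σ' => Sweeping z σ k σ')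
      (fun σ' h => h.iter) ?_ (2 * (z.N * z.N)) h₂ ?_)).mono ?_
      (fun σ' _ h => h.swept hz)
  · rintro k σ₁ hσ₁ h
    refine ⟨by rw [h.iter]; omega, ?_⟩
    have hiter : (Expr.var .iter - 1).eval σ₁ = k := by simp [h.iter]
    have hcount := h.count
    have hepoch := h.epoch
    refine assign_seq hM hσ₁ (by simp; omega) (by rw [hiter]; omega) fun hσ₂ => ?_
    rw [hiter] at hσ₂ ⊢
    have hs₁ : σ₁.HasSizes z := hs.of_eq fun x hx => h.reg x
      (by cases x <;> simp_all [Var.IsSize, Var.IsScratch]) (by rintro rfl; exact hx)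
    refine (query hM hD hz hX hT hV hsol hL hσ₂ (hs₁.setReg _ id) h.stamped ?_ ?_ ?_ ?_).mono
      le_rfl fun σ₂ _ h' => h.step hz h'
    · simp
      omega
    · simp
      omega
    · intro i hi j hj
      rw [Store.arr_setReg, h.arr .dist trivial (by simp) (by simp)]
      exact hd i hi j hj
    · intro i hi j hj
      exact (h.thr_le hi hj).trans (hq i hi j hj)
  · refine ⟨fun x hx hi => ?_, ?_, ?_, fun _ _ _ _ => rfl, hst, fun _ _ _ _ => .inl ⟨rfl, rfl⟩,
      ?_, ?_⟩
    · simp [hi, Var.ne_of_isScratch hx (y := .idx) trivial]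
    · simp [hs.dim]
    · simp
    · simp
    · simpa using hzero
  · set K := queryTime D z P τ
    nlinarith

/-! ### Binary search for the min-plus square, and the closure. -/

namespace Prog

/-- One step of the binary search for the min-plus product. -/
def round (P : Prog) : Prog :=
  .seq (.fill (.var .dim * .var .dim) .thr (.read .low (.var .ctr) + .var .step))
    (.seq (.sweep P)
      (.seq (.fill (.var .dim * .var .dim) .lowNew (.ite (.op .eq (.read .thr (.var .ctr)) 0)
          (.read .low (.var .ctr)) (.read .low (.var .ctr) + .var .step)))
        (.seq (.fill (.var .dim * .var .dim) .low (.read .lowNew (.var .ctr)))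
          (.assign .step (.var .step / 2)))))

/-- Compute the min-plus square of the distance matrix, with witnesses. -/
def minPlus (P : Prog) : Prog :=
  .seq (.fill (.var .dim * .var .dim) .low 0)
    (.seq (.fill (.var .dim * .var .dim) .wit (.var .ctr / .var .dim))
      (.seq (.assign .step (.var .cap / 2)) (.loop Var.step.ctorIdx (.round P))))

/-- Replace the distance matrix by its min-plus square, and update the second vertices. -/
def square (P : Prog) : Prog :=
  .seq (.assign .phase (.var .phase / 2))
    (.seq (.minPlus P)
      (.seq (.fill (.var .dim * .var .dim) .nextNew
          (.ite (.op .lt (.read .low (.var .ctr)) (.read .dist (.var .ctr)))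
            (entry .next (.var .ctr / .var .dim) (.read .wit (.var .ctr)))
            (.read .next (.var .ctr))))
        (.seq (.fill (.var .dim * .var .dim) .next (.read .nextNew (.var .ctr)))
          (.fill (.var .dim * .var .dim) .dist (.read .low (.var .ctr))))))

/-- Compute the closure of the distance matrix. -/
def closure (P : Prog) : Prog :=
  .seq (.assign .phase (.var .cap)) (.loop Var.phase.ctorIdx (.square P))

end Prog

theorem Sizes.Small.le {z : Sizes} (hX : z.Small X) : z.N * z.N ≤ X := by
  have := hX.N
  omega

/-- The rule for filling a square matrix. -/
theorem Runs.fill_mat (hM : (X + 2) ^ D ≤ M) (hD : 200 ≤ D) {z : Sizes} (hX : z.Small X)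
    {σ : Store} (hσ : σ.Bounded X) (hs : σ.HasSizes z) {e : Expr} (he : e.size ≤ D) {x : Arr}
    {f : ℕ → ℕ} (hf : ∀ k, e.eval (σ.setReg .ctr k) = f k) (hfX : ∀ k < z.N * z.N, f k ≤ X)
    (hindep : ∀ k g, e.eval ((σ.setReg .ctr k).setArr x g) = e.eval (σ.setReg .ctr k)) :
    Runs M X (.fill (.var .dim * .var .dim) x e) σ ((z.N * z.N + 1) * (4 * D + 4)) fun σ' =>
      ∃ f', σ' = (σ.setReg .ctr 0).setArr x f' ∧ (∀ k < z.N * z.N, f' k = f k) ∧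
        ∀ i < z.N, ∀ j < z.N, z.mat f' i j = z.mat f i j := by
  have hev : (Expr.var .dim * .var .dim).eval σ = z.N * z.N := by simp [hs.dim]
  have h := fill (x := x) hM (by omega) hσ (m := .var .dim * .var .dim) (by simp; omega)
    (by rw [hev]; exact hX.le) he (by rw [hev]; intro k hk; rw [hf]; exact hfX k hk) hindep
  rw [hev] at h
  refine h.mono le_rfl ?_
  rintro _ - rfl
  refine ⟨_, rfl, fun k hk => by rw [if_pos hk, hf], fun i hi j hj => ?_⟩
  simp only [Sizes.mat]
  rw [if_pos (z.index_lt hi hj), hf]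

/-- The state of the binary search with step length `2 ^ k / 2`. -/
structure Searching (z : Sizes) (E phase : ℕ) (d x : ℕ → ℕ) (k : ℕ) (σ : Store) : Prop where
  sizes : σ.HasSizes z
  stamped : σ.Stamped
  phase : σ.reg .phase = phase
  step : σ.reg .step = 2 ^ k / 2
  epoch : σ.reg .epoch + k * (2 * (z.N * z.N)) ≤ E
  dist : σ.arr .dist = d
  next : σ.arr .next = x
  le : ∀ i < z.N, ∀ j < z.N, z.mat (σ.arr .low) i j + 2 ^ k ≤ z.V
  low : ∀ i < z.N, ∀ j < z.N, ∀ l < z.N, z.mat (σ.arr .low) i j ≤ z.mat d i l + z.mat d l j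
  wit : ∀ i < z.N, ∀ j < z.N, z.mat (σ.arr .wit) i j < z.N ∧
    z.mat d i (z.mat (σ.arr .wit) i j) + z.mat d (z.mat (σ.arr .wit) i j) j <
      z.mat (σ.arr .low) i j + 2 ^ k

theorem Sizes.le_of_mat_le (z : Sizes) {f : ℕ → ℕ} {B : ℕ}
    (h : ∀ i < z.N, ∀ j < z.N, z.mat f i j ≤ B) {a : ℕ} (ha : a < z.N * z.N) : f a ≤ B := by
  have hN : 0 < z.N := Nat.pos_of_ne_zero fun h => by simp [h] at ha
  have := h (a / z.N) (Nat.div_lt_of_lt_mul ha) (a % z.N) (Nat.mod_lt _ hN)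
  rwa [Sizes.mat, mul_comm, Nat.div_add_mod] at this

/-- The time bound of a step of the binary search. -/
def roundTime (D : ℕ) (z : Sizes) (P : Prog) (τ : ℕ) : ℕ :=
  (z.N * z.N + 1) * (2 * queryTime D z P τ + 15 * D + 25)

/-- Every interval `[low, low + 2 ^ (k + 1))` is halved at its midpoint. A negative triangle for the
midpoint puts the minimum in the lower half and supplies a new witness. Otherwise `low` moves up,
and the old witness still lies in the interval. -/
theorem Runs.round (hM : (X + 2) ^ D ≤ M) (hD : 200 ≤ D) {z : Sizes} (hz : z.Valid)
    (hX : z.Small X) {α : ℚ} {c τ : ℕ} {P : Prog} (hP : Oracle α c z X P τ) {E phase : ℕ}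
    (hE : E ≤ X) {d x : ℕ → ℕ} (hd : ∀ i < z.N, ∀ j < z.N, z.mat d i j ≤ z.V) {k : ℕ} {σ : Store}
    (hσ : σ.Bounded X) (h : Searching z E phase d x (k + 1) σ) :
    Runs M X (.round P) σ (roundTime D z P τ) (Searching z E phase d x k) := by
  have hstep : σ.reg .step = 2 ^ k := by rw [h.step, pow_succ]; simp
  have hV := hX.V
  have hpow : 2 ^ (k + 1) = 2 ^ k + 2 ^ k := by ring
  have hpos : 0 < 2 ^ k := by positivity
  have hlow : ∀ a < z.N * z.N, σ.arr .low a + 2 ^ k ≤ X := fun a ha => by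
    -- The subtraction is not truncated: the invariant at entry `(0, 0)` gives `2 ^ (k + 1) ≤ z.V`.
    have := z.le_of_mat_le (f := σ.arr .low) (B := z.V - 2 ^ (k + 1)) (fun i hi j hj => by
      have := h.le i hi j hj
      omega) ha
    have hN : 0 < z.N := Nat.pos_of_ne_zero fun h => by simp [h] at ha
    have := h.le 0 hN 0 hN
    omega
  refine ((fill_mat hM hD hX hσ h.sizes (by simp; omega)
    (f := fun a => σ.arr .low a + 2 ^ k) (by simp [hstep]) hlow (by simp)).seq
    (B' := (z.N * z.N + 1) * (2 * queryTime D z P τ + 2 * D + 8) +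
      ((z.N * z.N + 1) * (4 * D + 4) + ((z.N * z.N + 1) * (4 * D + 4) + (D + 1))))
    (Q' := Searching z E phase d x k) ?_).mono ?_ fun _ _ h => h
  · rintro _ hσ₁ ⟨q, rfl, -, hq⟩
    have hepoch := h.epoch
    rw [add_mul, one_mul] at hepoch
    refine (sweep hM hD hz hX hP hσ₁ ((h.sizes.setReg (x := .ctr) 0 id).setArr .thr q) ?_ ?_ ?_ ?_
      ?_).seq (Q' := Searching z E phase d x k) ?_
    · exact h.stamped
    · simp
      omega
    · simpa [h.dist] using hd
    · intro i hi j hj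
      have h1 := h.le i hi j hj
      have h2 : z.mat q i j = z.mat (σ.arr .low) i j + 2 ^ k := hq i hi j hj
      simp [h2]
      omega
    · intro i hi j hj
      have h2 : z.mat q i j = z.mat (σ.arr .low) i j + 2 ^ k := hq i hi j hj
      simp [h2]
    · intro σ₂ hσ₂ hsw
      have hs₂ : σ₂.HasSizes z := h.sizes.of_eq fun y hy => by
        rw [hsw.reg y (by cases y <;> simp_all [Var.IsSize, Var.IsScratch])
          (by rintro rfl; exact hy)]
        have : y ≠ .ctr := by rintro rfl; exact hy
        simp [this]
      have hstep₂ : σ₂.reg .step = 2 ^ k := by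
        rw [hsw.reg .step id (by simp)]
        simpa using hstep
      have hlow₂ : σ₂.arr .low = σ.arr .low := by
        rw [hsw.arr .low trivial (by simp) (by simp)]
        simp
      refine (fill_mat hM hD hX hσ₂ hs₂ (by simp; omega) (x := .lowNew)
        (f := fun a => if σ₂.arr .thr a = 0 then σ.arr .low a else σ.arr .low a + 2 ^ k)
        (by simp [hlow₂, hstep₂]) ?_ (by simp)).seq ?_
      · intro a ha
        have := hlow a ha
        split_ifs <;> omega
      · rintro _ hσ₃ ⟨f, rfl, hfX, hf⟩
        refine (fill_mat hM hD hX hσ₃ ((hs₂.setReg (x := .ctr) 0 id).setArr _ _) (by simp; omega)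
          (f := f) (by simp) ?_ (by simp)).seq ?_
        · intro a ha
          have := hlow a ha
          rw [hfX a ha]
          split_ifs <;> omega
        · rintro _ hσ₄ ⟨f', rfl, -, hf'⟩
          refine (assign hM hσ₄ (by simp; omega) ?_ _).mono le_rfl ?_
          · have := hσ₂.reg .step
            simp
            omega
          · rintro _ - rfl
            have hlowmat : ∀ i < z.N, ∀ j < z.N, z.mat f' i j =
                if z.mat (σ₂.arr .thr) i j = 0 then z.mat (σ.arr .low) i j
                else z.mat (σ.arr .low) i j + 2 ^ k := fun i hi j hj => by
              rw [hf' i hi j hj, hf i hi j hj]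
              rfl
            have hphase₂ : σ₂.reg .phase = phase := by
              rw [hsw.reg .phase id (by simp), ← h.phase]
              simp
            have hepoch₂ := hsw.epoch
            -- The thresholds `low + 2 ^ k` start positive, so a zero after the sweep unambiguously
            -- marks a negative triangle.
            have hres : ∀ i < z.N, ∀ j < z.N,
                (z.mat (σ₂.arr .thr) i j ≠ 0 ∧
                  z.mat (σ₂.arr .wit) i j = z.mat (σ.arr .wit) i j ∧
                  ∀ l < z.N, z.mat (σ.arr .low) i j + 2 ^ k ≤ z.mat d i l + z.mat d l j) ∨
                (z.mat (σ₂.arr .thr) i j = 0 ∧ z.mat (σ₂.arr .wit) i j < z.N ∧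
                  z.mat d i (z.mat (σ₂.arr .wit) i j) + z.mat d (z.mat (σ₂.arr .wit) i j) j <
                    z.mat (σ.arr .low) i j + 2 ^ k) := fun i hi j hj => by
              have hqij : z.mat q i j = z.mat (σ.arr .low) i j + 2 ^ k := hq i hi j hj
              have := hsw.result i hi j hj
              simp only [Sizes.Neg, Store.arr_setArr, Store.arr_setReg, h.dist] at this
              simp only [if_true, reduceCtorEq, if_false, hqij, not_lt] at this
              refine this.imp (fun ⟨h1, h2, h3⟩ => ⟨by omega, h2, h3⟩) id
            refine ⟨?_, ?_, by simpa using hphase₂, by simp [hstep₂], ?_, ?_, ?_, ?_, ?_, ?_⟩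
            · exact ((((hs₂.setReg (x := .ctr) 0 id).setArr _ _).setReg (x := .ctr) 0 id).setArr
                _ _).setReg _ id
            · intro i a
              simpa using hsw.stamped i a
            · simp at hepoch₂ ⊢
              omega
            · simpa [hsw.arr .dist trivial] using h.dist
            · simpa [hsw.arr .next trivial] using h.next
            · intro i hi j hj
              have := h.le i hi j hj
              simp [hlowmat i hi j hj]
              split_ifs <;> omega
            · intro i hi j hj l hl
              have := h.low i hi j hj l hl
              simp [hlowmat i hi j hj]
              rcases hres i hi j hj with ⟨h1, -, h3⟩ | ⟨h1, -⟩
              · rw [if_neg h1]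
                exact h3 l hl
              · rwa [if_pos h1]
            · intro i hi j hj
              have := h.wit i hi j hj
              simp [hlowmat i hi j hj]
              rcases hres i hi j hj with ⟨h1, h2, -⟩ | ⟨h1, h2, h3⟩
              · rw [if_neg h1, h2]
                omega
              · rw [if_pos h1]
                exact ⟨h2, h3⟩
  · unfold roundTime
    set K := queryTime D z P τ
    nlinarith

theorem Sizes.index_div (z : Sizes) {i j : ℕ} (hj : j < z.N) : (i * z.N + j) / z.N = i := by
  rw [mul_comm, Nat.mul_add_div (by omega), Nat.div_eq_of_lt hj, add_zero]

theorem Sizes.index_mod (z : Sizes) {i j : ℕ} (hj : j < z.N) : (i * z.N + j) % z.N = j := by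
  rw [mul_comm, Nat.mul_add_mod, Nat.mod_eq_of_lt hj]

/-- The time bound of the binary search. -/
def minPlusTime (D : ℕ) (z : Sizes) (P : Prog) (τ l : ℕ) : ℕ :=
  (l + 1) * ((z.N * z.N + 1) * (2 * queryTime D z P τ + 24 * D + 40))

/-- The search starts with `low = 0` and length `V = 2 ^ l`. After `l` rounds the interval has
length 1, and the step `2 ^ 0 / 2 = 0` ends the loop. -/
theorem Runs.minPlus (hM : (X + 2) ^ D ≤ M) (hD : 200 ≤ D) {z : Sizes} (hz : z.Valid)
    (hX : z.Small X) {α : ℚ} {c τ : ℕ} {P : Prog} (hP : Oracle α c z X P τ) {l : ℕ}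
    (hl : z.V = 2 ^ l) {σ : Store} (hσ : σ.Bounded X) (hs : σ.HasSizes z) (hst : σ.Stamped)
    (hE : σ.reg .epoch + l * (2 * (z.N * z.N)) ≤ X)
    (hd : ∀ i < z.N, ∀ j < z.N, z.mat (σ.arr .dist) i j < z.V)
    (hdiag : ∀ i < z.N, z.mat (σ.arr .dist) i i = 0) :
    Runs M X (.minPlus P) σ (minPlusTime D z P τ l)
      (Searching z (σ.reg .epoch + l * (2 * (z.N * z.N))) (σ.reg .phase) (σ.arr .dist)
        (σ.arr .next) 0) := by
  set E := σ.reg .epoch + l * (2 * (z.N * z.N)) with hEdef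
  have hNX : z.N ≤ X := (Nat.le_mul_self _).trans hX.le
  refine ((fill_mat hM hD hX hσ hs (by simp; omega) (f := fun _ => 0) (by simp) (by simp)
    (by simp)).seq (B' := (z.N * z.N + 1) * (4 * D + 4) + (D + 1 + (l * (roundTime D z P τ + 1) + 1)))
    (Q' := Searching z E (σ.reg .phase) (σ.arr .dist) (σ.arr .next) 0) ?_).mono ?_ fun _ _ h => h
  · rintro _ hσ₁ ⟨low, rfl, -, hlow⟩
    have hs₁ := (hs.setReg (x := .ctr) 0 id).setArr .low low
    refine (fill_mat hM hD hX hσ₁ hs₁ (by simp; omega) (f := fun a => a / z.N) (by simp [hs.dim]) ?_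
      (by simp)).seq ?_
    · intro k hk
      exact (Nat.div_lt_of_lt_mul hk).le.trans hNX
    · rintro _ hσ₂ ⟨wit, rfl, -, hwit⟩
      have hs₂ := (hs₁.setReg (x := .ctr) 0 id).setArr .wit wit
      refine assign_seq hM hσ₂ (by simp; omega) ?_ fun hσ₃ => ?_
      · have := hX.V
        simp [hs.cap]
        omega
      refine loop .step (Searching z E (σ.reg .phase) (σ.arr .dist) (σ.arr .next)) ?_ ?_ l hσ₃ ?_
      · intro σ' h
        rw [h.step]
        rfl
      · intro k σ' hσ' h
        refine ⟨?_, round hM hD hz hX hP hE (fun i hi j hj => (hd i hi j hj).le) hσ' h⟩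
        rw [h.step, pow_succ]
        simp
      · refine ⟨hs₂.setReg _ id, ?_, by simp, by simp [hs.cap, hl], by simp [hEdef], by simp,
          by simp, ?_, ?_, ?_⟩
        · intro i a
          simpa using hst i a
        · intro i hi j hj
          have h2 := hlow i hi j hj
          simp only [Sizes.mat] at h2
          simp [h2, hl, Sizes.mat]
        · intro i hi j hj k hk
          have h2 := hlow i hi j hj
          simp only [Sizes.mat] at h2
          simp [h2, Sizes.mat]
        -- The first witness is the middle vertex `i`: its sum is `0 + d i j`, which is below `V`.
        · intro i hi j hj
          have h1 : z.mat wit i j = i := by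
            rw [hwit i hi j hj]
            exact z.index_div hj
          have h2 := hlow i hi j hj
          simp only [Sizes.mat] at h2
          have h3 := hd i hi j hj
          simp [h1, hi, hdiag i hi]
          omega
  · unfold minPlusTime roundTime
    set K := queryTime D z P τ
    have : 1 ≤ z.N * z.N + 1 := by omega
    have hl0 : 0 ≤ l := by omega
    nlinarith [Nat.zero_le (l * D * (z.N * z.N)), Nat.zero_le (l * D), Nat.zero_le (l * (z.N * z.N)),
      Nat.zero_le (K * (z.N * z.N)), Nat.zero_le (D * (z.N * z.N))]

/-- The state of the closure computation with phase counter `2 ^ k / 2`. -/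
structure Closing {n W : ℕ} (G : WeightedGraph n W) (z : Sizes) (E l k : ℕ) (σ : Store) :
    Prop where
  k_le : k ≤ l + 1
  sizes : σ.HasSizes z
  stamped : σ.Stamped
  phase : σ.reg .phase = 2 ^ k / 2
  epoch : σ.reg .epoch + k * (l * (2 * (z.N * z.N))) ≤ E
  approx : G.Approximates z.N (z.V - 1) (2 ^ (l + 1 - k)) (z.mat (σ.arr .dist))
    (z.mat (σ.arr .next))

/-- The time bound of a squaring. -/
def squareTime (D : ℕ) (z : Sizes) (P : Prog) (τ l : ℕ) : ℕ :=
  (l + 1) * ((z.N * z.N + 1) * (2 * queryTime D z P τ + 40 * D + 60))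

/-- Combines the search with `Approximates.square`. The second vertices are updated before the
distances are overwritten, since the test for strict improvement needs the old distance. They are
built in a separate array because a new entry reads an old one of the same row at the witness. -/
theorem Runs.square (hM : (X + 2) ^ D ≤ M) (hD : 200 ≤ D) {z : Sizes} (hz : z.Valid)
    (hX : z.Small X) {α : ℚ} {c τ : ℕ} {P : Prog} (hP : Oracle α c z X P τ) {l : ℕ}
    (hl : z.V = 2 ^ l) {n W : ℕ} {G : WeightedGraph n W} (hn : n ≤ z.N) {E k : ℕ} (hE : E ≤ X)
    {σ : Store} (hσ : σ.Bounded X) (h : Closing G z E l (k + 1) σ) :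
    Runs M X (.square P) σ (squareTime D z P τ l) (Closing G z E l k) := by
  have hepoch := h.epoch
  rw [add_mul, one_mul] at hepoch
  have hV0 : 0 < z.V := by rw [hl]; positivity
  have hphase : (Expr.var .phase / 2).eval σ = 2 ^ k / 2 := by
    simp [h.phase, pow_succ]
  refine (assign_seq (B := minPlusTime D z P τ l +
    ((z.N * z.N + 1) * (4 * D + 4) + ((z.N * z.N + 1) * (4 * D + 4) +
      (z.N * z.N + 1) * (4 * D + 4)))) hM hσ (by simp; omega) ?_ fun hσ₁ => ?_).mono ?_
      fun _ _ h => h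
  · have := hσ.reg .phase
    simp
    omega
  · rw [hphase] at hσ₁ ⊢
    refine (minPlus hM hD hz hX hP hl hσ₁ (h.sizes.setReg _ id) ?_ ?_ ?_ ?_).seq ?_
    · exact h.stamped
    · simp
      omega
    · intro i hi j hj
      have := h.approx.le i hi j hj
      simp
      omega
    · exact h.approx.diag
    · intro σ₂ hσ₂ h₂
      have hd₂ : σ₂.arr .dist = σ.arr .dist := by simpa using h₂.dist
      have hx₂ : σ₂.arr .next = σ.arr .next := by simpa using h₂.next
      refine (fill_mat hM hD hX hσ₂ h₂.sizes (x := .nextNew) (by simp [entry]; omega)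
        (f := fun a => if σ₂.arr .low a < σ₂.arr .dist a
          then σ₂.arr .next (a / z.N * z.N + σ₂.arr .wit a) else σ₂.arr .next a)
        (by simp [entry, h₂.sizes.dim]) ?_ (by simp [entry])).seq ?_
      · intro a _
        have h1 := hσ₂.arr .next
        split_ifs <;> exact h1 _
      rintro _ hσ₃ ⟨f, rfl, hfX, hf⟩
      have hs₃ := (h₂.sizes.setReg (x := .ctr) 0 id).setArr .nextNew f
      refine (fill_mat hM hD hX hσ₃ hs₃ (by simp; omega) (f := f) (by simp) ?_ (by simp)).seq ?_
      · intro a _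
        simpa using hσ₃.arr .nextNew a
      rintro _ hσ₄ ⟨x', rfl, -, hx'⟩
      refine (fill_mat hM hD hX hσ₄ ((hs₃.setReg (x := .ctr) 0 id).setArr .next x')
        (by simp; omega) (f := σ₂.arr .low) (by simp) ?_ (by simp)).mono le_rfl ?_
      · intro a _
        exact hσ₂.arr .low a
      rintro _ hσ₅ ⟨d', rfl, -, hd'⟩
      have hX' : ∀ i < z.N, ∀ j < z.N, z.mat x' i j =
          if z.mat d' i j < z.mat (σ.arr .dist) i j
          then z.mat (σ.arr .next) i (z.mat (σ₂.arr .wit) i j)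
          else z.mat (σ.arr .next) i j := fun i hi j hj => by
        rw [hx' i hi j hj, hf i hi j hj, hd' i hi j hj, ← hd₂, ← hx₂]
        simp only [Sizes.mat, z.index_div hj]
        rfl
      have happ := h.approx.square hn (D' := z.mat d') (X' := z.mat x')
        (P := z.mat (σ₂.arr .wit)) (fun i hi j hj => ?_) (fun i hi j hj k hk => ?_) hX'
      · have hk := h.k_le
        refine ⟨by omega, (((hs₃.setReg (x := .ctr) 0 id).setArr .next x').setReg
          (x := .ctr) 0 id).setArr .dist d', ?_, ?_, ?_, ?_⟩
        · intro i a
          simpa using h₂.stamped i a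
        · simpa using h₂.phase
        · have := h₂.epoch
          simp at this ⊢
          omega
        · have hexp : 2 ^ (l + 1 - k) = 2 * 2 ^ (l + 1 - (k + 1)) := by
            rw [← pow_succ']
            congr 1
            omega
          rw [hexp]
          simpa using happ
      -- At length 1 the bounds `low ≤ sum < low + 1` force the witness to attain the minimum.
      · have h3 := h₂.wit i hi j hj
        have h4 := h₂.low i hi j hj _ h3.1
        rw [hd' i hi j hj]
        refine ⟨h3.1, ?_⟩
        simp at h3 h4 ⊢
        omega
      · rw [hd' i hi j hj]
        simpa using h₂.low i hi j hj k hk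
  · unfold squareTime minPlusTime
    set K := queryTime D z P τ
    nlinarith [Nat.zero_le (l * D * (z.N * z.N)), Nat.zero_le (l * D), Nat.zero_le (l * (z.N * z.N)),
      Nat.zero_le (K * (z.N * z.N)), Nat.zero_le (D * (z.N * z.N))]

/-- The time bound of the closure computation. -/
def closureTime (D : ℕ) (z : Sizes) (P : Prog) (τ l : ℕ) : ℕ :=
  (l + 2) * (squareTime D z P τ l + D + 2)

/-- The phase counter runs through `2 ^ l, …, 1`, which amounts to `l + 1` squarings; `hE` reserves
room for all epochs used in them. -/
theorem Runs.closure (hM : (X + 2) ^ D ≤ M) (hD : 200 ≤ D) {z : Sizes} (hz : z.Valid)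
    (hX : z.Small X) {α : ℚ} {c τ : ℕ} {P : Prog} (hP : Oracle α c z X P τ) {l : ℕ}
    (hl : z.V = 2 ^ l) {n W : ℕ} {G : WeightedGraph n W} (hn : n ≤ z.N)
    (hE : (l + 1) * (l * (2 * (z.N * z.N))) ≤ X)
    {σ : Store} (hσ : σ.Bounded X) (hs : σ.HasSizes z) (hst : σ.Stamped) (hep : σ.reg .epoch = 0)
    (h : G.Approximates z.N (z.V - 1) 1 (z.mat (σ.arr .dist)) (z.mat (σ.arr .next))) :
    Runs M X (.closure P) σ (closureTime D z P τ l) fun σ' => σ'.HasSizes z ∧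
      G.Approximates z.N (z.V - 1) (2 ^ (l + 1)) (z.mat (σ'.arr .dist)) (z.mat (σ'.arr .next)) := by
  have hcap : (Expr.var .cap).eval σ = 2 ^ l := by simp [hs.cap, hl]
  refine (assign_seq (B := (l + 1) * (squareTime D z P τ l + 1) + 1) hM hσ (by simp; omega)
    (by rw [hcap, ← hl]; exact hX.V) fun hσ₁ => ?_).mono ?_ fun _ _ h => h
  · rw [hcap] at hσ₁ ⊢
    refine (loop .phase (Closing G z ((l + 1) * (l * (2 * (z.N * z.N)))) l) ?_ ?_ (l + 1) hσ₁
      ?_).mono le_rfl fun σ' _ h' => ⟨h'.sizes, h'.approx⟩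
    · intro σ' h'
      rw [h'.phase]
      rfl
    · intro k σ' hσ' h'
      refine ⟨?_, square hM hD hz hX hP hl hn hE hσ' h'⟩
      rw [h'.phase, pow_succ]
      simp
    · refine ⟨le_rfl, hs.setReg _ id, ?_, ?_, ?_, ?_⟩
      · intro i a
        simpa using hst i a
      · simp [pow_succ]
      · simp [hep]
      · simpa using h
  · unfold closureTime
    set S := squareTime D z P τ l
    nlinarith [Nat.zero_le (l * D)]

end WordRAM

namespace WeightedGraph

theorem Approximates.congr {n W : ℕ} {G : WeightedGraph n W} {N I l : ℕ} (hn : n ≤ N)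
    {D X D' X' : ℕ → ℕ → ℕ} (h : G.Approximates N I l D X)
    (hD : ∀ i < N, ∀ j < N, D' i j = D i j) (hX : ∀ i < N, ∀ j < N, X' i j = X i j) :
    G.Approximates N I l D' X' where
  diag i hi := by rw [hD i hi i hi, h.diag i hi]
  le i hi j hj := by rw [hD i hi j hj]; exact h.le i hi j hj
  sound i hi j hj := by rw [hD i hi j hj, hX i hi j hj]; exact h.sound i hi j hj
  complete u v p hp := by rw [hD u (by omega) v (by omega)]; exact h.complete u v p hp

end WeightedGraph

namespace WordRAM

open WordRAM.Expr

variable {M X D : ℕ}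

/-! ### The APSP algorithm -/

/-- The sizes for `n` vertices and the exponent `p / q`. -/
def Sizes.ofBase (n a p q l : ℕ) : Sizes where
  n := n
  N := a ^ (p + 2 * q)
  g := a ^ q
  h := a ^ p
  ni := a ^ (p + q)
  nk := a ^ (2 * q)
  m := (3 * a) ^ q
  T := (3 * a) ^ p
  V := 2 ^ l

/-- The factor 3 in the base of `m` and `T` provides the three groups of states and the two
observations per middle vertex, while keeping `m` and `T` exact powers of one base. -/
theorem Sizes.valid_ofBase {n a p q l : ℕ} (ha : 0 < a) (hp : 0 < p) (hq : 0 < q) :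
    (Sizes.ofBase n a p q l).Valid where
  N_eq_row := by simp only [ofBase]; ring
  N_eq_mid := by simp only [ofBase]; ring
  g_pos := by simp only [ofBase]; positivity
  h_pos := by simp only [ofBase]; positivity
  ni_pos := by simp only [ofBase]; positivity
  nk_pos := by simp only [ofBase]; positivity
  g_le := by
    simp only [ofBase, mul_pow]
    exact Nat.mul_le_mul_right _ (Nat.le_self_pow hq.ne' 3)
  h_le := by
    simp only [ofBase, mul_pow]
    exact Nat.mul_le_mul_right _ ((show 2 ≤ 3 by omega).trans (Nat.le_self_pow hp.ne' 3))
  blocks := by simp only [ofBase]; ring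

/-! ### Programs for parameters, input and output. -/

namespace Prog

/-- Compute the fixed numbers. -/
def setup (p q c : ℕ) : Prog :=
  .seq (.assign .base 1)
    (.seq (.fold (.var .n) .base (.ite (.op .lt ((Expr.var .base).pow (p + 2 * q)) (.var .n))
        (.var .base + 1) (.var .base)))
      (.seq (.assign .cap 1)
        (.seq (.fold (.lit (c + 1) * .var .n) .cap
            (.ite (.op .lt ((Expr.var .n).pow (c + 1)) (.var .cap)) (.var .cap)
              (.var .cap + .var .cap)))
          (.seq (.assign .dim ((Expr.var .base).pow (p + 2 * q)))
            (.seq (.assign .rowBlock ((Expr.var .base).pow q))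
              (.seq (.assign .midBlock ((Expr.var .base).pow p))
                (.seq (.assign .rowBlocks ((Expr.var .base).pow (p + q)))
                  (.seq (.assign .midBlocks ((Expr.var .base).pow (2 * q)))
                    (.seq (.assign .states ((3 * Expr.var .base).pow q))
                      (.assign .obs ((3 * Expr.var .base).pow p)))))))))))

/-- Write the matrix of edge weights. -/
def edges : Prog :=
  .seq (.fill (.var .dim * .var .dim) .dist
      (.ite (.op .eq (.var .ctr / .var .dim) (.var .ctr % .var .dim)) 0
        (.ite (.op .lt (.var .ctr / .var .dim) (.var .n))
          (.ite (.op .lt (.var .ctr % .var .dim) (.var .n))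
            (.ite (.op .eq (.read .input (.var .ctr / .var .dim * .var .n + .var .ctr % .var .dim)) 0)
              (.var .cap - 1)
              (.read .input (.var .ctr / .var .dim * .var .n + .var .ctr % .var .dim)))
            (.var .cap - 1))
          (.var .cap - 1))))
    (.fill (.var .dim * .var .dim) .next (.var .ctr % .var .dim))

/-- Write the output. -/
def answer : Prog :=
  .seq (.fill (.var .n * .var .n) .distOut
      (.ite (.op .lt (entry .dist (.var .ctr / .var .n) (.var .ctr % .var .n)) (.var .cap - 1))
        (entry .dist (.var .ctr / .var .n) (.var .ctr % .var .n)) 0))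
    (.fill (.var .n * .var .n) .nextOut (entry .next (.var .ctr / .var .n) (.var .ctr % .var .n)))

/-- Solve APSP with weights at most `n ^ c` by means of an algorithm `P` for Viterbi Path with
exponent `p / q`. -/
def apsp (p q c : ℕ) (P : Prog) : Prog :=
  .seq (.setup p q c) (.seq .edges (.seq (.closure P) .answer))

end Prog

/-- Both least values are found by counted loops that stop changing once the target is reached.
Linear time is affordable here. The exponents enter `D` because powers are written out as products.
-/
theorem Runs.setup {p q c : ℕ} (hM : (X + 2) ^ D ≤ M) (hD : 200 + 20 * (p + q + c) ≤ D)
    {n a l : ℕ} (hp : 0 < p) (ha : IsLeast {a | n ≤ a ^ (p + 2 * q)} a)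
    (hl : IsLeast {l | n ^ (c + 1) < 2 ^ l} l) (hn : 0 < n)
    (hX : (Sizes.ofBase n a p q l).Small X) (hnX : (c + 1) * n ≤ X)
    {σ : Store} (hσ : σ.Bounded X) (hσn : σ.reg .n = n) :
    Runs M X (.setup p q c) σ (((c + 1) * n + n + 2) * (3 * D + 3) + 9 * (D + 1)) fun σ' =>
      σ'.HasSizes (.ofBase n a p q l) ∧ σ'.arr = σ.arr ∧ σ'.reg .epoch = σ.reg .epoch := by
  have ha0 : 0 < a := Nat.pos_of_ne_zero fun h => by
    have := ha.1
    simp only [Set.mem_ofPred_eq, h, zero_pow (show p + 2 * q ≠ 0 by omega)] at this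
    omega
  have hbase : ∀ b < a, b ^ (p + 2 * q) < n := fun b hb => by
    by_contra h
    exact absurd (ha.2 (show n ≤ b ^ (p + 2 * q) by omega)) (by omega)
  have hcap : ∀ k < l, ¬ n ^ (c + 1) < 2 ^ k := fun k hk h => absurd (hl.2 h) (by omega)
  have haN : a ≤ a ^ (p + 2 * q) := Nat.le_self_pow (by omega) a
  have hNX : a ^ (p + 2 * q) ≤ X := (Nat.le_mul_self _).trans (by have := hX.N; simp [Sizes.ofBase] at this; omega)
  have hpowX : ∀ k ≤ p + 2 * q, a ^ k ≤ X := fun k hk => (Nat.pow_le_pow_right ha0 hk).trans hNX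
  have hTX : (3 * a) ^ p ≤ X := hX.T
  have hmX : (3 * a) ^ q ≤ X := (Nat.le_mul_self _).trans hX.m
  have hVX : 2 ^ l ≤ X := hX.V
  -- The loop for `cap` is long enough, because `n < 2 ^ n` gives `n ^ (c + 1) < 2 ^ ((c + 1) * n)`.
  have hlm : l ≤ (c + 1) * n := hl.2 (by
    rw [Set.mem_ofPred_eq, mul_comm, pow_mul]
    exact Nat.pow_lt_pow_left Nat.lt_two_pow_self (by omega))
  have hnX' : n ≤ X := (Nat.le_mul_of_pos_left _ (by omega)).trans hnX
  have h2 := hX.two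
  refine (assign_seq (B := (n + 1) * (3 * D + 3) + ((D + 1) + (((c + 1) * n + 1) * (3 * D + 3) +
    (7 * (D + 1))))) hM hσ (by simp; omega) (by simp; omega) fun hσ₁ => ?_).mono ?_ fun _ _ h => h
  · have hn₁ : (Expr.var .n).eval (σ.setReg .base ((1 : Expr).eval σ)) = n := by simp [hσn]
    have hfold := fold (x := .base) (m := .var .n) (e := .ite (.op .lt ((Expr.var .base).pow
        (p + 2 * q)) (.var .n)) (.var .base + 1) (.var .base)) hM (by omega) hσ₁
      (by simp; omega) (by rw [hn₁]; exact hnX') (by simp; omega) (by simp)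
      -- Either the target is reached, or every iteration so far has increased the value by one.
      (fun j v => 1 ≤ v ∧ v ≤ a ∧ (v = a ∨ v + j = n + 1)) (by rw [hn₁]; simp; omega) ?_
    · rw [hn₁] at hfold
      refine hfold.seq ?_
      rintro _ hσ₂ ⟨v, rfl, -, hva, hv⟩
      obtain rfl : v = a := by
        rcases hv with hv | hv
        · exact hv
        · by_contra hne
          have h1 := hbase v (by omega)
          have h2 : v ≤ v ^ (p + 2 * q) := Nat.le_self_pow (by omega) v
          omega
      refine assign_seq hM hσ₂ (by simp; omega) (by simp; omega) fun hσ₃ => ?_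
      set σ₃ := (((σ.setReg .base ((1 : Expr).eval σ)).setReg .ctr 0).setReg .base v).setReg .cap
        ((1 : Expr).eval (((σ.setReg .base ((1 : Expr).eval σ)).setReg .ctr 0).setReg .base v))
        with hσ₃def
      have hn₃ : (Expr.lit (c + 1) * .var .n).eval σ₃ = (c + 1) * n := by simp [hσn, hσ₃def]
      have hfold := fold (x := .cap) (m := .lit (c + 1) * .var .n)
        (e := .ite (.op .lt ((Expr.var .n).pow (c + 1)) (.var .cap)) (.var .cap)
              (.var .cap + .var .cap)) hM (by omega) hσ₃
        (by simp; omega) (by rw [hn₃]; exact hnX) (by simp; omega) (by simp)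
        (fun j v => ∃ k ≤ l, v = 2 ^ k ∧ (k = l ∨ k + j = (c + 1) * n))
        (by rw [hn₃]; exact ⟨0, by omega, by simp [hσ₃def], by simp⟩) ?_
      · rw [hn₃] at hfold
        refine hfold.seq ?_
        rintro _ hσ₄ ⟨w, rfl, k, hkl, rfl, hk⟩
        obtain rfl : k = l := by omega
        have e1 : v ^ (p + 2 * q) ≤ X := hNX
        refine (assign_seq hM hσ₄ (by simp; omega) (by simpa [hσ₃def] using hNX) fun h₁ =>
          assign_seq hM h₁ (by simp; omega)
            (by simpa [hσ₃def] using hpowX q (by omega)) fun h₂ =>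
          assign_seq hM h₂ (by simp; omega)
            (by simpa [hσ₃def] using hpowX p (by omega)) fun h₃ =>
          assign_seq hM h₃ (by simp; omega)
            (by simpa [hσ₃def] using hpowX (p + q) (by omega)) fun h₄ =>
          assign_seq hM h₄ (by simp; omega)
            (by simpa [hσ₃def] using hpowX (2 * q) (by omega)) fun h₅ =>
          assign_seq hM h₅ (by simp; omega) (by simpa [hσ₃def] using hmX) fun h₆ =>
          assign hM h₆ (by simp; omega) (by simpa [hσ₃def] using hTX) _).mono (by omega) ?_
        rintro _ - rfl
        refine ⟨?_, by simp [hσ₃def], by simp [hσ₃def]⟩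
        constructor <;> simp [hσ₃def, Sizes.ofBase, hσn]
      · rintro j _ - ⟨k, hkl, rfl, hk⟩
        simp only [eval_ite_lt, eval_pow, eval_var, eval_add, Store.reg_setReg]
        simp only [reduceCtorEq, if_false, if_true, hσ₃def, Store.reg_setReg, hσn]
        by_cases hkl' : k = l
        · subst hkl'
          have h1 := hl.1
          rw [Set.mem_ofPred_eq] at h1
          rw [if_pos h1]
          exact ⟨hVX, k, le_rfl, rfl, .inl rfl⟩
        · have hlt : k < l := by omega
          rw [if_neg (hcap k hlt), ← two_mul, ← pow_succ']
          exact ⟨(Nat.pow_le_pow_right (by omega) hlt).trans hVX, k + 1, hlt, rfl, by omega⟩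
    · rintro j v - ⟨hv1, hva, hv⟩
      simp only [eval_ite_lt, eval_pow, eval_var, eval_add, eval_one, Store.reg_setReg]
      simp only [reduceCtorEq, if_false, if_true, hσn]
      by_cases hva' : v = a
      · subst hva'
        have h1 := ha.1
        rw [Set.mem_ofPred_eq] at h1
        rw [if_neg (by omega)]
        omega
      · rw [if_pos (hbase v (by omega))]
        omega
  · ring_nf
    omega

theorem Runs.edges (hM : (X + 2) ^ D ≤ M) (hD : 200 ≤ D) {z : Sizes} (hX : z.Small X) {W : ℕ}
    {G : WeightedGraph z.n W} (hn : z.n ≤ z.N) (hW : W ≤ z.V - 1) {σ : Store} (hσ : σ.Bounded X)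
    (hs : σ.HasSizes z)
    (hin : ∀ u v : Fin z.n, σ.arr .input (u * z.n + v) = G.entry u v) :
    Runs M X .edges σ (2 * ((z.N * z.N + 1) * (4 * D + 4))) fun σ' => σ'.HasSizes z ∧
      (∀ i, σ'.arr (.value i) = σ.arr (.value i) ∧ σ'.arr (.stamp i) = σ.arr (.stamp i)) ∧
      σ'.reg .epoch = σ.reg .epoch ∧
      G.Approximates z.N (z.V - 1) 1 (z.mat (σ'.arr .dist)) (z.mat (σ'.arr .next)) := by
  have hVX : z.V - 1 ≤ X := (Nat.sub_le _ _).trans hX.V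
  have hNX := hX.le
  rw [two_mul]
  refine (fill_mat hM hD hX hσ hs (by simp; omega) (f := fun k => if k / z.N = k % z.N then 0 else
    if k / z.N < z.n then if k % z.N < z.n then
      if σ.arr .input (k / z.N * z.n + k % z.N) = 0 then z.V - 1
        else σ.arr .input (k / z.N * z.n + k % z.N)
      else z.V - 1 else z.V - 1) ?_ ?_ (by simp)).seq ?_
  · intro k
    simp [hs.dim, hs.n, hs.cap]
  · intro k _
    have := hσ.arr .input (k / z.N * z.n + k % z.N)
    split_ifs <;> omega
  rintro _ hσ₁ ⟨d, rfl, -, hd⟩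
  refine (fill_mat hM hD hX hσ₁ ((hs.setReg (x := .ctr) 0 id).setArr .dist d) (by simp; omega)
    (f := fun k => k % z.N) (by simp [hs.dim]) ?_ (by simp)).mono le_rfl ?_
  · intro k hk
    exact (Nat.mod_le _ _).trans (by omega)
  rintro _ - ⟨x, rfl, -, hx⟩
  refine ⟨(((hs.setReg (x := .ctr) 0 id).setArr .dist d).setReg (x := .ctr) 0 id).setArr .next x,
    by simp, by simp, ?_⟩
  refine (G.approximates_edgeMatrix hW).congr hn ?_ ?_
  · intro i hi j hj
    have h1 : z.mat d i j = _ := hd i hi j hj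
    simp only [Sizes.mat, z.index_div hj, z.index_mod hj] at h1
    simp only [Sizes.mat, WeightedGraph.edgeMatrix]
    simp
    rw [h1]
    by_cases hij : i = j
    · simp [hij]
    · rw [if_neg hij, if_neg hij]
      by_cases h : i < z.n ∧ j < z.n
      · rw [if_pos h.1, if_pos h.2, dif_pos h, ← hin ⟨i, h.1⟩ ⟨j, h.2⟩]
      · rw [dif_neg h]
        split_ifs <;> first | rfl | tauto
  · intro i hi j hj
    have := hx i hi j hj
    simp only [Sizes.mat, z.index_mod hj] at this ⊢
    simpa using this

theorem Runs.answer (hM : (X + 2) ^ D ≤ M) (hD : 200 ≤ D) {z : Sizes} (hX : z.Small X)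
    (hn : z.n ≤ z.N) {σ : Store} (hσ : σ.Bounded X) (hs : σ.HasSizes z) :
    Runs M X .answer σ (2 * ((z.n * z.n + 1) * (4 * D + 4))) fun σ' =>
      ∀ u < z.n, ∀ v < z.n,
        (σ'.arr .distOut (u * z.n + v) = if z.mat (σ.arr .dist) u v < z.V - 1 then
          z.mat (σ.arr .dist) u v else 0) ∧
        σ'.arr .nextOut (u * z.n + v) = z.mat (σ.arr .next) u v := by
  have hnX : z.n * z.n ≤ X := (Nat.mul_le_mul hn hn).trans hX.le
  have hev : (Expr.var .n * .var .n).eval σ = z.n * z.n := by simp [hs.n]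
  have hbound : ∀ (x : Arr) (k : ℕ), σ.arr x k ≤ X := hσ.arr
  have h := fill (x := .distOut) (m := .var .n * .var .n) (e := .ite (.op .lt
      (entry .dist (.var .ctr / .var .n) (.var .ctr % .var .n)) (.var .cap - 1))
        (entry .dist (.var .ctr / .var .n) (.var .ctr % .var .n)) 0) hM (by omega) hσ
    (by simp; omega) (by rw [hev]; exact hnX) (by simp [entry]; omega)
    (fun k _ => by
      rw [eval_ite_lt]
      split
      · exact hbound _ _
      · exact Nat.zero_le _) (by simp [entry])
  rw [hev] at h
  rw [two_mul]
  refine h.seq ?_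
  rintro _ hσ₁ rfl
  have h := fill (x := .nextOut) (m := .var .n * .var .n)
    (e := entry .next (.var .ctr / .var .n) (.var .ctr % .var .n)) hM (by omega) hσ₁
    (by simp; omega) (by simpa [hs.n] using hnX) (by simp [entry]; omega)
    (fun k _ => by
      simp only [entry, eval_read, Store.arr_setReg]
      exact hσ₁.arr _ _) (by simp [entry])
  simp only [eval_mul, eval_var, Store.reg_setArr, Store.reg_setReg, reduceCtorEq, if_false,
    hs.n] at h
  refine h.mono le_rfl ?_
  rintro _ - rfl u hu v hv
  have hlt : u * z.n + v < z.n * z.n := by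
    calc u * z.n + v < (u + 1) * z.n := by rw [add_mul, one_mul]; omega
      _ ≤ _ := Nat.mul_le_mul_right _ hu
  have hdiv : (u * z.n + v) / z.n = u := by
    rw [mul_comm, Nat.mul_add_div (by omega), Nat.div_eq_of_lt hv, add_zero]
  have hmod : (u * z.n + v) % z.n = v := by
    rw [mul_comm, Nat.mul_add_mod, Nat.mod_eq_of_lt hv]
  constructor <;> simp [entry, hlt, hs.n, hs.dim, hs.cap, hdiv, hmod, Sizes.mat]
  rfl

/-- The time bound of the APSP algorithm. -/
def apspTime (D : ℕ) (z : Sizes) (P : Prog) (τ l c : ℕ) : ℕ :=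
  ((c + 1) * z.n + z.n + 2) * (3 * D + 3) + 9 * (D + 1) + (2 * ((z.N * z.N + 1) * (4 * D + 4)) +
    (closureTime D z P τ l + 2 * ((z.n * z.n + 1) * (4 * D + 4))))

/-- Infinity is `V - 1`. Since `V` exceeds `n ^ (c + 1)`, this is at least `n * n ^ c`, as
`Approximates.correct` requires. -/
theorem exec_apsp {p q c : ℕ} (hM : (X + 2) ^ D ≤ M) (hD : 200 + 20 * (p + q + c) ≤ D)
    {n a l : ℕ} (hp : 0 < p) (hq : 0 < q) (ha : IsLeast {a | n ≤ a ^ (p + 2 * q)} a)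
    (hl : IsLeast {l | n ^ (c + 1) < 2 ^ l} l) (hn : 0 < n)
    (hX : (Sizes.ofBase n a p q l).Small X) (hnX : (c + 1) * n ≤ X)
    (hE : (l + 1) * (l * (2 * (a ^ (p + 2 * q) * a ^ (p + 2 * q)))) ≤ X)
    {α : ℚ} {c' τ : ℕ} {P : Prog} (hP : Oracle α c' (.ofBase n a p q l) X P τ)
    (G : (apspProblem c).Inst n) :
    ∃ s t, Exec M (.apsp p q c P) ((apspProblem c).init G) s t ∧
      t ≤ apspTime D (.ofBase n a p q l) P τ l c ∧ (apspProblem c).Correct G s := by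
  have ha0 : 0 < a := Nat.pos_of_ne_zero fun h => by
    have := ha.1
    simp only [Set.mem_ofPred_eq, h, zero_pow (show p + 2 * q ≠ 0 by omega)] at this
    omega
  set z := Sizes.ofBase n a p q l with hz
  have hnN : z.n ≤ z.N := ha.1
  have hval : z.Valid := Sizes.valid_ofBase ha0 hp hq
  have hV : n * n ^ c ≤ z.V - 1 := by
    have := hl.1
    rw [Set.mem_ofPred_eq, pow_succ, mul_comm] at this
    simp only [hz, Sizes.ofBase]
    omega
  have hW : n ^ c ≤ z.V - 1 := (Nat.le_mul_of_pos_left _ hn).trans hV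
  change WeightedGraph n (n ^ c) at G
  -- Variable `n` and array `input` have number 0, where the problem places its input. Everything
  -- else is zero initially, in particular the epoch and all stamps.
  let σ : Store :=
    { reg := fun x => if x = .n then n else 0
      arr := fun x a => if x = .input then ((apspProblem c).init G).mem 0 a else 0 }
  have hmem : ∀ a, ((apspProblem c).init G).mem 0 a ≤ X := fun a => by
    have h1 := hX.V
    simp only [apspProblem]
    split_ifs
    · exact (G.entry_le _ _).trans (by omega)
    · omega
  have hσ : σ.Bounded X := by
    have hnX' : n ≤ X := (Nat.le_mul_of_pos_left _ (by omega)).trans hnX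
    constructor
    · intro x
      simp only [σ]
      split_ifs <;> omega
    · intro x a
      simp only [σ]
      split_ifs
      · exact hmem a
      · omega
  have hholds : Holds ((apspProblem c).init G) σ := by
    constructor
    · intro x
      cases x <;> rfl
    · intro x a
      by_cases hx : x = .input
      · simp [hx, σ, Arr.num]
      · have : x.num ≠ 0 := by cases x <;> simp_all [Arr.num]
        simp [σ, hx, apspProblem, this]
  have hinput : ∀ u v : Fin n, σ.arr .input (u * n + v) = G.entry u v := fun u v => by
    have hlt : (u : ℕ) * n + v < n * n := by
      calc (u : ℕ) * n + v < (u + 1) * n := by rw [add_mul, one_mul]; omega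
        _ ≤ _ := Nat.mul_le_mul_right _ u.2
    simp only [σ, apspProblem, if_true, true_and, hlt, dif_pos]
    congr 1
    · ext
      simp only
      rw [mul_comm, Nat.mul_add_div hn, Nat.div_eq_of_lt v.2, add_zero]
    · ext
      simp only
      rw [mul_comm, Nat.mul_add_mod, Nat.mod_eq_of_lt v.2]
  have hrun : Runs M X (.apsp p q c P) σ (apspTime D z P τ l c) fun σ' => ∃ d x : ℕ → ℕ → ℕ,
      G.Approximates z.N (z.V - 1) (2 ^ (l + 1)) d x ∧ ∀ u < n, ∀ v < n,
        (σ'.arr .distOut (u * n + v) = if d u v < z.V - 1 then d u v else 0) ∧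
        σ'.arr .nextOut (u * n + v) = x u v := by
    refine (Runs.setup hM hD hp ha hl hn hX hnX hσ (by simp [σ])).seq ?_
    rintro σ₁ hσ₁ ⟨hs₁, harr₁, hep₁⟩
    refine (Runs.edges hM (by omega) hX (G := G) hnN hW hσ₁ hs₁ ?_).seq ?_
    · rw [harr₁]
      exact hinput
    rintro σ₂ hσ₂ ⟨hs₂, harr₂, hep₂, happ₂⟩
    have hst : σ₂.Stamped := fun i a => by
      rw [(harr₂ i).2, harr₁]
      simp [σ]
    refine (Runs.closure hM (by omega) hval hX hP rfl hnN hE hσ₂ hs₂ hst ?_ happ₂).seq ?_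
    · rw [hep₂, hep₁]
      simp [σ]
    rintro σ₃ hσ₃ ⟨hs₃, happ₃⟩
    exact (Runs.answer hM (by omega) hX hnN hσ₃ hs₃).mono le_rfl fun σ₄ _ h => ⟨_, _, happ₃, h⟩
  obtain ⟨s, t, σ', hex, ht, hs, -, d, x, happ, hout⟩ := hrun _ hholds
  refine ⟨s, t, hex, ht, fun u v => ?_⟩
  have hl' : n ≤ 2 ^ (l + 1) := by
    have h1 := hl.1
    rw [Set.mem_ofPred_eq] at h1
    have h2 : n ≤ n ^ (c + 1) := Nat.le_self_pow (by omega) n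
    have h3 : 2 ^ l ≤ 2 ^ (l + 1) := Nat.pow_le_pow_right (by omega) (by omega)
    omega
  have h := happ.correct hnN (Nat.one_le_pow _ _ hn) hV hl' u v
  have hd := hs.arr .distOut (u * n + v)
  have hx := hs.arr .nextOut (u * n + v)
  simp only [Arr.num] at hd hx
  obtain ⟨h1, h2⟩ := hout u u.2 v v.2
  rw [hd, hx, h1, h2]
  exact h

end WordRAM

namespace WordRAM

/-! ### Bounds -/

theorem exists_isLeast_nat {p : ℕ → Prop} (h : ∃ a, p a) : ∃ a, IsLeast {a | p a} a := by
  classical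
  exact ⟨Nat.find h, Nat.find_spec h, fun b hb => Nat.find_min' h hb⟩

/-- Padding costs only a constant factor: for `a ≥ 2` one has `a ≤ 2 * (a - 1)`, and `(a - 1) ^ e <
n` by minimality. -/
theorem pow_le_of_isLeast {n e a : ℕ} (hn : 0 < n) (ha : IsLeast {a | n ≤ a ^ e} a) :
    a ^ e ≤ 2 ^ e * n := by
  rcases Nat.lt_or_ge a 2 with h | h
  · calc a ^ e ≤ 1 ^ e := Nat.pow_le_pow_left (by omega) e
      _ = 1 * 1 := by simp
      _ ≤ 2 ^ e * n := Nat.mul_le_mul Nat.one_le_two_pow hn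
  · have h1 : (a - 1) ^ e < n := by
      by_contra hc
      have := ha.2 (show n ≤ (a - 1) ^ e by omega)
      omega
    calc a ^ e ≤ (2 * (a - 1)) ^ e := Nat.pow_le_pow_left (by omega) e
      _ = 2 ^ e * (a - 1) ^ e := mul_pow _ _ _
      _ ≤ _ := Nat.mul_le_mul_left _ h1.le

theorem two_pow_le_of_isLeast {N l : ℕ} (hN : 0 < N) (hl : IsLeast {l | N < 2 ^ l} l) :
    2 ^ l ≤ 2 * N := by
  cases l with
  | zero => omega
  | succ l =>
    have : 2 ^ l ≤ N := by
      by_contra hc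
      have := hl.2 (show N < 2 ^ l by omega)
      omega
    rw [pow_succ']
    omega

/-- The number of states is chosen as a `q`-th power so that `m ^ (p / q)` is an integer and the
ceiling is harmless. -/
theorem numObs_pow (p b : ℕ) {q : ℕ} (hq : 0 < q) : numObs ((p : ℚ) / q) (b ^ q) = b ^ p := by
  have hq' : (q : ℝ) ≠ 0 := by positivity
  have : ((b ^ q : ℕ) : ℝ) ^ ((((p : ℚ) / q : ℚ)) : ℝ) = ((b ^ p : ℕ) : ℝ) := by
    push_cast
    rw [← Real.rpow_natCast, ← Real.rpow_mul (by positivity), mul_div_cancel₀ _ hq',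
      Real.rpow_natCast]
  rw [numObs, this, Nat.ceil_natCast]

/-- A search takes at least `37 * (D + 1)` steps in this accounting, which absorbs the bookkeeping
around it. -/
theorem apspTime_le (D : ℕ) {z : Sizes} (hn : z.n ≤ z.N) (P : Prog) (τ l c : ℕ) :
    apspTime D z P τ l c ≤ (c + 15) * ((l + 2) ^ 2 * ((z.N * z.N + 1) * queryTime D z P τ)) := by
  have hQ : 37 * (D + 1) ≤ queryTime D z P τ := by
    unfold queryTime
    nlinarith [Nat.zero_le (D * (8 * (z.m * z.m + z.T * z.m + z.T) + 3 * z.h))]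
  have hN := Nat.le_mul_self z.N
  have hn2 : z.n * z.n ≤ z.N * z.N := Nat.mul_le_mul hn hn
  unfold apspTime closureTime squareTime
  set Q := queryTime D z P τ
  set R := z.N * z.N + 1 with hR
  set Y := (l + 2) ^ 2 * (R * Q) with hY
  have hRQ : R * Q ≤ Y := Nat.le_mul_of_pos_left _ (by positivity)
  have hQR : Q ≤ R * Q := Nat.le_mul_of_pos_left _ (by omega)
  have h1 : ((c + 1) * z.n + z.n + 2) * (3 * D + 3) ≤ (c + 2) * Y := by
    calc ((c + 1) * z.n + z.n + 2) * (3 * D + 3) ≤ ((c + 2) * R) * Q := by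
          refine Nat.mul_le_mul ?_ (by omega)
          have : z.n + 1 ≤ R := by omega
          nlinarith
      _ = (c + 2) * (R * Q) := mul_assoc _ _ _
      _ ≤ _ := Nat.mul_le_mul_left _ hRQ
  have h2 : 9 * (D + 1) ≤ Y := by omega
  have h3 : 2 * (R * (4 * D + 4)) ≤ Y := by
    calc 2 * (R * (4 * D + 4)) = R * (8 * D + 8) := by ring
      _ ≤ R * Q := Nat.mul_le_mul_left _ (by omega)
      _ ≤ Y := hRQ
  have h4 : 2 * ((z.n * z.n + 1) * (4 * D + 4)) ≤ Y := by
    refine le_trans ?_ h3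
    exact Nat.mul_le_mul_left _ (Nat.mul_le_mul_right _ (by omega))
  have h5 : (l + 2) * ((l + 1) * (R * (2 * Q + 40 * D + 60)) + D + 2) ≤ 5 * Y := by
    calc (l + 2) * ((l + 1) * (R * (2 * Q + 40 * D + 60)) + D + 2)
        ≤ (l + 2) * ((l + 2) * (R * (4 * Q)) + (l + 2) * (R * Q)) := by
          refine Nat.mul_le_mul_left _ ?_
          rw [add_assoc]
          refine Nat.add_le_add ?_ ?_
          · exact Nat.mul_le_mul (by omega) (Nat.mul_le_mul_left _ (by omega))
          · have : R * Q ≤ (l + 2) * (R * Q) := Nat.le_mul_of_pos_left _ (by omega)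
            omega
      _ = 5 * Y := by rw [hY]; ring
  nlinarith

theorem queryTime_le (D : ℕ) {z : Sizes} (P : Prog) {τ : ℕ} {K F : ℝ} (hF : 1 ≤ F)
    (hm : ((z.m * z.m : ℕ) : ℝ) ≤ F) (hTm : ((z.T * z.m : ℕ) : ℝ) ≤ F) (hT : (z.T : ℝ) ≤ F)
    (hh : (z.h : ℝ) ≤ F) (hτ : (τ : ℝ) ≤ K * F) :
    (queryTime D z P τ : ℝ) ≤ (64 * (D + 1) + (P.regBound + 7) + 4 * K) * F := by
  unfold queryTime
  push_cast at hm hTm ⊢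
  have h1 : (D + 1 : ℝ) * (8 * (z.m * z.m + z.T * z.m + z.T) + 3 * z.h + 37) ≤
      (D + 1) * (64 * F) := mul_le_mul_of_nonneg_left (by linarith) (by positivity)
  have h2 : (P.regBound + 7 : ℝ) * 1 ≤ (P.regBound + 7) * F :=
    mul_le_mul_of_nonneg_left hF (by positivity)
  nlinarith

/-- Since `log n ≤ n ^ η / η`, the logarithmic factors are dominated by arbitrarily small powers of
`n`. -/
theorem log_bound {n c l : ℕ} (hn : 1 ≤ n) (hl : 2 ^ l ≤ 2 * n ^ (c + 1)) {η : ℝ} (hη : 0 < η) :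
    (l + 2 : ℝ) ≤ (3 + 2 * (c + 1) / η) * (n : ℝ) ^ η := by
  have hn' : (1 : ℝ) ≤ n := by exact_mod_cast hn
  have h1 : (l : ℝ) * Real.log 2 ≤ Real.log 2 + (c + 1) * Real.log n := by
    have h : ((2 : ℝ) ^ l) ≤ 2 * (n : ℝ) ^ (c + 1) := by exact_mod_cast hl
    have := Real.log_le_log (by positivity) h
    rw [Real.log_pow, Real.log_mul (by norm_num) (by positivity), Real.log_pow] at this
    push_cast at this
    exact this
  have h2 : Real.log n ≤ (n : ℝ) ^ η / η := Real.log_le_rpow_div (by positivity) hη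
  have h3 : (1 : ℝ) ≤ (n : ℝ) ^ η := Real.one_le_rpow hn' hη.le
  have h4 : (1 / 2 : ℝ) ≤ Real.log 2 := by
    have := Real.log_two_gt_d9
    linarith
  have h5 : (c + 1 : ℝ) * Real.log n ≤ (c + 1) * ((n : ℝ) ^ η / η) :=
    mul_le_mul_of_nonneg_left h2 (by positivity)
  have h6 : (l : ℝ) ≤ 1 + 2 * ((c + 1) * ((n : ℝ) ^ η / η)) := by
    have h7 : 0 ≤ (c + 1 : ℝ) * ((n : ℝ) ^ η / η) := by positivity
    by_contra hc
    push Not at hc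
    nlinarith
  have h8 : (3 + 2 * (c + 1) / η) * (n : ℝ) ^ η =
      3 * (n : ℝ) ^ η + 2 * ((c + 1) * ((n : ℝ) ^ η / η)) := by
    field_simp
  rw [h8]
  linarith

theorem sq_bound {n N e : ℕ} (hn : 1 ≤ n) (hN : N ≤ 2 ^ e * n) :
    (N * N + 1 : ℝ) ≤ (2 * (2 ^ e) ^ 2) * (n : ℝ) ^ 2 := by
  have h1 : N * N ≤ (2 ^ e * n) * (2 ^ e * n) := Nat.mul_le_mul hN hN
  have h2 : 1 ≤ (2 ^ e * n) * (2 ^ e * n) :=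
    Nat.mul_pos (by positivity) (by positivity)
  have h3 : N * N + 1 ≤ (2 * (2 ^ e) ^ 2) * n ^ 2 := by
    calc N * N + 1 ≤ 2 * ((2 ^ e * n) * (2 ^ e * n)) := by omega
      _ = _ := by ring
  exact_mod_cast h3

theorem rpow_bound {n a e : ℕ} (ha : a ^ e ≤ 2 ^ e * n) {δ : ℝ} (hδ : 0 ≤ δ) (hδ1 : δ ≤ 1) :
    ((3 * a : ℝ) ^ e) ^ (1 - δ) ≤ 6 ^ e * (n : ℝ) ^ (1 - δ) := by
  have h1 : (3 * a : ℝ) ^ e ≤ 6 ^ e * n := by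
    have h : (3 * a) ^ e ≤ 6 ^ e * n := by
      calc (3 * a) ^ e = 3 ^ e * a ^ e := mul_pow _ _ _
        _ ≤ 3 ^ e * (2 ^ e * n) := Nat.mul_le_mul_left _ ha
        _ = 6 ^ e * n := by rw [← mul_assoc, ← mul_pow]; norm_num
    exact_mod_cast h
  have h6 : (1 : ℝ) ≤ 6 ^ e := one_le_pow₀ (by norm_num)
  calc ((3 * a : ℝ) ^ e) ^ (1 - δ) ≤ (6 ^ e * (n : ℝ)) ^ (1 - δ) :=
        Real.rpow_le_rpow (by positivity) h1 (by linarith)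
    _ = ((6 : ℝ) ^ e) ^ (1 - δ) * (n : ℝ) ^ (1 - δ) :=
        Real.mul_rpow (by positivity) (by positivity)
    _ ≤ 6 ^ e * (n : ℝ) ^ (1 - δ) := by
        refine mul_le_mul_of_nonneg_right ?_ (by positivity)
        calc ((6 : ℝ) ^ e) ^ (1 - δ) ≤ ((6 : ℝ) ^ e) ^ (1 : ℝ) :=
              Real.rpow_le_rpow_of_exponent_le h6 (by linarith)
          _ = 6 ^ e := Real.rpow_one _

/-- The exponent on both sides is `3 - δ / 2`: half of the saving `δ` pays for the two logarithmic
factors. -/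
theorem rpow_mul_rpow_bound {x : ℝ} (hx : 0 < x) (δ : ℝ) :
    (x ^ (δ / 4)) ^ 2 * (x ^ 2 * x ^ (1 - δ)) = (x ^ 3) ^ (1 - δ / 6) := by
  rw [← Real.rpow_natCast, ← Real.rpow_natCast, ← Real.rpow_natCast, ← Real.rpow_mul hx.le,
    ← Real.rpow_mul hx.le, ← Real.rpow_add hx, ← Real.rpow_add hx]
  congr 1
  push_cast
  ring

/-- A polynomial bound for all numbers that occur in the APSP algorithm. -/
theorem Sizes.small_ofBase {n a p q c l k κ : ℕ} (hn : 0 < n) (ha0 : 0 < a)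
    (hp : 0 < p) (hq : 0 < q)
    (ha : a ^ (p + 2 * q) ≤ 2 ^ (p + 2 * q) * n) (hl : 2 ^ l ≤ 2 * n ^ (c + 1))
    (hκ : 2 * (c + 2) + 2 * (p + 2 * q) + 3 + (2 * (p + 2 * q) + 1) * k ≤ κ) :
    (Sizes.ofBase n a p q l).Small ((n + 2) ^ κ) ∧ (c + 1) * n ≤ (n + 2) ^ κ ∧
      (l + 1) * (l * (2 * (a ^ (p + 2 * q) * a ^ (p + 2 * q)))) ≤ (n + 2) ^ κ ∧
      ((3 * a) ^ q + 2) ^ k ≤ (n + 2) ^ κ := by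
  set e := p + 2 * q with he
  set Y := n + 2 with hY
  have hpow : ∀ {x j : ℕ}, x ≤ Y ^ j → j ≤ κ → x ≤ Y ^ κ := fun hx hj =>
    hx.trans (Nat.pow_le_pow_right (by omega) hj)
  have hN : a ^ e ≤ Y ^ (e + 1) := by
    calc a ^ e ≤ 2 ^ e * n := ha
      _ ≤ Y ^ e * Y := Nat.mul_le_mul (Nat.pow_le_pow_left (by omega) _) (by omega)
      _ = _ := (pow_succ _ _).symm
  have h2N : 2 * (a ^ e * a ^ e) ≤ Y ^ (2 * e + 3) := by
    calc 2 * (a ^ e * a ^ e) ≤ Y * (Y ^ (e + 1) * Y ^ (e + 1)) :=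
          Nat.mul_le_mul (by omega) (Nat.mul_le_mul hN hN)
      _ = _ := by ring
  have hb : ∀ j ≤ e, (3 * a) ^ j ≤ Y ^ (2 * e + 1) := fun j hj => by
    calc (3 * a) ^ j ≤ (3 * a) ^ e := Nat.pow_le_pow_right (by omega) hj
      _ = 3 ^ e * a ^ e := mul_pow _ _ _
      _ ≤ Y ^ e * Y ^ (e + 1) := Nat.mul_le_mul (Nat.pow_le_pow_left (by omega) _) hN
      _ = _ := by ring
  have hV : 2 ^ l ≤ Y ^ (c + 2) := by
    calc 2 ^ l ≤ 2 * n ^ (c + 1) := hl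
      _ ≤ Y * Y ^ (c + 1) := Nat.mul_le_mul (by omega) (Nat.pow_le_pow_left (by omega) _)
      _ = _ := by ring
  have hlV : l + 1 ≤ Y ^ (c + 2) := (Nat.lt_two_pow_self (n := l)).trans_le hV
  refine ⟨⟨?_, ?_, ?_, ?_, ?_, ?_⟩, ?_, ?_, ?_⟩
  · exact hpow (j := 1) (by rw [pow_one]; omega) (by omega)
  · exact hpow h2N (by omega)
  · refine hpow (j := 2 * e + 1) ?_ (by omega)
    have := hb (2 * q) (by omega)
    rwa [two_mul q, pow_add] at this
  · refine hpow (j := 2 * e + 1) ?_ (by omega)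
    have := hb (p + q) (by omega)
    rwa [pow_add] at this
  · exact hpow (hb p (by omega)) (by omega)
  · exact hpow hV (by omega)
  · refine hpow (j := c + 2) ?_ (by omega)
    calc (c + 1) * n ≤ 2 ^ (c + 1) * n := Nat.mul_le_mul_right _ Nat.lt_two_pow_self.le
      _ ≤ Y ^ (c + 1) * Y := Nat.mul_le_mul (Nat.pow_le_pow_left (by omega) _) (by omega)
      _ = _ := by ring
  · refine hpow (j := 2 * (c + 2) + (2 * e + 3)) ?_ (by omega)
    calc (l + 1) * (l * (2 * (a ^ e * a ^ e))) ≤ Y ^ (c + 2) * (Y ^ (c + 2) * Y ^ (2 * e + 3)) :=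
          Nat.mul_le_mul hlV (Nat.mul_le_mul (by omega) h2N)
      _ = _ := by ring
  -- This is the word bound `(m + 2) ^ k` of the simulated Viterbi program, with `m = (3 * a) ^ q`.
  · refine hpow (j := (2 * e + 1) * k) ?_ (by omega)
    rw [pow_mul]
    refine Nat.pow_le_pow_left ?_ k
    have h3 : 3 ≤ (3 * a) ^ q :=
      (show 3 ≤ 3 * a by omega).trans (Nat.le_self_pow (by omega) _)
    calc (3 * a) ^ q + 2 ≤ (3 * a) ^ q * (3 * a) ^ q := by nlinarith
      _ = (3 * a) ^ (2 * q) := by ring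
      _ ≤ _ := hb _ (by omega)

/-- An algorithm for Viterbi Path gives an algorithm for APSP. -/
theorem solvable_apsp {p q : ℕ} (hp : 0 < p) (hq : 0 < q) (c : ℕ) {δ : ℝ} (hδ : 0 < δ)
    (hδe : δ ≤ 1 / ((p + 2 * q : ℕ) : ℝ))
    (h : SolvableInTime (viterbiProblem ((p : ℚ) / q) ((p + 2 * q) * (c + 1) + 1))
      fun n => ((numObs ((p : ℚ) / q) n : ℝ) * (n : ℝ) ^ 2) ^ (1 - δ)) :
    SolvableInTime (apspProblem c) fun n => ((n : ℝ) ^ 3) ^ (1 - δ / 6) := by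
  obtain ⟨P, k, K, hP⟩ := h
  set e := p + 2 * q with he
  set D := 200 + 20 * (p + q + c) with hD
  set κ := 2 * (c + 2) + 2 * e + 3 + (2 * e + 1) * k with hκ
  set A : ℝ := 64 * (D + 1) + (P.regBound + 7) + 4 * |K| with hA
  set B : ℝ := 3 + 2 * (c + 1) / (δ / 4) with hB
  refine ⟨.apsp p q c P, (κ + 1) * D, (c + 15) * (B ^ 2 * ((2 * (2 ^ e) ^ 2) * (A * 6 ^ e))),
    fun n hn G => ?_⟩
  obtain ⟨a, ha⟩ := exists_isLeast_nat (p := fun a => n ≤ a ^ e)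
    ⟨n, Nat.le_self_pow (by omega) n⟩
  obtain ⟨l, hl⟩ := exists_isLeast_nat (p := fun l => n ^ (c + 1) < 2 ^ l)
    ⟨_, Nat.lt_two_pow_self⟩
  have ha0 : 0 < a := Nat.pos_of_ne_zero fun h => by
    have := ha.1
    simp only [Set.mem_ofPred_eq, h, zero_pow (show e ≠ 0 by omega)] at this
    omega
  have haN := pow_le_of_isLeast hn ha
  have hlV := two_pow_le_of_isLeast (by positivity) hl
  obtain ⟨hX, hnX, hE, hL⟩ := Sizes.small_ofBase (k := k) (κ := κ) hn ha0 hp hq haN hlV hκ.ge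
  set m := (3 * a) ^ q with hm
  have hm3 : 3 ≤ m := (show 3 ≤ 3 * a by omega).trans (Nat.le_self_pow hq.ne' _)
  have hT : numObs ((p : ℚ) / q) m = (3 * a) ^ p := numObs_pow p (3 * a) hq
  set S : ℝ := (3 * a : ℝ) ^ e with hS
  have hS' : (numObs ((p : ℚ) / q) m : ℝ) * (m : ℝ) ^ 2 = S := by
    rw [hT, hm, hS, he]
    push_cast
    ring
  have hb1 : (1 : ℝ) ≤ 3 * a := by
    have : (1 : ℝ) ≤ a := by exact_mod_cast ha0
    linarith
  have hS1 : 1 ≤ S := one_le_pow₀ hb1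
  set F : ℝ := S ^ (1 - δ) with hF
  have he1 : (1 : ℝ) ≤ (e : ℕ) := by exact_mod_cast (show 1 ≤ e by omega)
  have hδ1 : δ ≤ 1 := hδe.trans (by rw [div_le_one (by linarith)]; exact he1)
  have hF1 : 1 ≤ F := Real.one_le_rpow hS1 (by linarith)
  -- This is where `δ ≤ 1 / e` is used: `j ≤ e - 1 ≤ e * (1 - δ)`. It applies to `m ^ 2`, `T * m`
  -- and `T`, so writing an instance is no more expensive than the bound for solving it.
  have hpowF : ∀ j < e, (3 * a : ℝ) ^ j ≤ F := fun j hj => by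
    rw [hF, hS, ← Real.rpow_natCast, ← Real.rpow_natCast, ← Real.rpow_mul (by positivity)]
    refine Real.rpow_le_rpow_of_exponent_le hb1 ?_
    have h1 : (e : ℝ) * δ ≤ 1 := by
      rw [le_div_iff₀ (by linarith)] at hδe
      linarith
    have h2 : (j : ℝ) + 1 ≤ e := by exact_mod_cast hj
    linarith
  -- The constant `K` may be negative; hence the floor in the natural numbers and the bound with
  -- `|K|`.
  set τ := ⌊K * F⌋₊ with hτ
  have hτF : (τ : ℝ) ≤ |K| * F := by
    rcases le_total 0 (K * F) with h0 | h0
    · exact (Nat.floor_le h0).trans (mul_le_mul_of_nonneg_right (le_abs_self K) (by linarith))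
    · rw [hτ, Nat.floor_of_nonpos h0]
      push_cast
      positivity
  set z := Sizes.ofBase n a p q l with hz
  have horacle : Oracle ((p : ℚ) / q) (e * (c + 1) + 1) z ((n + 2) ^ κ) P τ := by
    refine ⟨hT.symm, ?_, _, hL, fun x => ?_⟩
    -- The entries are polynomial in `n`, but must be bounded by a power of the much smaller `m`.
    -- From `n ≤ a ^ e ≤ m ^ e` comes the exponent `e * (c + 1) + 1`.
    · calc 2 ^ l ≤ 2 * n ^ (c + 1) := hlV
        _ ≤ m * (m ^ e) ^ (c + 1) := by
          refine Nat.mul_le_mul (by omega) (Nat.pow_le_pow_left (ha.1.trans ?_) _)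
          refine Nat.pow_le_pow_left ?_ e
          exact (show a ≤ 3 * a by omega).trans (Nat.le_self_pow hq.ne' _)
        _ = m ^ (e * (c + 1) + 1) := by ring
    · obtain ⟨s, t, hex, ht, hs⟩ := hP m (by omega) x
      refine ⟨s, t, hex, Nat.le_floor ?_, hs⟩
      simpa only [hS'] using ht
  have hM : ((n + 2) ^ κ + 2) ^ D ≤ (n + 2) ^ ((κ + 1) * D) := by
    rw [pow_mul]
    refine Nat.pow_le_pow_left ?_ D
    have : 1 ≤ (n + 2) ^ κ := Nat.one_le_pow _ _ (by omega)
    rw [pow_succ]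
    nlinarith
  obtain ⟨s, t, hex, ht, hs⟩ := exec_apsp hM le_rfl hp hq ha hl hn hX hnX hE horacle G
  refine ⟨s, t, hex, ?_, hs⟩
  have hn1 : (1 : ℝ) ≤ n := by exact_mod_cast hn
  have hn0 : (0 : ℝ) < n := by linarith
  have ht' : (t : ℝ) ≤ (c + 15) * ((l + 2) ^ 2 * ((z.N * z.N + 1) * queryTime D z P τ)) := by
    exact_mod_cast ht.trans (apspTime_le D (z := z) ha.1 P τ l c)
  have hlog : (l + 2 : ℝ) ≤ B * (n : ℝ) ^ (δ / 4) := log_bound hn hlV (by positivity)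
  have hNN : (z.N * z.N + 1 : ℝ) ≤ (2 * (2 ^ e) ^ 2) * (n : ℝ) ^ 2 := sq_bound hn haN
  have hA0 : 0 ≤ A := by positivity
  have hFn : F ≤ 6 ^ e * (n : ℝ) ^ (1 - δ) := rpow_bound haN hδ.le hδ1
  have hQ : (queryTime D z P τ : ℝ) ≤ A * F := by
    refine queryTime_le D P hF1 ?_ ?_ ?_ ?_ hτF
    · have := hpowF (2 * q) (by omega)
      rw [two_mul q, pow_add] at this
      exact_mod_cast this
    · have := hpowF (p + q) (by omega)
      rw [pow_add] at this
      exact_mod_cast this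
    · exact_mod_cast hpowF p (by omega)
    · refine le_trans ?_ (hpowF p (by omega))
      have : a ^ p ≤ (3 * a) ^ p := Nat.pow_le_pow_left (by omega) p
      exact_mod_cast this
  calc (t : ℝ) ≤ (c + 15) * ((l + 2) ^ 2 * ((z.N * z.N + 1) * queryTime D z P τ)) := ht'
    _ ≤ (c + 15) * ((B * (n : ℝ) ^ (δ / 4)) ^ 2 * (((2 * (2 ^ e) ^ 2) * (n : ℝ) ^ 2) *
        (A * (6 ^ e * (n : ℝ) ^ (1 - δ))))) := by
      gcongr
      exact hQ.trans (mul_le_mul_of_nonneg_left hFn hA0)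
    _ = (c + 15) * (B ^ 2 * ((2 * (2 ^ e) ^ 2) * (A * 6 ^ e))) *
        (((n : ℝ) ^ (δ / 4)) ^ 2 * ((n : ℝ) ^ 2 * (n : ℝ) ^ (1 - δ))) := by ring
    _ = _ := by rw [rpow_mul_rpow_bound hn0]

theorem SolvableInTime.mono {Q : Problem} {f g : ℕ → ℝ} (h : SolvableInTime Q f)
    (hf : ∀ n, 1 ≤ n → 0 ≤ f n) (hfg : ∀ n, 1 ≤ n → f n ≤ g n) : SolvableInTime Q g := by
  obtain ⟨P, k, K, hP⟩ := h
  refine ⟨P, k, |K|, fun n hn x => ?_⟩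
  obtain ⟨s, t, hex, ht, hs⟩ := hP n hn x
  refine ⟨s, t, hex, ht.trans ?_, hs⟩
  exact mul_le_mul (le_abs_self K) (hfg n hn) (hf n hn) (abs_nonneg K)

end WordRAM

/-- The hypothesis is applied with the saving `δ / 6` that `solvable_apsp` delivers, and its
exponent `c` determines the bound on the Viterbi entries. -/
theorem theorem1 (hAPSP : APSPConjecture) (α : ℚ) (hα : 0 < α) :
    RequiresTime (viterbiProblem α) (fun n => (numObs α n : ℝ) * (n : ℝ) ^ 2) := by
  intro ε hε
  obtain ⟨p, q, hp, hq, rfl⟩ : ∃ p q : ℕ, 0 < p ∧ 0 < q ∧ α = (p : ℚ) / q := by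
    refine ⟨α.num.toNat, α.den, ?_, α.den_pos, ?_⟩
    · have := Rat.num_pos.2 hα
      omega
    · have h : ((α.num.toNat : ℤ) : ℚ) = α.num := by
        rw [Int.toNat_of_nonneg (Rat.num_pos.2 hα).le]
      rw [← Int.cast_natCast, h, Rat.num_div_den]
  -- A smaller saving is a weaker demand, since `T * n ^ 2 ≥ 1`. Capping it at `1 / e` also covers
  -- `ε ≥ 1` and keeps the cost of writing the instances within the bound.
  set δ := min ε (1 / ((p + 2 * q : ℕ) : ℝ)) with hδ
  have hδ0 : 0 < δ := lt_min hε (by positivity)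
  obtain ⟨c, hc⟩ := hAPSP (δ / 6) (by positivity)
  refine ⟨(p + 2 * q) * (c + 1) + 1, fun h => hc ?_⟩
  refine solvable_apsp hp hq c hδ0 (min_le_right _ _) (h.mono ?_ ?_)
  · intro n _
    positivity
  · intro n hn
    refine Real.rpow_le_rpow_of_exponent_le ?_ (by linarith [min_le_left ε (1 / ((p + 2 * q : ℕ) : ℝ))])
    have hn1 : (1 : ℝ) ≤ n := by exact_mod_cast hn
    have h1 : (1 : ℝ) ≤ numObs ((p : ℚ) / q) n := by
      refine le_trans ?_ (Nat.le_ceil _)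
      exact Real.one_le_rpow hn1 (by exact_mod_cast hα.le)
    exact one_le_mul_of_one_le_of_one_le h1 (one_le_pow₀ hn1)
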